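/- Let $(\widetilde M,g,J)$ be a Kähler manifold of real dimension $2m$ with Levi-Civita connection $\widetilde\nabla$ and constant holomorphic sectional curvature $\mu\in\mathbb R$, i.e. $g(\widetilde R(x,Jx)Jx,x)=\mu\,g(x,x)^2$ for all tangent vectors $x$, where curvature tensors are taken with the sign $R(X,Y)=\nabla_X\nabla_Y-\nabla_Y\nabla_X-\nabla_{[X,Y]}$. Let $M$ be an (immersed) $n$-dimensional submanifold of $\widetilde M$ with $n>1$. For tangent fields $X,Y$ and normal fields $\xi$ on $M$ write $\widetilde\nabla_XY=\nabla_XY+\sigma(X,Y)$ and $\widetilde\nabla_X\xi=-A_\xi X+D_X\xi$ for the decompositions into tangential and normal components, let $R$ and $R^\perp$ be the curvature tensors of the induced connection $\nabla$ and of the normal connection $D$, and let $f\xi$ be the normal component of $J\xi$. Assume that 1. $M$ is totally real: $J\,T_pM\subset (T_pM)^\perp$ for all $p\in M$; 2. $M$ is semiparallel: $R^\perp(X,Y)\sigma(Z,U)-\sigma(R(X,Y)Z,U)-\sigma(Z,R(X,Y)U)=0$ for all tangent fields $X,Y,Z,U$; 3. $M$ has commutative second fundamental forms: $A_\xi A_\eta=A_\eta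 A_\xi$ for all normal fields $\xi,\eta$; 4. the $f$-structure in the normal bundle is parallel: $D_X(f\xi)=f D_X\xi$ for all tangent fields $X$ and normal fields $\xi$ (the case $f=0$ is allowed). Then $M$ is totally geodesic ($\sigma=0$ on all of $M$) or flat ($R=0$ on all of $M$). -/

import Mathlib

open Bundle
open scoped Manifold ContDiff Topology

noncomputable section

namespace KaehlerSubmanifold

section Curvature

variable {E : Type*} [NormedAddCommGroup E] [NormedSpace ℝ E]
  {M : Type*} [TopologicalSpace M] [ChartedSpace E M] [IsManifold 𝓘(ℝ, E) ∞ M]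
  {V : M → Type*} [∀ p, AddCommGroup (V p)]

/-- The vector field `X` is smooth on a neighbourhood of `p`. -/
def SmoothNear (X : ∀ q : M, TangentSpace 𝓘(ℝ, E) q) (p : M) : Prop :=
  ∀ᶠ q in 𝓝 p, ContMDiffAt 𝓘(ℝ, E) 𝓘(ℝ, E).tangent ∞
    (fun r ↦ (⟨r, X r⟩ : TangentBundle 𝓘(ℝ, E) M)) q

/-- `D s q v` is the covariant derivative of the section `s` at `q` in the direction `v`; this is
`D_X (D_Y s) - D_Y (D_X s) - D_{[X, Y]} s` at the point `p`. -/
def curvature (D : (∀ q : M, V q) → ∀ q : M, TangentSpace 𝓘(ℝ, E) q → V q)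
    (X Y : ∀ q : M, TangentSpace 𝓘(ℝ, E) q) (s : ∀ q : M, V q) (p : M) : V p :=
  D (fun q ↦ D s q (Y q)) p (X p) - D (fun q ↦ D s q (X q)) p (Y p)
    - D s p (VectorField.mlieBracket 𝓘(ℝ, E) X Y p)

end Curvature

section Ambient

variable {F : Type*} [NormedAddCommGroup F] [NormedSpace ℝ F] [FiniteDimensional ℝ F]
  {N : Type*} [TopologicalSpace N] [ChartedSpace F N] [IsManifold 𝓘(ℝ, F) ∞ N]
  [RiemannianBundle (fun x : N ↦ TangentSpace 𝓘(ℝ, F) x)]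
  [IsContMDiffRiemannianBundle 𝓘(ℝ, F) ∞ F (fun x : N ↦ TangentSpace 𝓘(ℝ, F) x)]

/-- `(N, g, J, ∇)` is a Kähler manifold: `∇` is the Levi-Civita connection of the Riemannian metric
`g` of `N`, and `J` is a smooth, `g`-orthogonal and `∇`-parallel almost complex structure. -/
structure IsKaehler
    (cov : CovariantDerivative 𝓘(ℝ, F) F (fun x : N ↦ TangentSpace 𝓘(ℝ, F) x))
    (J : ∀ x : N, TangentSpace 𝓘(ℝ, F) x →L[ℝ] TangentSpace 𝓘(ℝ, F) x) : Prop where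
  /-- `∇` is a smooth connection: it maps smooth fields to smooth fields. -/
  smooth_cov : cov.ContMDiffCovariantDerivative ∞
  torsion_free : cov.torsion = 0
  metric : CovariantDerivative.IsMetricCompatible (F := F)
    (V := fun x : N ↦ TangentSpace 𝓘(ℝ, F) x) cov
  smooth_J : ContMDiff 𝓘(ℝ, F) (𝓘(ℝ, F).prod 𝓘(ℝ, F →L[ℝ] F)) ∞
    (fun x ↦ TotalSpace.mk' (F →L[ℝ] F)
      (E := fun x : N ↦ TangentSpace 𝓘(ℝ, F) x →L[ℝ] TangentSpace 𝓘(ℝ, F) x) x (J x))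
  J_sq : ∀ (x : N) (v : TangentSpace 𝓘(ℝ, F) x), J x (J x v) = -v
  J_orthogonal : ∀ (x : N) (v w : TangentSpace 𝓘(ℝ, F) x),
    inner ℝ (J x v) (J x w) = inner ℝ v w
  J_parallel : ∀ (x : N) (Y : ∀ y : N, TangentSpace 𝓘(ℝ, F) y), SmoothNear Y x →
    ∀ v : TangentSpace 𝓘(ℝ, F) x, cov (fun y ↦ J y (Y y)) x v = J x (cov Y x v)

/-- The holomorphic sectional curvature is the constant `μ`:
`g(R(X, JX)JX, X) = μ g(X, X)²` for every vector field `X`. -/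
def HasConstantHolomorphicCurvature
    (cov : CovariantDerivative 𝓘(ℝ, F) F (fun x : N ↦ TangentSpace 𝓘(ℝ, F) x))
    (J : ∀ x : N, TangentSpace 𝓘(ℝ, F) x →L[ℝ] TangentSpace 𝓘(ℝ, F) x) (μ : ℝ) : Prop :=
  ∀ (x : N) (X : ∀ y : N, TangentSpace 𝓘(ℝ, F) y), SmoothNear X x →
    inner ℝ (curvature (fun s y v ↦ cov s y v) X (fun y ↦ J y (X y)) (fun y ↦ J y (X y)) x) (X x)
      = μ * (inner ℝ (X x) (X x)) ^ 2

end Ambient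

section Submanifold

variable {E : Type*} [NormedAddCommGroup E] [NormedSpace ℝ E] [FiniteDimensional ℝ E]
  {M : Type*} [TopologicalSpace M] [ChartedSpace E M] [IsManifold 𝓘(ℝ, E) ∞ M]
  {F : Type*} [NormedAddCommGroup F] [NormedSpace ℝ F] [FiniteDimensional ℝ F]
  {N : Type*} [TopologicalSpace N] [ChartedSpace F N] [IsManifold 𝓘(ℝ, F) ∞ N]

variable (E F) in
/-- `ι : M → N` is a smooth immersion, i.e. it makes `M` an (immersed) submanifold of `N`. -/
structure IsSubmanifold (ι : M → N) : Prop where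
  smooth : ContMDiff 𝓘(ℝ, E) 𝓘(ℝ, F) ∞ ι
  injective : ∀ p : M, Function.Injective (mfderiv 𝓘(ℝ, E) 𝓘(ℝ, F) ι p)

/-- The vector field `V` along `ι` is smooth on a neighbourhood of `p`. -/
def SmoothAlongNear (ι : M → N) (V : ∀ q : M, TangentSpace 𝓘(ℝ, F) (ι q)) (p : M) : Prop :=
  ∀ᶠ q in 𝓝 p, ContMDiffAt 𝓘(ℝ, E) 𝓘(ℝ, F).tangent ∞
    (fun r ↦ (⟨ι r, V r⟩ : TangentBundle 𝓘(ℝ, F) N)) q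

/-- A vector field on `M`, regarded as a vector field along `ι`. -/
def push (ι : M → N) (X : ∀ q : M, TangentSpace 𝓘(ℝ, E) q) (q : M) :
    TangentSpace 𝓘(ℝ, F) (ι q) :=
  mfderiv 𝓘(ℝ, E) 𝓘(ℝ, F) ι q (X q)

/-- The covariant derivative of a vector field `V` along `ι` at `p` in the direction `v ∈ T_p M`.
Let `c` be the coordinates of `V` in a local trivialization of `TN` around `ι p`. The value is
the derivative of `c` in the direction `v`, plus the covariant derivative in the direction
`dι v` of the local vector field of `N` which has the constant coordinates `c p`.
In a local frame `e_i`: `∇_v (∑ c_i (e_i ∘ ι)) = ∑ dc_i(v) e_i + ∑ c_i ∇_{dι v} e_i`. -/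
def covAlong (cov : CovariantDerivative 𝓘(ℝ, F) F (fun x : N ↦ TangentSpace 𝓘(ℝ, F) x))
    (ι : M → N) (V : ∀ q : M, TangentSpace 𝓘(ℝ, F) (ι q)) (p : M) (v : TangentSpace 𝓘(ℝ, E) p) :
    TangentSpace 𝓘(ℝ, F) (ι p) :=
  let e := trivializationAt F (fun x : N ↦ TangentSpace 𝓘(ℝ, F) x) (ι p)
  let c : M → F := fun q ↦ (e ⟨ι q, V q⟩).2
  e.symm (ι p) (mfderiv 𝓘(ℝ, E) 𝓘(ℝ, F) c p v)
    + cov (fun y ↦ e.symm y (c p)) (ι p) (mfderiv 𝓘(ℝ, E) 𝓘(ℝ, F) ι p v)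

variable [RiemannianBundle (fun x : N ↦ TangentSpace 𝓘(ℝ, F) x)]

variable (E) in
/-- The tangent space of the submanifold at `p`, as a subspace of `T_{ι p} N`. -/
def tangentSubspace (ι : M → N) (p : M) : Submodule ℝ (TangentSpace 𝓘(ℝ, F) (ι p)) :=
  LinearMap.range (mfderiv 𝓘(ℝ, E) 𝓘(ℝ, F) ι p).toLinearMap

instance (ι : M → N) (p : M) : FiniteDimensional ℝ (tangentSubspace E (F := F) ι p) := by
  have : FiniteDimensional ℝ (TangentSpace 𝓘(ℝ, E) p) := inferInstanceAs (FiniteDimensional ℝ E)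
  unfold tangentSubspace
  infer_instance

variable (E) in
/-- The normal component of `w ∈ T_{ι p} N`. -/
def normalPart (ι : M → N) (p : M) (w : TangentSpace 𝓘(ℝ, F) (ι p)) :
    TangentSpace 𝓘(ℝ, F) (ι p) :=
  w - (tangentSubspace E ι p).starProjection w

variable (E) in
/-- The tangential component of `w ∈ T_{ι p} N`, as a vector of `T_p M`. -/
def tangentPart (ι : M → N) (p : M) (w : TangentSpace 𝓘(ℝ, F) (ι p)) : TangentSpace 𝓘(ℝ, E) p :=
  (mfderiv 𝓘(ℝ, E) 𝓘(ℝ, F) ι p).toLinearMap.leftInverse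
    ((tangentSubspace E ι p).starProjection w)

variable (E) in
/-- `ξ` is a normal vector field which is smooth on a neighbourhood of `p`. -/
def SmoothNormalNear (ι : M → N) (ξ : ∀ q : M, TangentSpace 𝓘(ℝ, F) (ι q)) (p : M) : Prop :=
  SmoothAlongNear (E := E) ι ξ p ∧ ∀ᶠ q in 𝓝 p, ξ q ∈ (tangentSubspace E ι q)ᗮ

variable (cov : CovariantDerivative 𝓘(ℝ, F) F (fun x : N ↦ TangentSpace 𝓘(ℝ, F) x))

/-- The induced covariant differentiation of `M`: `∇_v Y` is the tangential component of the
covariant derivative of `Y` in `N`. -/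
def inducedConnection (ι : M → N) (Y : ∀ q : M, TangentSpace 𝓘(ℝ, E) q) (p : M)
    (v : TangentSpace 𝓘(ℝ, E) p) : TangentSpace 𝓘(ℝ, E) p :=
  tangentPart E ι p (covAlong cov ι (push ι Y) p v)

/-- The second fundamental form: `σ(X, Y)` is the normal component of the covariant derivative
of `Y` in the direction of `X` in `N`. -/
def secondFundamentalForm (ι : M → N) (X Y : ∀ q : M, TangentSpace 𝓘(ℝ, E) q) (p : M) :
    TangentSpace 𝓘(ℝ, F) (ι p) :=
  normalPart E ι p (covAlong cov ι (push ι Y) p (X p))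

/-- The shape operator: `-A_ξ v` is the tangential component of the covariant derivative of `ξ`. -/
def shapeOperator (ι : M → N) (ξ : ∀ q : M, TangentSpace 𝓘(ℝ, F) (ι q)) (p : M)
    (v : TangentSpace 𝓘(ℝ, E) p) : TangentSpace 𝓘(ℝ, E) p :=
  -tangentPart E ι p (covAlong cov ι ξ p v)

/-- The normal connection: `D_v ξ` is the normal component of the covariant derivative of `ξ`. -/
def normalConnection (ι : M → N) (ξ : ∀ q : M, TangentSpace 𝓘(ℝ, F) (ι q)) (p : M)
    (v : TangentSpace 𝓘(ℝ, E) p) : TangentSpace 𝓘(ℝ, F) (ι p) :=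
  normalPart E ι p (covAlong cov ι ξ p v)

/-- The curvature tensor `R(X, Y)Z` of `M`. -/
def tangentCurvature (ι : M → N) (X Y Z : ∀ q : M, TangentSpace 𝓘(ℝ, E) q) (p : M) :
    TangentSpace 𝓘(ℝ, E) p :=
  curvature (inducedConnection cov ι) X Y Z p

/-- The curvature tensor `R^⊥(X, Y)ξ` of the normal connection. -/
def normalCurvature (ι : M → N) (X Y : ∀ q : M, TangentSpace 𝓘(ℝ, E) q)
    (ξ : ∀ q : M, TangentSpace 𝓘(ℝ, F) (ι q)) (p : M) : TangentSpace 𝓘(ℝ, F) (ι p) :=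
  curvature (V := fun q ↦ TangentSpace 𝓘(ℝ, F) (ι q)) (normalConnection cov ι) X Y ξ p

variable (E) in
/-- `J` maps the tangent spaces of `M` into the normal spaces. -/
def IsTotallyReal (J : ∀ x : N, TangentSpace 𝓘(ℝ, F) x →L[ℝ] TangentSpace 𝓘(ℝ, F) x)
    (ι : M → N) : Prop :=
  ∀ (p : M), ∀ w ∈ tangentSubspace E ι p, J (ι p) w ∈ (tangentSubspace E ι p)ᗮ

variable (E) in
/-- Commutative second fundamental forms: `[A_ξ, A_η] = 0` for all normal fields `ξ`, `η`. -/
def HasCommutativeSecondForms (ι : M → N) : Prop :=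
  ∀ (p : M) (ξ η : ∀ q : M, TangentSpace 𝓘(ℝ, F) (ι q)),
    SmoothNormalNear E ι ξ p → SmoothNormalNear E ι η p →
    ∀ v : TangentSpace 𝓘(ℝ, E) p,
      shapeOperator cov ι ξ p (shapeOperator cov ι η p v)
        = shapeOperator cov ι η p (shapeOperator cov ι ξ p v)

variable (E) in
/-- The endomorphism `f` of the normal bundle, `f ξ` being the normal component of `J ξ`. -/
def normalF (J : ∀ x : N, TangentSpace 𝓘(ℝ, F) x →L[ℝ] TangentSpace 𝓘(ℝ, F) x)
    (ι : M → N) (p : M) (ξ : TangentSpace 𝓘(ℝ, F) (ι p)) : TangentSpace 𝓘(ℝ, F) (ι p) :=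
  normalPart E ι p (J (ι p) ξ)

variable (E) in
/-- The `f`-structure in the normal bundle is parallel: `D_v (f ξ) = f (D_v ξ)`. -/
def HasParallelF (J : ∀ x : N, TangentSpace 𝓘(ℝ, F) x →L[ℝ] TangentSpace 𝓘(ℝ, F) x)
    (ι : M → N) : Prop :=
  ∀ (p : M) (ξ : ∀ q : M, TangentSpace 𝓘(ℝ, F) (ι q)), SmoothNormalNear E ι ξ p →
    ∀ v : TangentSpace 𝓘(ℝ, E) p,
      normalConnection cov ι (fun q ↦ normalF E J ι q (ξ q)) p v
        = normalF E J ι p (normalConnection cov ι ξ p v)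

variable (E) in
/-- `M` is semiparallel: `R^⊥(X, Y)σ(Z, U) - σ(R(X, Y)Z, U) - σ(Z, R(X, Y)U) = 0`. -/
def IsSemiparallel (ι : M → N) : Prop :=
  ∀ (p : M) (X Y Z U : ∀ q : M, TangentSpace 𝓘(ℝ, E) q),
    SmoothNear X p → SmoothNear Y p → SmoothNear Z p → SmoothNear U p →
    normalCurvature cov ι X Y (secondFundamentalForm cov ι Z U) p
      - secondFundamentalForm cov ι (tangentCurvature cov ι X Y Z) U p
      - secondFundamentalForm cov ι Z (tangentCurvature cov ι X Y U) p = 0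

variable (E) in
/-- `M` is totally geodesic: `σ = 0`. -/
def IsTotallyGeodesic (ι : M → N) : Prop :=
  ∀ (p : M) (X Y : ∀ q : M, TangentSpace 𝓘(ℝ, E) q),
    SmoothNear X p → SmoothNear Y p → secondFundamentalForm cov ι X Y p = 0

variable (E) in
/-- `M` is flat: its curvature tensor `R` vanishes. -/
def IsFlat (ι : M → N) : Prop :=
  ∀ (p : M) (X Y Z : ∀ q : M, TangentSpace 𝓘(ℝ, E) q),
    SmoothNear X p → SmoothNear Y p → SmoothNear Z p → tangentCurvature cov ι X Y Z p = 0

end Submanifold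

end KaehlerSubmanifold

end

/-! Idea. Since `J` is parallel on `N`, everything reduces to the cubic form `C(u, v, w) = ⟨σ(u, v),
Jw⟩`. It is symmetric: in the first two slots because the connection is torsion-free, in the last
two by differentiating `⟨JV, W⟩ = 0` (`inner_secondForm_comm`).

For tangent `w` the normal field `JW` satisfies `f(JW) = 0`, so parallelism of `f` gives `f²σ(v, w)
= 0`. As `f` is skew-adjoint, `fσ = 0`, i.e. `Jσ` is tangent to `M`
(`normalPart_complexStructure_secondForm`). Hence `JA_{JX}v = σ(v, X)`, and commutativity of the
shape operators `A_{JX}`, `A_{JY}` says exactly that the two `σ`-terms of the Gauss equation cancel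
(`inner_secondForm_secondForm_comm`). The curvature of a complex space form on totally real vectors
is that of a real space form of curvature `μ/4`, so `M` has constant curvature `μ/4`
(`tangentCurvature_eq`). If `μ = 0`, then `M` is flat.

Let `μ ≠ 0`. Again because `fσ = 0`, `J` carries `∇` to `D` on `J(TM)`, hence `R` to `R^⊥`.
Semiparallelity for `X = x` and `Y = Z = U = y` with `x ⊥ y` then becomes `C(y, y, y)Jx - C(y, y,
x)Jy = 2|y|²σ(x, y)` (`semiparallel_identity`). Pairing with `Jy` gives `C(x, y, y) = 0`; pairing
with `Jx`, for some `x ≠ 0` orthogonal to `y`, which exists because `n > 1`, gives `C(y, y, y) = 0`.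
Polarization yields `C = 0`, and as `Jσ` is tangent this means `σ = 0` (`secondForm_eq_zero`).

Most of the file supplies the geometry behind these lines: `covAlong` is a metric, torsion-free
connection for which `J` is parallel and whose curvature is the pullback of that of `N`
(`curvature_covAlong`). These facts are checked in coordinate frames. -/

set_option linter.unusedSectionVars false

noncomputable section

namespace KaehlerSubmanifold

/-! ### Real functions smooth near a point -/

section SmoothFunctions

variable {E : Type*} [NormedAddCommGroup E] [NormedSpace ℝ E]
  {M : Type*} [TopologicalSpace M] [ChartedSpace E M]

variable (E) in
/-- The function `c` is smooth on a neighbourhood of `p`. -/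
def SmoothFnNear (c : M → ℝ) (p : M) : Prop :=
  ∀ᶠ q in 𝓝 p, ContMDiffAt 𝓘(ℝ, E) 𝓘(ℝ, ℝ) ∞ c q

namespace SmoothFnNear

variable {c d : M → ℝ} {p : M}

lemma contMDiffAt (hc : SmoothFnNear E c p) : ContMDiffAt 𝓘(ℝ, E) 𝓘(ℝ, ℝ) ∞ c p :=
  Filter.Eventually.self_of_nhds hc

lemma mdifferentiableAt (hc : SmoothFnNear E c p) :
    MDifferentiableAt 𝓘(ℝ, E) 𝓘(ℝ, ℝ) c p :=
  hc.contMDiffAt.mdifferentiableAt (by simp)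

/-- Smoothness is required on a neighbourhood because `ContMDiffAt` of order `∞` at one point need
not persist at nearby points; here persistence is automatic. -/
lemma eventually (hc : SmoothFnNear E c p) : ∀ᶠ q in 𝓝 p, SmoothFnNear E c q :=
  eventually_eventually_nhds.2 hc

lemma const (a : ℝ) : SmoothFnNear E (fun _ : M ↦ a) p :=
  .of_forall fun _ ↦ contMDiffAt_const

lemma add (hc : SmoothFnNear E c p) (hd : SmoothFnNear E d p) :
    SmoothFnNear E (fun q ↦ c q + d q) p := by
  filter_upwards [hc, hd] with q h1 h2 using h1.add h2

lemma sub (hc : SmoothFnNear E c p) (hd : SmoothFnNear E d p) :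
    SmoothFnNear E (fun q ↦ c q - d q) p := by
  filter_upwards [hc, hd] with q h1 h2 using h1.sub h2

lemma mul (hc : SmoothFnNear E c p) (hd : SmoothFnNear E d p) :
    SmoothFnNear E (fun q ↦ c q * d q) p := by
  filter_upwards [hc, hd] with q h1 h2 using h1.mul h2

lemma sum {κ : Type*} (s : Finset κ) {f : κ → M → ℝ} (hf : ∀ i ∈ s, SmoothFnNear E (f i) p) :
    SmoothFnNear E (fun q ↦ ∑ i ∈ s, f i q) p := by
  filter_upwards [(Filter.eventually_all_finset s).2 hf] with q hq
  exact contMDiffAt_finsetSum hq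

lemma prod {κ : Type*} (s : Finset κ) {f : κ → M → ℝ} (hf : ∀ i ∈ s, SmoothFnNear E (f i) p) :
    SmoothFnNear E (fun q ↦ ∏ i ∈ s, f i q) p := by
  filter_upwards [(Filter.eventually_all_finset s).2 hf] with q hq
  exact contMDiffAt_finsetProd hq

lemma inv (hc : SmoothFnNear E c p) (h0 : c p ≠ 0) : SmoothFnNear E (fun q ↦ (c q)⁻¹) p := by
  have h1 : ∀ᶠ q in 𝓝 p, c q ≠ 0 := hc.contMDiffAt.continuousAt.eventually_ne h0
  filter_upwards [hc, h1] with q h1 h2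
  exact (contDiffAt_inv ℝ h2).contMDiffAt.comp q h1

lemma det {κ : Type*} [Fintype κ] [DecidableEq κ] {A : M → Matrix κ κ ℝ}
    (hA : ∀ i j, SmoothFnNear E (fun q ↦ A q i j) p) : SmoothFnNear E (fun q ↦ (A q).det) p := by
  simp only [Matrix.det_apply']
  exact sum _ fun s _ ↦ (const _).mul (prod _ fun i _ ↦ hA _ _)

end SmoothFnNear

end SmoothFunctions

/-! ### Local frames of the tangent bundle -/

section Frames

variable {F : Type*} [NormedAddCommGroup F] [NormedSpace ℝ F] [FiniteDimensional ℝ F]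
  {N : Type*} [TopologicalSpace N] [ChartedSpace F N] [IsManifold 𝓘(ℝ, F) ∞ N]

variable (F) in
/-- The domain of the preferred trivialization of the tangent bundle around `y`. -/
def frameDomain (y : N) : Set N :=
  (trivializationAt F (fun x : N ↦ TangentSpace 𝓘(ℝ, F) x) y).baseSet

/-- The local frame of the tangent bundle given by the preferred trivialization around `y`. -/
def frame (y : N) (i : Fin (Module.finrank ℝ F)) (x : N) : TangentSpace 𝓘(ℝ, F) x :=
  (trivializationAt F (fun x : N ↦ TangentSpace 𝓘(ℝ, F) x) y).localFrame
    (Module.finBasis ℝ F) i x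

/-- The coefficients of a tangent vector in the local frame around `y`. -/
def frameCoeff (y : N) (i : Fin (Module.finrank ℝ F)) (x : N) :
    TangentSpace 𝓘(ℝ, F) x →ₗ[ℝ] ℝ :=
  (trivializationAt F (fun x : N ↦ TangentSpace 𝓘(ℝ, F) x) y).localFrameCoeff 𝓘(ℝ, F)
    (Module.finBasis ℝ F) i x

lemma mem_frameDomain (y : N) : y ∈ frameDomain F y :=
  FiberBundle.mem_baseSet_trivializationAt' y

lemma isOpen_frameDomain (y : N) : IsOpen (frameDomain F y) :=
  (trivializationAt F (fun x : N ↦ TangentSpace 𝓘(ℝ, F) x) y).open_baseSet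

lemma frame_smoothNear {y x : N} (hx : x ∈ frameDomain F y) (i : Fin (Module.finrank ℝ F)) :
    SmoothNear (frame y i) x := by
  filter_upwards [(isOpen_frameDomain y).mem_nhds hx] with z hz
  exact contMDiffAt_localFrame_of_mem _ _ _ i hz

lemma sum_frameCoeff_smul_frame {y x : N} (hx : x ∈ frameDomain F y) (v : TangentSpace 𝓘(ℝ, F) x) :
    ∑ i, frameCoeff y i x v • frame y i x = v := by
  classical
  -- The expansion is stated for sections, so the single vector `v` is turned into the section that
  -- is `v` at `x` and `0` elsewhere.
  have := (trivializationAt F (fun x : N ↦ TangentSpace 𝓘(ℝ, F) x) y).eq_sum_localFrameCoeff_smul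
    (I := 𝓘(ℝ, F)) (b := Module.finBasis ℝ F) (s := Function.update 0 x v) hx
  simp only [Function.update_self] at this
  exact this.symm

lemma frameCoeff_eq {y x : N} (hx : x ∈ frameDomain F y) (i : Fin (Module.finrank ℝ F))
    (v : TangentSpace 𝓘(ℝ, F) x) :
    frameCoeff y i x v = (Module.finBasis ℝ F).repr
      (trivializationAt F (fun x : N ↦ TangentSpace 𝓘(ℝ, F) x) y ⟨x, v⟩).2 i := by
  classical
  have := (trivializationAt F (fun x : N ↦ TangentSpace 𝓘(ℝ, F) x) y).localFrameCoeff_eq_coeff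
    (I := 𝓘(ℝ, F)) (b := Module.finBasis ℝ F) (s := Function.update 0 x v) hx (i := i)
  simp only [Function.update_self] at this
  exact this

lemma SmoothNear.contMDiffAt {X : ∀ q : N, TangentSpace 𝓘(ℝ, F) q} {x : N} (hX : SmoothNear X x) :
    ContMDiffAt 𝓘(ℝ, F) 𝓘(ℝ, F).tangent ∞ (fun r ↦ (⟨r, X r⟩ : TangentBundle 𝓘(ℝ, F) N)) x :=
  Filter.Eventually.self_of_nhds hX

lemma SmoothNear.mdifferentiableAt {X : ∀ q : N, TangentSpace 𝓘(ℝ, F) q} {x : N}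
    (hX : SmoothNear X x) :
    MDifferentiableAt 𝓘(ℝ, F) 𝓘(ℝ, F).tangent
      (fun r ↦ (⟨r, X r⟩ : TangentBundle 𝓘(ℝ, F) N)) x :=
  hX.contMDiffAt.mdifferentiableAt (by simp)

lemma SmoothNear.eventually {X : ∀ q : N, TangentSpace 𝓘(ℝ, F) q} {x : N} (hX : SmoothNear X x) :
    ∀ᶠ z in 𝓝 x, SmoothNear X z :=
  eventually_eventually_nhds.2 hX

end Frames

/-! ### Smooth fields along a map -/

section AlongMaps

variable {E : Type*} [NormedAddCommGroup E] [NormedSpace ℝ E]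
  {M : Type*} [TopologicalSpace M] [ChartedSpace E M] [IsManifold 𝓘(ℝ, E) ∞ M]
  {F : Type*} [NormedAddCommGroup F] [NormedSpace ℝ F] [FiniteDimensional ℝ F]
  {N : Type*} [TopologicalSpace N] [ChartedSpace F N] [IsManifold 𝓘(ℝ, F) ∞ N]

/-- In a trivialization, smoothness into the total space splits into smoothness of the base map,
given by `hι`, and of the fibre coordinate, which is tested on a basis of `F`. The centre `y` is
free, so one frame serves a whole neighbourhood of `p`. -/
lemma contMDiffAt_along_iff {ι : M → N} {V : ∀ q : M, TangentSpace 𝓘(ℝ, F) (ι q)} {p : M}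
    (hι : ContMDiffAt 𝓘(ℝ, E) 𝓘(ℝ, F) ∞ ι p) {y : N} (hy : ι p ∈ frameDomain F y) :
    ContMDiffAt 𝓘(ℝ, E) 𝓘(ℝ, F).tangent ∞
      (fun r ↦ (⟨ι r, V r⟩ : TangentBundle 𝓘(ℝ, F) N)) p ↔
    ∀ i, ContMDiffAt 𝓘(ℝ, E) 𝓘(ℝ, ℝ) ∞ (fun q ↦ frameCoeff y i (ι q) (V q)) p := by
  set e := trivializationAt F (fun x : N ↦ TangentSpace 𝓘(ℝ, F) x) y with he
  have hmem : ∀ᶠ q in 𝓝 p, ι q ∈ frameDomain F y :=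
    hι.continuousAt.eventually ((isOpen_frameDomain y).mem_nhds hy)
  have h1 := e.contMDiffAt_iff (IM := 𝓘(ℝ, E)) (IB := 𝓘(ℝ, F)) (n := ∞) (x₀ := p)
    (f := fun r ↦ (⟨ι r, V r⟩ : TangentBundle 𝓘(ℝ, F) N)) (e.mem_source.2 hy)
  refine h1.trans ?_
  simp only [hι, true_and]
  have h2 : ContMDiffAt 𝓘(ℝ, E) 𝓘(ℝ, F) ∞
      (fun x ↦ (e (⟨ι x, V x⟩ : TangentBundle 𝓘(ℝ, F) N)).2) p ↔
      ContMDiffAt 𝓘(ℝ, E) 𝓘(ℝ, Fin (Module.finrank ℝ F) → ℝ) ∞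
      (fun x ↦ (Module.finBasis ℝ F).equivFunL
        (e (⟨ι x, V x⟩ : TangentBundle 𝓘(ℝ, F) N)).2) p := by
    constructor
    · intro h
      exact ((Module.finBasis ℝ F).equivFunL.contDiff.contMDiff.contMDiffAt).comp p h
    · intro h
      have := ((Module.finBasis ℝ F).equivFunL.symm.contDiff
        (n := ∞)).contMDiff.contMDiffAt.comp p h
      refine this.congr_of_eventuallyEq (.of_forall fun q ↦ ?_)
      simp
  rw [h2, contMDiffAt_pi_space]
  refine forall_congr' fun i ↦ Filter.EventuallyEq.contMDiffAt_iff ?_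
  filter_upwards [hmem] with q hq
  rw [frameCoeff_eq hq]
  rfl

variable {ι : M → N} {V W : ∀ q : M, TangentSpace 𝓘(ℝ, F) (ι q)} {p : M}

lemma smoothAlongNear_iff (hι : ContMDiff 𝓘(ℝ, E) 𝓘(ℝ, F) ∞ ι) {y : N}
    (hy : ι p ∈ frameDomain F y) :
    SmoothAlongNear (E := E) ι V p ↔
      ∀ i, SmoothFnNear E (fun q ↦ frameCoeff y i (ι q) (V q)) p := by
  have hmem : ∀ᶠ q in 𝓝 p, ι q ∈ frameDomain F y :=
    hι.continuous.continuousAt.eventually ((isOpen_frameDomain y).mem_nhds hy)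
  unfold SmoothAlongNear SmoothFnNear
  rw [← Filter.eventually_all]
  refine Filter.eventually_congr ?_
  filter_upwards [hmem] with q hq using contMDiffAt_along_iff (hι q) hq

namespace SmoothAlongNear

lemma contMDiffAt (hV : SmoothAlongNear (E := E) ι V p) : ContMDiffAt 𝓘(ℝ, E) 𝓘(ℝ, F).tangent ∞
    (fun r ↦ (⟨ι r, V r⟩ : TangentBundle 𝓘(ℝ, F) N)) p :=
  Filter.Eventually.self_of_nhds hV

lemma eventually (hV : SmoothAlongNear (E := E) ι V p) :
    ∀ᶠ q in 𝓝 p, SmoothAlongNear (E := E) ι V q :=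
  eventually_eventually_nhds.2 hV

lemma congr (hV : SmoothAlongNear (E := E) ι V p) (h : ∀ᶠ q in 𝓝 p, W q = V q) :
    SmoothAlongNear (E := E) ι W p := by
  filter_upwards [Filter.Eventually.and hV (eventually_eventually_nhds.2 h)] with q hq
  refine hq.1.congr_of_eventuallyEq ?_
  filter_upwards [hq.2] with r hr
  rw [hr]

lemma smoothFnNear_frameCoeff (hι : ContMDiff 𝓘(ℝ, E) 𝓘(ℝ, F) ∞ ι)
    (hV : SmoothAlongNear (E := E) ι V p) {y : N} (hy : ι p ∈ frameDomain F y)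
    (i : Fin (Module.finrank ℝ F)) : SmoothFnNear E (fun q ↦ frameCoeff y i (ι q) (V q)) p :=
  (smoothAlongNear_iff hι hy).1 hV i

lemma add (hι : ContMDiff 𝓘(ℝ, E) 𝓘(ℝ, F) ∞ ι) (hV : SmoothAlongNear (E := E) ι V p)
    (hW : SmoothAlongNear (E := E) ι W p) : SmoothAlongNear (E := E) ι (fun q ↦ V q + W q) p := by
  rw [smoothAlongNear_iff hι (mem_frameDomain _)] at *
  intro i
  simp only [map_add]
  exact (hV i).add (hW i)

lemma sub (hι : ContMDiff 𝓘(ℝ, E) 𝓘(ℝ, F) ∞ ι) (hV : SmoothAlongNear (E := E) ι V p)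
    (hW : SmoothAlongNear (E := E) ι W p) : SmoothAlongNear (E := E) ι (fun q ↦ V q - W q) p := by
  rw [smoothAlongNear_iff hι (mem_frameDomain _)] at *
  intro i
  simp only [map_sub]
  exact (hV i).sub (hW i)

lemma smul (hι : ContMDiff 𝓘(ℝ, E) 𝓘(ℝ, F) ∞ ι) {c : M → ℝ} (hc : SmoothFnNear E c p)
    (hV : SmoothAlongNear (E := E) ι V p) : SmoothAlongNear (E := E) ι (fun q ↦ c q • V q) p := by
  rw [smoothAlongNear_iff hι (mem_frameDomain _)] at *
  intro i
  simp only [map_smul, smul_eq_mul]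
  exact hc.mul (hV i)

lemma sum (hι : ContMDiff 𝓘(ℝ, E) 𝓘(ℝ, F) ∞ ι) {κ : Type*} (s : Finset κ)
    {V : κ → ∀ q : M, TangentSpace 𝓘(ℝ, F) (ι q)}
    (hV : ∀ k ∈ s, SmoothAlongNear (E := E) ι (V k) p) :
    SmoothAlongNear (E := E) ι (fun q ↦ ∑ k ∈ s, V k q) p := by
  rw [smoothAlongNear_iff hι (mem_frameDomain _)]
  intro i
  simp only [map_sum]
  exact .sum s fun k hk ↦ (smoothAlongNear_iff hι (mem_frameDomain _)).1 (hV k hk) i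

end SmoothAlongNear

lemma SmoothFnNear.comp (hι : ContMDiff 𝓘(ℝ, E) 𝓘(ℝ, F) ∞ ι) {c : N → ℝ}
    (hc : SmoothFnNear F c (ι p)) : SmoothFnNear E (fun q ↦ c (ι q)) p := by
  filter_upwards [hι.continuous.continuousAt.eventually hc] with q hq
  exact ContMDiffAt.comp q hq (hι q)

lemma SmoothNear.comp (hι : ContMDiff 𝓘(ℝ, E) 𝓘(ℝ, F) ∞ ι)
    {Z : ∀ x : N, TangentSpace 𝓘(ℝ, F) x} (hZ : SmoothNear Z (ι p)) :
    SmoothAlongNear (E := E) ι (fun q ↦ Z (ι q)) p := by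
  filter_upwards [hι.continuous.continuousAt.eventually hZ] with q hq
  exact ContMDiffAt.comp q hq (hι q)

lemma SmoothNear.smoothAlongNear_push (hι : ContMDiff 𝓘(ℝ, E) 𝓘(ℝ, F) ∞ ι)
    {X : ∀ q : M, TangentSpace 𝓘(ℝ, E) q} (hX : SmoothNear X p) :
    SmoothAlongNear (E := E) (F := F) ι (push ι X) p := by
  filter_upwards [hX] with q hq
  have h := (hι.contMDiff_tangentMap (m := ∞) (by simp)).contMDiffAt
    (x := (⟨q, X q⟩ : TangentBundle 𝓘(ℝ, E) M))
  exact h.comp q hq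

/-- The derivative of a smooth function in the direction of a smooth field is smooth. -/
lemma SmoothFnNear.mvfderiv {c : M → ℝ} (hc : SmoothFnNear E c p)
    {X : ∀ q : M, TangentSpace 𝓘(ℝ, E) q} (hX : SmoothNear X p) :
    SmoothFnNear E (fun q ↦ mvfderiv 𝓘(ℝ, E) c q (X q)) p := by
  obtain ⟨U, hU, hUo, hpU⟩ := eventually_nhds_iff.1 hc
  filter_upwards [hX, hUo.mem_nhds hpU] with q hXq hq
  have h1 : ContMDiffAt 𝓘(ℝ, E).tangent 𝓘(ℝ, ℝ).tangent ∞ (tangentMap 𝓘(ℝ, E) 𝓘(ℝ, ℝ) c)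
      (⟨q, X q⟩ : TangentBundle 𝓘(ℝ, E) M) := by
    -- `c` is smooth only on the open set `U`, so the tangent map is taken within `U` and then
    -- identified with the full one over `U`.
    have hon : ContMDiffOn 𝓘(ℝ, E) 𝓘(ℝ, ℝ) ∞ c U := fun z hz ↦ (hU z hz).contMDiffWithinAt
    have := hon.contMDiffOn_tangentMapWithin (m := ∞) (by simp) hUo.uniqueMDiffOn
    have hopen : IsOpen ((TotalSpace.proj : TangentBundle 𝓘(ℝ, E) M → M) ⁻¹' U) :=
      hUo.preimage (FiberBundle.continuous_proj E (fun x : M ↦ TangentSpace 𝓘(ℝ, E) x))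
    refine (this.contMDiffAt (hopen.mem_nhds hq)).congr_of_eventuallyEq ?_
    filter_upwards [hopen.mem_nhds (show
      (⟨q, X q⟩ : TangentBundle 𝓘(ℝ, E) M) ∈ _ from hq)] with z hz
    exact (tangentMapWithin_eq_tangentMap (hUo.uniqueMDiffOn _ hz)
      ((hU _ hz).mdifferentiableAt (by simp))).symm
  have h2 := h1.comp q hXq
  have h3 := (contMDiffAt_totalSpace.1 h2).2
  refine h3.congr_of_eventuallyEq (.of_forall fun z ↦ ?_)
  simp [tangentMap]
  rfl

end AlongMaps

/-! ### The connection of `N` on fields smooth near a point -/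

section CovariantDerivative

variable {F : Type*} [NormedAddCommGroup F] [NormedSpace ℝ F] [FiniteDimensional ℝ F]
  {N : Type*} [TopologicalSpace N] [ChartedSpace F N] [IsManifold 𝓘(ℝ, F) ∞ N]
  (cov : CovariantDerivative 𝓘(ℝ, F) F (fun x : N ↦ TangentSpace 𝓘(ℝ, F) x))
  {x : N}

/-- With the identity written as `fun y ↦ y`, `SmoothNear` unfolds to `SmoothAlongNear`, so results
on fields along maps apply to vector fields of `N` as well. -/
lemma contMDiff_id' : ContMDiff 𝓘(ℝ, F) 𝓘(ℝ, F) ∞ (fun y : N ↦ y) := contMDiff_id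

lemma cov_add {Y Z : ∀ y : N, TangentSpace 𝓘(ℝ, F) y} (hY : SmoothNear Y x) (hZ : SmoothNear Z x) :
    cov (fun y ↦ Y y + Z y) x = cov Y x + cov Z x :=
  cov.isCovariantDerivativeOn.add hY.mdifferentiableAt hZ.mdifferentiableAt

lemma cov_smul {c : N → ℝ} {Y : ∀ y : N, TangentSpace 𝓘(ℝ, F) y} (hc : SmoothFnNear F c x)
    (hY : SmoothNear Y x) (v : TangentSpace 𝓘(ℝ, F) x) :
    cov (fun y ↦ c y • Y y) x v = mvfderiv 𝓘(ℝ, F) c x v • Y x + c x • cov Y x v := by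
  have := congr($(cov.isCovariantDerivativeOn.leibniz (s := Set.univ) hY.mdifferentiableAt
    hc.mdifferentiableAt) v)
  rw [add_comm]
  exact this

lemma cov_congr {Y Z : ∀ y : N, TangentSpace 𝓘(ℝ, F) y} (hY : SmoothNear Y x)
    (h : ∀ᶠ y in 𝓝 x, Z y = Y y) : cov Z x = cov Y x := by
  have hZ : SmoothNear Z x :=
    SmoothAlongNear.congr (ι := fun y : N ↦ y) (V := Y) (W := Z) hY h
  exact cov.isCovariantDerivativeOn.congr_of_eventuallyEq (s := Set.univ) hZ.mdifferentiableAt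
    hY.mdifferentiableAt Filter.univ_mem h

lemma cov_sum {κ : Type*} (s : Finset κ) {Y : κ → ∀ y : N, TangentSpace 𝓘(ℝ, F) y}
    (hY : ∀ k ∈ s, SmoothNear (Y k) x) :
    cov (fun y ↦ ∑ k ∈ s, Y k y) x = ∑ k ∈ s, cov (Y k) x := by
  classical
  induction s using Finset.induction_on with
  | empty =>
    simp only [Finset.sum_empty]
    exact congr($(cov.zero) x)
  | insert a s ha ih =>
    simp only [Finset.sum_insert ha]
    rw [← ih fun k hk ↦ hY k (Finset.mem_insert_of_mem hk)]
    exact cov_add cov (hY a (Finset.mem_insert_self a s))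
      (SmoothAlongNear.sum (ι := fun y : N ↦ y) contMDiff_id' s
        fun k hk ↦ hY k (Finset.mem_insert_of_mem hk))

/-- Identifies the constant-coordinate field in the definition of `covAlong` with a combination of
the frame with constant coefficients. -/
lemma symm_eq_sum_frame {y x : N} (hx : x ∈ frameDomain F y) (a : F) :
    (trivializationAt F (fun x : N ↦ TangentSpace 𝓘(ℝ, F) x) y).symm x a =
      ∑ i, (Module.finBasis ℝ F).repr a i • frame y i x := by
  set e := trivializationAt F (fun x : N ↦ TangentSpace 𝓘(ℝ, F) x) y
  have h1 : ∀ i, frame y i x = (e.linearEquivAt (R := ℝ) x hx).symm (Module.finBasis ℝ F i) := by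
    intro i
    exact e.localFrame_apply_of_mem_baseSet _ hx
  have h2 : e.symm x a = (e.linearEquivAt (R := ℝ) x hx).symm a := rfl
  simp_rw [h1, h2, ← map_smul, ← map_sum, (Module.finBasis ℝ F).sum_repr]

end CovariantDerivative

/-! ### Covariant differentiation along a map -/

section AlongMaps

variable {E : Type*} [NormedAddCommGroup E] [NormedSpace ℝ E]
  {M : Type*} [TopologicalSpace M] [ChartedSpace E M] [IsManifold 𝓘(ℝ, E) ∞ M]
  {F : Type*} [NormedAddCommGroup F] [NormedSpace ℝ F] [FiniteDimensional ℝ F]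
  {N : Type*} [TopologicalSpace N] [ChartedSpace F N] [IsManifold 𝓘(ℝ, F) ∞ N]
  (cov : CovariantDerivative 𝓘(ℝ, F) F (fun x : N ↦ TangentSpace 𝓘(ℝ, F) x))
  {ι : M → N} {V W : ∀ q : M, TangentSpace 𝓘(ℝ, F) (ι q)} {p : M}

lemma SmoothFnNear.mvfderiv_add {c d : M → ℝ} (hc : SmoothFnNear E c p) (hd : SmoothFnNear E d p)
    (v : TangentSpace 𝓘(ℝ, E) p) : _root_.mvfderiv 𝓘(ℝ, E) (fun q ↦ c q + d q) p v
      = _root_.mvfderiv 𝓘(ℝ, E) c p v + _root_.mvfderiv 𝓘(ℝ, E) d p v :=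
  congr($(_root_.mvfderiv_add hc.mdifferentiableAt hd.mdifferentiableAt) v)

lemma SmoothFnNear.mvfderiv_mul {c d : M → ℝ} (hc : SmoothFnNear E c p) (hd : SmoothFnNear E d p)
    (v : TangentSpace 𝓘(ℝ, E) p) : _root_.mvfderiv 𝓘(ℝ, E) (fun q ↦ c q * d q) p v
      = c p * _root_.mvfderiv 𝓘(ℝ, E) d p v + d p * _root_.mvfderiv 𝓘(ℝ, E) c p v := by
  have := congr($(_root_.mvfderiv_mul hc.mdifferentiableAt hd.mdifferentiableAt) v)
  simpa using! this

lemma mvfderiv_congr {c d : M → ℝ} (h : ∀ᶠ q in 𝓝 p, c q = d q) (v : TangentSpace 𝓘(ℝ, E) p) :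
    mvfderiv 𝓘(ℝ, E) c p v = mvfderiv 𝓘(ℝ, E) d p v := by
  have h1 : c =ᶠ[𝓝 p] d := h
  unfold mvfderiv
  have h2 := h1.mfderiv_eq (I := 𝓘(ℝ, E)) (I' := 𝓘(ℝ, ℝ))
  simp only [ContinuousLinearMap.comp_apply]
  exact congr($h2 v)

/-- The covariant derivative along `ι` in terms of the local frame around `ι p`. -/
lemma covAlong_eq_sum (hι : ContMDiff 𝓘(ℝ, E) 𝓘(ℝ, F) ∞ ι) (hV : SmoothAlongNear (E := E) ι V p)
    (v : TangentSpace 𝓘(ℝ, E) p) :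
    covAlong cov ι V p v = ∑ i,
      (mvfderiv 𝓘(ℝ, E) (fun q ↦ frameCoeff (ι p) i (ι q) (V q)) p v • frame (ι p) i (ι p) +
        frameCoeff (ι p) i (ι p) (V p) •
          cov (frame (ι p) i) (ι p) (mfderiv 𝓘(ℝ, E) 𝓘(ℝ, F) ι p v)) := by
  set e := trivializationAt F (fun x : N ↦ TangentSpace 𝓘(ℝ, F) x) (ι p) with he
  have hc := hV.smoothFnNear_frameCoeff hι (mem_frameDomain (F := F) (ι p))
  have hmem : ∀ᶠ q in 𝓝 p, ι q ∈ frameDomain F (ι p) :=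
    hι.continuous.continuousAt.eventually ((isOpen_frameDomain _).mem_nhds (mem_frameDomain _))
  set c : M → F := fun q ↦ (e ⟨ι q, V q⟩).2 with hcdef
  have hcd : MDifferentiableAt 𝓘(ℝ, E) 𝓘(ℝ, F) c p :=
    (contMDiffAt_totalSpace.1 hV.contMDiffAt).2.mdifferentiableAt (by simp)
  -- The coordinate functionals of the basis are linear, so they commute with differentiation.
  have hderiv : ∀ i, (Module.finBasis ℝ F).repr (mfderiv 𝓘(ℝ, E) 𝓘(ℝ, F) c p v) i
      = mvfderiv 𝓘(ℝ, E) (fun q ↦ frameCoeff (ι p) i (ι q) (V q)) p v := by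
    intro i
    set L : F →L[ℝ] ℝ := ((Module.finBasis ℝ F).coord i).toContinuousLinearMap with hL
    have h1 : ∀ᶠ q in 𝓝 p, frameCoeff (ι p) i (ι q) (V q) = L (c q) := by
      filter_upwards [hmem] with q hq
      rw [frameCoeff_eq hq]
      rfl
    rw [mvfderiv_congr h1]
    have h2 : HasMFDerivAt 𝓘(ℝ, E) 𝓘(ℝ, ℝ) (fun q ↦ L (c q)) p
        (L.comp (mfderiv 𝓘(ℝ, E) 𝓘(ℝ, F) c p)) :=
      HasMFDerivAt.comp p L.hasMFDerivAt hcd.hasMFDerivAt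
    unfold mvfderiv
    rw [h2.mfderiv]
    rfl
  have hcp : ∀ i, (Module.finBasis ℝ F).repr (c p) i = frameCoeff (ι p) i (ι p) (V p) := fun i ↦
    (frameCoeff_eq (mem_frameDomain (ι p)) i _).symm
  have hfr := fun i ↦ frame_smoothNear (mem_frameDomain (F := F) (ι p)) i
  have hs : ∀ i, SmoothNear (fun y ↦ (Module.finBasis ℝ F).repr (c p) i • frame (ι p) i y) (ι p) :=
    fun i ↦ SmoothAlongNear.smul (ι := fun y : N ↦ y) contMDiff_id' (.const _) (hfr i)
  -- The two fields agree only on the domain of the frame, which suffices because `cov` is local.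
  have hsec : cov (fun y ↦ e.symm y (c p)) (ι p) =
      ∑ i, cov (fun y ↦ (Module.finBasis ℝ F).repr (c p) i • frame (ι p) i y) (ι p) := by
    rw [← cov_sum cov _ fun i _ ↦ hs i]
    refine cov_congr cov (SmoothAlongNear.sum (ι := fun y : N ↦ y) contMDiff_id' _
      fun i _ ↦ hs i) ?_
    filter_upwards [(isOpen_frameDomain (F := F) (ι p)).mem_nhds (mem_frameDomain _)] with y hy
    exact symm_eq_sum_frame hy _
  have hfst := symm_eq_sum_frame (mem_frameDomain (F := F) (ι p))
    (mfderiv 𝓘(ℝ, E) 𝓘(ℝ, F) c p v)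
  change e.symm (ι p) (mfderiv 𝓘(ℝ, E) 𝓘(ℝ, F) c p v)
    + cov (fun y ↦ e.symm y (c p)) (ι p) (mfderiv 𝓘(ℝ, E) 𝓘(ℝ, F) ι p v) = _
  rw [Finset.sum_add_distrib]
  refine congr_arg₂ (· + ·) (hfst.trans (Finset.sum_congr rfl fun i _ ↦ ?_)) ?_
  · rw [← hderiv]
  · rw [hsec, sum_apply]
    refine Finset.sum_congr rfl fun i _ ↦ ?_
    rw [cov_smul cov (SmoothFnNear.const _) (hfr i), hcp, mvfderiv_const]
    simp

/-- No smoothness is needed: the field enters only through the germ of its coordinate function, its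
derivative and its value at `p`. -/
lemma covAlong_congr (h : ∀ᶠ q in 𝓝 p, W q = V q) (v : TangentSpace 𝓘(ℝ, E) p) :
    covAlong cov ι W p v = covAlong cov ι V p v := by
  set e := trivializationAt F (fun x : N ↦ TangentSpace 𝓘(ℝ, F) x) (ι p) with he
  have h1 : (fun q ↦ (e ⟨ι q, W q⟩).2) =ᶠ[𝓝 p] fun q ↦ (e ⟨ι q, V q⟩).2 := by
    filter_upwards [h] with q hq
    rw [hq]
  have h2 : (e ⟨ι p, W p⟩).2 = (e ⟨ι p, V p⟩).2 := h1.self_of_nhds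
  have h3 := congr($(h1.mfderiv_eq (I := 𝓘(ℝ, E)) (I' := 𝓘(ℝ, F))) v)
  unfold covAlong
  simp only
  rw [← he, h2]
  congr 1
  exact congr(e.symm (ι p) $h3)

lemma covAlong_add (hι : ContMDiff 𝓘(ℝ, E) 𝓘(ℝ, F) ∞ ι) (hV : SmoothAlongNear (E := E) ι V p)
    (hW : SmoothAlongNear (E := E) ι W p) (v : TangentSpace 𝓘(ℝ, E) p) :
    covAlong cov ι (fun q ↦ V q + W q) p v = covAlong cov ι V p v + covAlong cov ι W p v := by
  rw [covAlong_eq_sum cov hι hV, covAlong_eq_sum cov hι hW, covAlong_eq_sum cov hι (hV.add hι hW),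
    ← Finset.sum_add_distrib]
  refine Finset.sum_congr rfl fun i _ ↦ ?_
  simp only [map_add]
  rw [SmoothFnNear.mvfderiv_add (hV.smoothFnNear_frameCoeff hι (mem_frameDomain (F := F) (ι p)) i)
    (hW.smoothFnNear_frameCoeff hι (mem_frameDomain (F := F) (ι p)) i)]
  module

lemma covAlong_smul (hι : ContMDiff 𝓘(ℝ, E) 𝓘(ℝ, F) ∞ ι) {c : M → ℝ} (hc : SmoothFnNear E c p)
    (hV : SmoothAlongNear (E := E) ι V p) (v : TangentSpace 𝓘(ℝ, E) p) :
    covAlong cov ι (fun q ↦ c q • V q) p v =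
      mvfderiv 𝓘(ℝ, E) c p v • V p + c p • covAlong cov ι V p v := by
  have hVp := sum_frameCoeff_smul_frame (mem_frameDomain (F := F) (ι p)) (V p)
  conv_rhs => rw [← hVp]
  rw [covAlong_eq_sum cov hι hV, covAlong_eq_sum cov hι (hV.smul hι hc), Finset.smul_sum,
    Finset.smul_sum, ← Finset.sum_add_distrib]
  refine Finset.sum_congr rfl fun i _ ↦ ?_
  simp only [map_smul, smul_eq_mul]
  rw [SmoothFnNear.mvfderiv_mul hc
    (hV.smoothFnNear_frameCoeff hι (mem_frameDomain (F := F) (ι p)) i)]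
  module

lemma covAlong_zero (hι : ContMDiff 𝓘(ℝ, E) 𝓘(ℝ, F) ∞ ι) (v : TangentSpace 𝓘(ℝ, E) p) :
    covAlong cov ι (fun _ ↦ 0) p v = 0 := by
  have h0 : SmoothAlongNear (E := E) ι (fun q ↦ (0 : TangentSpace 𝓘(ℝ, F) (ι q))) p := by
    rw [smoothAlongNear_iff hι (mem_frameDomain _)]
    intro i
    simp only [map_zero]
    exact .const 0
  have := covAlong_add cov hι h0 h0 v
  simpa using this

lemma smoothAlongNear_zero (hι : ContMDiff 𝓘(ℝ, E) 𝓘(ℝ, F) ∞ ι) :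
    SmoothAlongNear (E := E) ι (fun q ↦ (0 : TangentSpace 𝓘(ℝ, F) (ι q))) p := by
  rw [smoothAlongNear_iff hι (mem_frameDomain _)]
  intro i
  simp only [map_zero]
  exact .const 0

lemma covAlong_sum (hι : ContMDiff 𝓘(ℝ, E) 𝓘(ℝ, F) ∞ ι) {κ : Type*} (s : Finset κ)
    {V : κ → ∀ q : M, TangentSpace 𝓘(ℝ, F) (ι q)}
    (hV : ∀ k ∈ s, SmoothAlongNear (E := E) ι (V k) p) (v : TangentSpace 𝓘(ℝ, E) p) :
    covAlong cov ι (fun q ↦ ∑ k ∈ s, V k q) p v = ∑ k ∈ s, covAlong cov ι (V k) p v := by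
  classical
  induction s using Finset.induction_on with
  | empty => simpa using covAlong_zero cov hι v
  | insert a s ha ih =>
    simp only [Finset.sum_insert ha]
    rw [← ih fun k hk ↦ hV k (Finset.mem_insert_of_mem hk)]
    exact covAlong_add cov hι (hV a (Finset.mem_insert_self a s))
      (.sum hι s fun k hk ↦ hV k (Finset.mem_insert_of_mem hk)) v

lemma covAlong_vec_add (hι : ContMDiff 𝓘(ℝ, E) 𝓘(ℝ, F) ∞ ι) (hV : SmoothAlongNear (E := E) ι V p)
    (v w : TangentSpace 𝓘(ℝ, E) p) :
    covAlong cov ι V p (v + w) = covAlong cov ι V p v + covAlong cov ι V p w := by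
  simp only [covAlong_eq_sum cov hι hV, ← Finset.sum_add_distrib, map_add]
  exact Finset.sum_congr rfl fun i _ ↦ by module

lemma covAlong_vec_smul (hι : ContMDiff 𝓘(ℝ, E) 𝓘(ℝ, F) ∞ ι)
    (hV : SmoothAlongNear (E := E) ι V p) (c : ℝ) (v : TangentSpace 𝓘(ℝ, E) p) :
    covAlong cov ι V p (c • v) = c • covAlong cov ι V p v := by
  simp only [covAlong_eq_sum cov hι hV, Finset.smul_sum, map_smul]
  exact Finset.sum_congr rfl fun i _ ↦ by simp only [smul_eq_mul]; module

lemma eventually_eq_sum_frameCoeff_smul_frame (Y : ∀ x : N, TangentSpace 𝓘(ℝ, F) x) {y x : N}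
    (hx : x ∈ frameDomain F y) :
    ∀ᶠ z in 𝓝 x, Y z = ∑ i, frameCoeff y i z (Y z) • frame y i z := by
  filter_upwards [(isOpen_frameDomain y).mem_nhds hx] with z hz
  exact (sum_frameCoeff_smul_frame hz _).symm

lemma SmoothNear.smoothFnNear_frameCoeff {Y : ∀ x : N, TangentSpace 𝓘(ℝ, F) x} {y x : N}
    (hY : SmoothNear Y x) (hx : x ∈ frameDomain F y) (i : Fin (Module.finrank ℝ F)) :
    SmoothFnNear F (fun z ↦ frameCoeff y i z (Y z)) x :=
  SmoothAlongNear.smoothFnNear_frameCoeff (ι := fun z : N ↦ z) contMDiff_id' hY hx i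

/-- The covariant derivative of a field in terms of a local frame. -/
lemma cov_eq_sum {Y : ∀ x : N, TangentSpace 𝓘(ℝ, F) x} {y x : N} (hY : SmoothNear Y x)
    (hx : x ∈ frameDomain F y) (v : TangentSpace 𝓘(ℝ, F) x) :
    cov Y x v = ∑ i, (mvfderiv 𝓘(ℝ, F) (fun z ↦ frameCoeff y i z (Y z)) x v • frame y i x +
      frameCoeff y i x (Y x) • cov (frame y i) x v) := by
  have hfr := fun i ↦ frame_smoothNear hx i
  have hc := fun i ↦ hY.smoothFnNear_frameCoeff hx i
  have hs : ∀ i, SmoothNear (fun z ↦ frameCoeff y i z (Y z) • frame y i z) x := fun i ↦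
    SmoothAlongNear.smul (ι := fun z : N ↦ z) contMDiff_id' (hc i) (hfr i)
  rw [← cov_congr cov hY (Z := fun z ↦ ∑ i, frameCoeff y i z (Y z) • frame y i z)
    ((eventually_eq_sum_frameCoeff_smul_frame Y hx).mono fun z hz ↦ hz.symm),
    cov_sum cov _ fun i _ ↦ hs i, sum_apply]
  exact Finset.sum_congr rfl fun i _ ↦ cov_smul cov (hc i) (hfr i) v

lemma SmoothFnNear.mvfderiv_comp (hι : ContMDiff 𝓘(ℝ, E) 𝓘(ℝ, F) ∞ ι) {c : N → ℝ}
    (hc : SmoothFnNear F c (ι p)) (v : TangentSpace 𝓘(ℝ, E) p) :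
    _root_.mvfderiv 𝓘(ℝ, E) (fun q ↦ c (ι q)) p v
      = _root_.mvfderiv 𝓘(ℝ, F) c (ι p) (mfderiv 𝓘(ℝ, E) 𝓘(ℝ, F) ι p v) :=
  mvfderiv_comp_apply p hc.mdifferentiableAt ((hι p).mdifferentiableAt (by simp)) v

/-- The chain rule: along `ι`, a field of `N` is differentiated by `∇`. -/
lemma covAlong_comp (hι : ContMDiff 𝓘(ℝ, E) 𝓘(ℝ, F) ∞ ι) {Y : ∀ x : N, TangentSpace 𝓘(ℝ, F) x}
    (hY : SmoothNear Y (ι p)) (v : TangentSpace 𝓘(ℝ, E) p) :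
    covAlong cov ι (fun q ↦ Y (ι q)) p v = cov Y (ι p) (mfderiv 𝓘(ℝ, E) 𝓘(ℝ, F) ι p v) := by
  rw [covAlong_eq_sum cov hι (hY.comp hι), cov_eq_sum cov hY (mem_frameDomain _)]
  refine Finset.sum_congr rfl fun i _ ↦ ?_
  rw [(hY.smoothFnNear_frameCoeff (mem_frameDomain _) i).mvfderiv_comp hι]

/-- The covariant derivative along `ι` in terms of any local frame. -/
lemma covAlong_eq_sum_frame (hι : ContMDiff 𝓘(ℝ, E) 𝓘(ℝ, F) ∞ ι)
    (hV : SmoothAlongNear (E := E) ι V p) {y : N} (hy : ι p ∈ frameDomain F y)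
    (v : TangentSpace 𝓘(ℝ, E) p) :
    covAlong cov ι V p v = ∑ i,
      (mvfderiv 𝓘(ℝ, E) (fun q ↦ frameCoeff y i (ι q) (V q)) p v • frame y i (ι p) +
        frameCoeff y i (ι p) (V p) •
          cov (frame y i) (ι p) (mfderiv 𝓘(ℝ, E) 𝓘(ℝ, F) ι p v)) := by
  have hc := hV.smoothFnNear_frameCoeff hι hy
  have hfr := fun i ↦ frame_smoothNear hy i
  have hmem : ∀ᶠ q in 𝓝 p, ι q ∈ frameDomain F y :=
    hι.continuous.continuousAt.eventually ((isOpen_frameDomain y).mem_nhds hy)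
  -- `covAlong` at `q` uses the trivialization around `ι q`, which moves with `q`. Expanding `V` in
  -- a fixed frame and applying the Leibniz and chain rules gives a formula that can be
  -- differentiated again.
  rw [covAlong_congr cov (W := V) (V := fun q ↦ ∑ i, frameCoeff y i (ι q) (V q) • frame y i (ι q))
    (hmem.mono fun q hq ↦ (sum_frameCoeff_smul_frame hq _).symm),
    covAlong_sum cov hι _ fun i _ ↦ ((hfr i).comp hι).smul hι (hc i)]
  refine Finset.sum_congr rfl fun i _ ↦ ?_
  rw [covAlong_smul cov hι (hc i) ((hfr i).comp hι), covAlong_comp cov hι (hfr i)]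

/-- For `ι = id`, the covariant derivative along `ι` is `∇`. -/
lemma covAlong_id {Y : ∀ x : N, TangentSpace 𝓘(ℝ, F) x} {x : N}
    (hY : SmoothNear Y x) (v : TangentSpace 𝓘(ℝ, F) x) :
    covAlong cov (fun z : N ↦ z) Y x v = cov Y x v := by
  rw [covAlong_comp cov (ι := fun z : N ↦ z) contMDiff_id' hY]
  congr 1
  exact congr($(mfderiv_id) v)

end AlongMaps

/-! ### The Lie bracket as a commutator of derivations -/

section LieBracket

variable {E : Type*} [NormedAddCommGroup E] [NormedSpace ℝ E] [FiniteDimensional ℝ E]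
  {M : Type*} [TopologicalSpace M] [ChartedSpace E M] [IsManifold 𝓘(ℝ, E) ∞ M] {p : M}

lemma fderiv_comp_extChartAt_symm {g : M → ℝ} {z : E} (hz : z ∈ (extChartAt 𝓘(ℝ, E) p).target)
    (hg : MDifferentiableAt 𝓘(ℝ, E) 𝓘(ℝ, ℝ) g ((extChartAt 𝓘(ℝ, E) p).symm z)) (w : E) :
    fderiv ℝ (fun z ↦ g ((extChartAt 𝓘(ℝ, E) p).symm z)) z w =
      mvfderiv 𝓘(ℝ, E) g ((extChartAt 𝓘(ℝ, E) p).symm z)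
        (mfderivWithin 𝓘(ℝ, E) 𝓘(ℝ, E) (extChartAt 𝓘(ℝ, E) p).symm (Set.range 𝓘(ℝ, E)) z w) := by
  have h1 := (mdifferentiableWithinAt_extChartAt_symm hz).hasMFDerivWithinAt
  rw [ModelWithCorners.Boundaryless.range_eq_univ, hasMFDerivWithinAt_univ] at h1
  have h2 : HasMFDerivAt 𝓘(ℝ, E) 𝓘(ℝ, ℝ) (fun z ↦ g ((extChartAt 𝓘(ℝ, E) p).symm z)) z _ :=
    HasMFDerivAt.comp z hg.hasMFDerivAt h1
  rw [ModelWithCorners.Boundaryless.range_eq_univ, ← mfderiv_eq_fderiv, h2.mfderiv]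
  rfl

/-- The pullback applies the inverse of the derivative of the inverse chart, and the chain rule
applies that derivative again; the two cancel. -/
lemma fderiv_comp_extChartAt_symm_pullback {g : M → ℝ} {z : E}
    (hz : z ∈ (extChartAt 𝓘(ℝ, E) p).target)
    (hg : MDifferentiableAt 𝓘(ℝ, E) 𝓘(ℝ, ℝ) g ((extChartAt 𝓘(ℝ, E) p).symm z))
    (X : ∀ q : M, TangentSpace 𝓘(ℝ, E) q) :
    fderiv ℝ (fun z ↦ g ((extChartAt 𝓘(ℝ, E) p).symm z)) z
      (VectorField.mpullbackWithin 𝓘(ℝ, E) 𝓘(ℝ, E) (extChartAt 𝓘(ℝ, E) p).symm X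
        (Set.range 𝓘(ℝ, E)) z) =
      mvfderiv 𝓘(ℝ, E) g ((extChartAt 𝓘(ℝ, E) p).symm z)
        (X ((extChartAt 𝓘(ℝ, E) p).symm z)) := by
  have h := fderiv_comp_extChartAt_symm hz hg (VectorField.mpullbackWithin 𝓘(ℝ, E) 𝓘(ℝ, E)
    (extChartAt 𝓘(ℝ, E) p).symm X (Set.range 𝓘(ℝ, E)) z)
  refine h.trans ?_
  congr 1
  exact (isInvertible_mfderivWithin_extChartAt_symm hz).self_apply_inverse _

/-- The Lie bracket is the commutator of the derivations given by two fields. -/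
lemma SmoothFnNear.mvfderiv_mlieBracket {f : M → ℝ} (hf : SmoothFnNear E f p)
    {X Y : ∀ q : M, TangentSpace 𝓘(ℝ, E) q} (hX : SmoothNear X p) (hY : SmoothNear Y p) :
    _root_.mvfderiv 𝓘(ℝ, E) f p (VectorField.mlieBracket 𝓘(ℝ, E) X Y p) =
      _root_.mvfderiv 𝓘(ℝ, E) (fun q ↦ _root_.mvfderiv 𝓘(ℝ, E) f q (Y q)) p (X p) -
        _root_.mvfderiv 𝓘(ℝ, E) (fun q ↦ _root_.mvfderiv 𝓘(ℝ, E) f q (X q)) p (Y p) := by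
  set φ := extChartAt 𝓘(ℝ, E) p with hφ
  set P : (∀ q : M, TangentSpace 𝓘(ℝ, E) q) → E → E := fun X ↦
    VectorField.mpullbackWithin 𝓘(ℝ, E) 𝓘(ℝ, E) φ.symm X (Set.range 𝓘(ℝ, E)) with hP
  set fh : E → ℝ := fun z ↦ f (φ.symm z) with hfh
  have hz0 : φ p ∈ φ.target := mem_extChartAt_target p
  have hback : φ.symm (φ p) = p := extChartAt_to_inv p
  have hcont : ContinuousAt φ.symm (φ p) := continuousAt_extChartAt_symm p
  have htarget : ∀ᶠ z in 𝓝 (φ p), z ∈ φ.target := extChartAt_target_mem_nhds p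
  have hfev : ∀ᶠ z in 𝓝 (φ p), SmoothFnNear E f (φ.symm z) := by
    refine hcont.eventually ?_
    rw [hback]
    exact hf.eventually
  have hfhs : ContDiffAt ℝ ∞ fh (φ p) := by
    have h1 : ContMDiffAt 𝓘(ℝ, E) 𝓘(ℝ, E) ∞ φ.symm (φ p) := by
      have := contMDiffWithinAt_extChartAt_symm_range (n := ∞) (I := 𝓘(ℝ, E)) p hz0
      rwa [ModelWithCorners.Boundaryless.range_eq_univ, contMDiffWithinAt_univ] at this
    have h2 : ContMDiffAt 𝓘(ℝ, E) 𝓘(ℝ, ℝ) ∞ f (φ.symm (φ p)) := by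
      rw [hback]; exact hf.contMDiffAt
    exact (h2.comp (φ p) h1).contDiffAt
  have hPd : ∀ X : ∀ q : M, TangentSpace 𝓘(ℝ, E) q, SmoothNear X p →
      DifferentiableAt ℝ (P X) (φ p) := by
    intro X hX
    have := MDifferentiableWithinAt.differentiableWithinAt_mpullbackWithin_vectorField
      (s := Set.univ) (hX.mdifferentiableAt.mdifferentiableWithinAt)
    simp only [Set.preimage_univ, ModelWithCorners.Boundaryless.range_eq_univ,
      Set.univ_inter] at this
    simp only [hP, ModelWithCorners.Boundaryless.range_eq_univ]
    exact differentiableWithinAt_univ.1 this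
  have hXf : ∀ X : ∀ q : M, TangentSpace 𝓘(ℝ, E) q,
      ∀ᶠ z in 𝓝 (φ p), fderiv ℝ fh z (P X z)
        = _root_.mvfderiv 𝓘(ℝ, E) f (φ.symm z) (X (φ.symm z)) := by
    intro X
    filter_upwards [htarget, hfev] with z hz hfz
    exact fderiv_comp_extChartAt_symm_pullback hz hfz.mdifferentiableAt X
  -- In the chart, `X(Yf) = D²f(X, Y) + Df(DY·X)` by the product rule.
  have hsecond : ∀ X Y : ∀ q : M, TangentSpace 𝓘(ℝ, E) q, SmoothNear X p → SmoothNear Y p →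
      _root_.mvfderiv 𝓘(ℝ, E) (fun q ↦ _root_.mvfderiv 𝓘(ℝ, E) f q (Y q)) p (X p) =
      fderiv ℝ (fderiv ℝ fh) (φ p) (P X (φ p)) (P Y (φ p))
        + fderiv ℝ fh (φ p) (fderiv ℝ (P Y) (φ p) (P X (φ p))) := by
    intro X Y hX hY
    have hg : SmoothFnNear E (fun q ↦ _root_.mvfderiv 𝓘(ℝ, E) f q (Y q)) p := hf.mvfderiv hY
    have h1 := fderiv_comp_extChartAt_symm_pullback (p := p) hz0
      (g := fun q ↦ _root_.mvfderiv 𝓘(ℝ, E) f q (Y q))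
      (by rw [← hφ, hback]; exact hg.mdifferentiableAt) X
    rw [← hφ, hback] at h1
    rw [← h1]
    have h2 : (fun z ↦ _root_.mvfderiv 𝓘(ℝ, E) f (φ.symm z) (Y (φ.symm z)))
        =ᶠ[𝓝 (φ p)] fun z ↦ fderiv ℝ fh z (P Y z) := by
      filter_upwards [hXf Y] with z hz using hz.symm
    rw [h2.fderiv_eq]
    have h3 : DifferentiableAt ℝ (fderiv ℝ fh) (φ p) :=
      (hfhs.fderiv_right (m := 1) (by norm_cast)).differentiableAt (by simp)
    have h4 := (h3.hasFDerivAt.clm_apply (hPd Y hY).hasFDerivAt).fderiv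
    refine congr($h4 _).trans ?_
    exact add_comm _ _
  -- The second-order terms cancel in the commutator, leaving `Df` of the bracket in the vector
  -- space `E`.
  have hsymm : IsSymmSndFDerivAt ℝ fh (φ p) :=
      hfhs.isSymmSndFDerivAt (by simp; exact WithTop.coe_le_coe.2 le_top)
  have hbr : _root_.mvfderiv 𝓘(ℝ, E) f p (VectorField.mlieBracket 𝓘(ℝ, E) X Y p) =
      fderiv ℝ fh (φ p) (VectorField.lieBracket ℝ (P X) (P Y) (φ p)) := by
    have h1 := fderiv_comp_extChartAt_symm (p := p) hz0 (g := f)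
      (by rw [← hφ, hback]; exact hf.mdifferentiableAt)
      (VectorField.lieBracket ℝ (P X) (P Y) (φ p))
    rw [← hφ, hback] at h1
    refine Eq.trans ?_ h1.symm
    congr 1
    rw [← VectorField.mlieBracketWithin_univ, VectorField.mlieBracketWithin_apply]
    -- The bracket on `M` is pulled back by the inverse of the derivative of the chart; this is the
    -- derivative of the inverse chart.
    have h2 : (mfderiv 𝓘(ℝ, E) 𝓘(ℝ, E) φ p).inverse =
        mfderivWithin 𝓘(ℝ, E) 𝓘(ℝ, E) φ.symm (Set.range 𝓘(ℝ, E)) (φ p) := by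
      refine ContinuousLinearMap.inverse_eq ?_ ?_
      · exact mfderiv_extChartAt_comp_mfderivWithin_extChartAt_symm' (mem_extChartAt_source p)
      · exact mfderivWithin_extChartAt_symm_comp_mfderiv_extChartAt' (mem_extChartAt_source p)
    rw [h2]
    congr 1
    simp only [Set.preimage_univ, ModelWithCorners.Boundaryless.range_eq_univ, Set.univ_inter,
      hP]
    exact congr($(VectorField.lieBracketWithin_univ (𝕜 := ℝ) (E := E)) _)
  rw [hbr, hsecond X Y hX hY, hsecond Y X hY hX, VectorField.lieBracket, map_sub]
  rw [hsymm.eq (P X (φ p)) (P Y (φ p))]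
  ring

end LieBracket

/-! ### Smoothness of covariant derivatives -/

section Smoothness

variable {E : Type*} [NormedAddCommGroup E] [NormedSpace ℝ E]
  {M : Type*} [TopologicalSpace M] [ChartedSpace E M] [IsManifold 𝓘(ℝ, E) ∞ M]
  {F : Type*} [NormedAddCommGroup F] [NormedSpace ℝ F] [FiniteDimensional ℝ F]
  {N : Type*} [TopologicalSpace N] [T2Space N] [ChartedSpace F N] [IsManifold 𝓘(ℝ, F) ∞ N]
  {cov : CovariantDerivative 𝓘(ℝ, F) F (fun x : N ↦ TangentSpace 𝓘(ℝ, F) x)}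

/-- A smooth connection maps fields that are smooth near a point to such fields. -/
lemma SmoothNear.cov_apply (hcov : cov.ContMDiffCovariantDerivative ∞) {x : N}
    {Y X : ∀ x : N, TangentSpace 𝓘(ℝ, F) x} (hY : SmoothNear Y x) (hX : SmoothNear X x) :
    SmoothNear (fun y ↦ cov Y y (X y)) x := by
  obtain ⟨U, hU, hUo, hxU⟩ := eventually_nhds_iff.1 hY
  -- The smoothness hypothesis on `cov` is used for globally smooth fields, so `Y` is cut off by a
  -- bump function `ρ`. Near `x` one has `ρ = 1`, and locality gives back `cov Y`.
  obtain ⟨ρ, -, hρ⟩ := (SmoothBumpFunction.nhds_basis_tsupport (I := 𝓘(ℝ, F)) x).mem_iff.1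
    (hUo.mem_nhds hxU)
  have hs : ContMDiffOn 𝓘(ℝ, F) (𝓘(ℝ, F).prod 𝓘(ℝ, F)) ∞
      (fun y ↦ (⟨y, Y y⟩ : TangentBundle 𝓘(ℝ, F) N)) U := fun z hz ↦ (hU z hz).contMDiffWithinAt
  have hglob : ContMDiff 𝓘(ℝ, F) (𝓘(ℝ, F).prod 𝓘(ℝ, F)) ∞
      (fun y ↦ (⟨y, ρ y • Y y⟩ : TangentBundle 𝓘(ℝ, F) N)) :=
    ContMDiffOn.smul_section_of_tsupport (ρ.contMDiff.contMDiffOn) hUo hρ hs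
  have h1 := hcov.contMDiff.contMDiff (σ := fun y ↦ ρ y • Y y)
    (hglob.contMDiffOn (s := Set.univ))
  have heq : ∀ᶠ y in 𝓝 x, cov (fun y ↦ ρ y • Y y) y = cov Y y := by
    filter_upwards [eventually_eventually_nhds.2 ρ.eventuallyEq_one, hY.eventually] with y hy hYy
    refine cov_congr cov hYy ?_
    filter_upwards [hy] with z hz
    simp [hz]
  have hsm : SmoothNear (fun y ↦ cov (fun y ↦ ρ y • Y y) y (X y)) x := by
    filter_upwards [hX] with y hXy
    exact ContMDiffAt.clm_bundle_apply (h1.contMDiffAt Filter.univ_mem) hXy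
  exact SmoothAlongNear.congr (ι := fun y : N ↦ y) hsm (heq.mono fun y hy ↦ by rw [hy])

lemma SmoothNear.smoothFnNear_frameCoeff_push {ι : M → N} (hι : ContMDiff 𝓘(ℝ, E) 𝓘(ℝ, F) ∞ ι)
    {p : M} {X : ∀ q : M, TangentSpace 𝓘(ℝ, E) q} (hX : SmoothNear X p) {y : N}
    (hy : ι p ∈ frameDomain F y) (i : Fin (Module.finrank ℝ F)) :
    SmoothFnNear E (fun q ↦ frameCoeff y i (ι q) (mfderiv 𝓘(ℝ, E) 𝓘(ℝ, F) ι q (X q))) p :=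
  (hX.smoothAlongNear_push (F := F) hι).smoothFnNear_frameCoeff hι hy i

/-- The direction `dι(X)` need not be the restriction of a field of `N`. Expanding it in the frame
leaves smooth coefficients times restrictions of smooth fields of `N`. -/
lemma smoothAlongNear_cov_push (hcov : cov.ContMDiffCovariantDerivative ∞) {ι : M → N}
    (hι : ContMDiff 𝓘(ℝ, E) 𝓘(ℝ, F) ∞ ι) {p : M} {X : ∀ q : M, TangentSpace 𝓘(ℝ, E) q}
    (hX : SmoothNear X p) {Y : ∀ x : N, TangentSpace 𝓘(ℝ, F) x} (hY : SmoothNear Y (ι p)) :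
    SmoothAlongNear (E := E) ι (fun q ↦ cov Y (ι q) (mfderiv 𝓘(ℝ, E) 𝓘(ℝ, F) ι q (X q))) p := by
  have hmem : ∀ᶠ q in 𝓝 p, ι q ∈ frameDomain F (ι p) :=
    hι.continuous.continuousAt.eventually ((isOpen_frameDomain _).mem_nhds (mem_frameDomain _))
  have hfr := fun i ↦ frame_smoothNear (mem_frameDomain (F := F) (ι p)) i
  refine SmoothAlongNear.congr (V := fun q ↦ ∑ i, frameCoeff (ι p) i (ι q)
    (mfderiv 𝓘(ℝ, E) 𝓘(ℝ, F) ι q (X q)) • cov Y (ι q) (frame (ι p) i (ι q)))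
    (.sum hι _ fun i _ ↦ .smul hι (hX.smoothFnNear_frameCoeff_push hι (mem_frameDomain _) i)
      ((SmoothNear.cov_apply hcov hY (hfr i)).comp hι)) ?_
  filter_upwards [hmem] with q hq
  conv_lhs => rw [← sum_frameCoeff_smul_frame hq (mfderiv 𝓘(ℝ, E) 𝓘(ℝ, F) ι q (X q))]
  rw [map_sum]
  simp only [map_smul]

lemma SmoothAlongNear.covAlong (hcov : cov.ContMDiffCovariantDerivative ∞) {ι : M → N}
    (hι : ContMDiff 𝓘(ℝ, E) 𝓘(ℝ, F) ∞ ι) {p : M} {X : ∀ q : M, TangentSpace 𝓘(ℝ, E) q}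
    (hX : SmoothNear X p) {V : ∀ q : M, TangentSpace 𝓘(ℝ, F) (ι q)}
    (hV : SmoothAlongNear (E := E) ι V p) :
    SmoothAlongNear (E := E) ι (fun q ↦ covAlong cov ι V q (X q)) p := by
  have hmem : ∀ᶠ q in 𝓝 p, ι q ∈ frameDomain F (ι p) :=
    hι.continuous.continuousAt.eventually ((isOpen_frameDomain _).mem_nhds (mem_frameDomain _))
  have hfr := fun i ↦ frame_smoothNear (mem_frameDomain (F := F) (ι p)) i
  have hc := hV.smoothFnNear_frameCoeff hι (mem_frameDomain (F := F) (ι p))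
  refine SmoothAlongNear.congr (.sum hι Finset.univ fun i _ ↦ .add hι
    (.smul hι ((hc i).mvfderiv hX) ((hfr i).comp hι))
    (.smul hι (hc i) (smoothAlongNear_cov_push hcov hι hX (hfr i)))) ?_
  filter_upwards [hmem, hV.eventually] with q hq hVq
  exact covAlong_eq_sum_frame cov hι hVq hq (X q)

end Smoothness

/-! ### Coordinate functions and fields with constant coordinates -/

section CoordinateFunctions

variable {F : Type*} [NormedAddCommGroup F] [NormedSpace ℝ F] [FiniteDimensional ℝ F]
  {N : Type*} [TopologicalSpace N] [ChartedSpace F N] [IsManifold 𝓘(ℝ, F) ∞ N]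

/-- The coordinates of the preferred chart around `y`. -/
def chartCoord (y : N) (i : Fin (Module.finrank ℝ F)) (x : N) : ℝ :=
  (Module.finBasis ℝ F).repr (extChartAt 𝓘(ℝ, F) y x) i

lemma smoothFnNear_chartCoord {y x : N} (hx : x ∈ frameDomain F y)
    (i : Fin (Module.finrank ℝ F)) : SmoothFnNear F (chartCoord y i) x := by
  filter_upwards [(isOpen_frameDomain y).mem_nhds hx] with z hz
  have h1 : ContMDiffAt 𝓘(ℝ, F) 𝓘(ℝ, F) ∞ (extChartAt 𝓘(ℝ, F) y) z := contMDiffAt_extChartAt' hz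
  exact (((Module.finBasis ℝ F).coord i).toContinuousLinearMap.contDiff
    (n := ∞)).contMDiff.contMDiffAt.comp z h1

/-- The frame coefficients of a tangent vector are the derivatives of the coordinates. -/
lemma frameCoeff_eq_mvfderiv {y x : N} (hx : x ∈ frameDomain F y)
    (i : Fin (Module.finrank ℝ F)) (v : TangentSpace 𝓘(ℝ, F) x) :
    frameCoeff y i x v = mvfderiv 𝓘(ℝ, F) (chartCoord y i) x v := by
  -- The base set of the preferred trivialization is by definition the chart domain.
  have hx' : x ∈ (chartAt F y).source := hx
  set L : F →L[ℝ] ℝ := ((Module.finBasis ℝ F).coord i).toContinuousLinearMap with hL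
  have h1 : HasMFDerivAt 𝓘(ℝ, F) 𝓘(ℝ, F) (extChartAt 𝓘(ℝ, F) y) x _ :=
    (mdifferentiableAt_extChartAt hx').hasMFDerivAt
  have h2 : HasMFDerivAt 𝓘(ℝ, F) 𝓘(ℝ, ℝ) (chartCoord y i) x _ :=
    HasMFDerivAt.comp x L.hasMFDerivAt h1
  rw [frameCoeff_eq hx]
  unfold mvfderiv
  rw [h2.mfderiv, ← TangentBundle.continuousLinearMapAt_trivializationAt hx']
  have h3 : (trivializationAt F (fun x : N ↦ TangentSpace 𝓘(ℝ, F) x) y).continuousLinearMapAt ℝ x v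
      = (trivializationAt F (fun x : N ↦ TangentSpace 𝓘(ℝ, F) x) y ⟨x, v⟩).2 :=
    congr($((trivializationAt F (fun x : N ↦ TangentSpace 𝓘(ℝ, F) x) y).coe_linearMapAt_of_mem
      (R := ℝ) hx) v)
  rw [← h3]
  rfl

lemma frameCoeff_frame {y x : N} (hx : x ∈ frameDomain F y) (i j : Fin (Module.finrank ℝ F)) :
    frameCoeff y i x (frame y j x) = if j = i then 1 else 0 := by
  have h := (trivializationAt F
    (fun x : N ↦ TangentSpace 𝓘(ℝ, F) x) y).localFrameCoeff_apply_of_mem_baseSet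
    (I := 𝓘(ℝ, F)) (Module.finBasis ℝ F) hx (frame y j) i
  refine h.trans ?_
  have h2 : frame y j x = (trivializationAt F (fun x : N ↦ TangentSpace 𝓘(ℝ, F) x) y).basisAt
      (Module.finBasis ℝ F) hx j :=
    (trivializationAt F (fun x : N ↦ TangentSpace 𝓘(ℝ, F) x) y).localFrame_apply_of_mem_baseSet _ hx
  rw [h2, Module.Basis.repr_self, Finsupp.single_apply]

lemma frameCoeff_ext {y x : N} (hx : x ∈ frameDomain F y) {v w : TangentSpace 𝓘(ℝ, F) x}
    (h : ∀ i, frameCoeff y i x v = frameCoeff y i x w) : v = w := by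
  rw [← sum_frameCoeff_smul_frame hx v, ← sum_frameCoeff_smul_frame hx w]
  simp only [h]

/-- Two fields with constant coordinates commute. -/
lemma mlieBracket_eq_zero_of_frameCoeff {y x : N} (hx : x ∈ frameDomain F y)
    {X Y : ∀ z : N, TangentSpace 𝓘(ℝ, F) z} (hX : SmoothNear X x) (hY : SmoothNear Y x)
    {a b : Fin (Module.finrank ℝ F) → ℝ}
    (ha : ∀ᶠ z in 𝓝 x, ∀ i, frameCoeff y i z (X z) = a i)
    (hb : ∀ᶠ z in 𝓝 x, ∀ i, frameCoeff y i z (Y z) = b i) :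
    VectorField.mlieBracket 𝓘(ℝ, F) X Y x = 0 := by
  refine frameCoeff_ext hx fun i ↦ ?_
  have hdom := (isOpen_frameDomain (F := F) y).mem_nhds hx
  -- The bracket is tested on each coordinate function, whose derivatives along `X` and `Y` are
  -- locally the constants `a i` and `b i`.
  rw [frameCoeff_eq_mvfderiv hx, (smoothFnNear_chartCoord hx i).mvfderiv_mlieBracket hX hY,
    mvfderiv_congr (d := fun _ ↦ b i), mvfderiv_const, mvfderiv_congr (d := fun _ ↦ a i),
    mvfderiv_const]
  · simp
  · filter_upwards [ha, hdom] with z hz hzd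
    rw [← frameCoeff_eq_mvfderiv hzd, hz i]
  · filter_upwards [hb, hdom] with z hz hzd
    rw [← frameCoeff_eq_mvfderiv hzd, hz i]

/-- The extension of a tangent vector to a field with constant coordinates. -/
def constField (y : N) (v : TangentSpace 𝓘(ℝ, F) y) (x : N) : TangentSpace 𝓘(ℝ, F) x :=
  ∑ i, frameCoeff y i y v • frame y i x

lemma constField_self (y : N) (v : TangentSpace 𝓘(ℝ, F) y) : constField y v y = v :=
  sum_frameCoeff_smul_frame (mem_frameDomain y) v

lemma constField_smoothNear (y : N) (v : TangentSpace 𝓘(ℝ, F) y) {x : N}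
    (hx : x ∈ frameDomain F y) : SmoothNear (constField y v) x :=
  SmoothAlongNear.sum (ι := fun z : N ↦ z) contMDiff_id' _ fun i _ ↦
    SmoothAlongNear.smul (ι := fun z : N ↦ z) contMDiff_id' (.const _) (frame_smoothNear hx i)

lemma constField_smoothNear_self (y : N) (v : TangentSpace 𝓘(ℝ, F) y) :
    SmoothNear (constField y v) y :=
  constField_smoothNear y v (mem_frameDomain y)

lemma frameCoeff_constField {y x : N} (hx : x ∈ frameDomain F y) (v : TangentSpace 𝓘(ℝ, F) y)
    (i : Fin (Module.finrank ℝ F)) :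
    frameCoeff y i x (constField y v x) = frameCoeff y i y v := by
  unfold constField
  simp [map_sum, frameCoeff_frame hx]

lemma mlieBracket_constField {y x : N} (hx : x ∈ frameDomain F y) (v w : TangentSpace 𝓘(ℝ, F) y) :
    VectorField.mlieBracket 𝓘(ℝ, F) (constField y v) (constField y w) x = 0 := by
  have hdom := (isOpen_frameDomain (F := F) y).mem_nhds hx
  exact mlieBracket_eq_zero_of_frameCoeff hx (constField_smoothNear y v hx)
    (constField_smoothNear y w hx) (hdom |> Filter.mem_of_superset <| fun z hz i ↦
      frameCoeff_constField hz v i) (Filter.mem_of_superset hdom fun z hz i ↦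
      frameCoeff_constField hz w i)

lemma mlieBracket_frame {y x : N} (hx : x ∈ frameDomain F y) (i j : Fin (Module.finrank ℝ F)) :
    VectorField.mlieBracket 𝓘(ℝ, F) (frame y i) (frame y j) x = 0 := by
  have hdom := (isOpen_frameDomain (F := F) y).mem_nhds hx
  exact mlieBracket_eq_zero_of_frameCoeff hx (frame_smoothNear hx i) (frame_smoothNear hx j)
    (Filter.mem_of_superset hdom fun z hz k ↦ frameCoeff_frame hz k i)
    (Filter.mem_of_superset hdom fun z hz k ↦ frameCoeff_frame hz k j)

lemma cov_comm {cov : CovariantDerivative 𝓘(ℝ, F) F (fun x : N ↦ TangentSpace 𝓘(ℝ, F) x)}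
    (ht : cov.torsion = 0) {x : N} {X Y : ∀ z : N, TangentSpace 𝓘(ℝ, F) z} (hX : SmoothNear X x)
    (hY : SmoothNear Y x) (h : VectorField.mlieBracket 𝓘(ℝ, F) X Y x = 0) :
    cov X x (Y x) = cov Y x (X x) := by
  have := cov.torsion_eq_zero_iff.1 ht hX.mdifferentiableAt hY.mdifferentiableAt
  rw [h, sub_eq_zero] at this
  exact this.symm

end CoordinateFunctions

/-! ### Torsion along a map, and induction on fields along it -/

section AlongMaps

variable {E : Type*} [NormedAddCommGroup E] [NormedSpace ℝ E] [FiniteDimensional ℝ E]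
  {M : Type*} [TopologicalSpace M] [ChartedSpace E M] [IsManifold 𝓘(ℝ, E) ∞ M]
  {F : Type*} [NormedAddCommGroup F] [NormedSpace ℝ F] [FiniteDimensional ℝ F]
  {N : Type*} [TopologicalSpace N] [ChartedSpace F N] [IsManifold 𝓘(ℝ, F) ∞ N]
  {cov : CovariantDerivative 𝓘(ℝ, F) F (fun x : N ↦ TangentSpace 𝓘(ℝ, F) x)}
  {ι : M → N} {p : M}

/-- This is the commutator formula for the pulled back coordinate `x_i ∘ ι`, whose derivative along
`v` is the `i`-th coefficient of `dι(v)`. It avoids extending `X` and `Y` to fields of `N`. -/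
lemma frameCoeff_mlieBracket_push (hι : ContMDiff 𝓘(ℝ, E) 𝓘(ℝ, F) ∞ ι)
    {X Y : ∀ q : M, TangentSpace 𝓘(ℝ, E) q} (hX : SmoothNear X p) (hY : SmoothNear Y p)
    {y : N} (hy : ι p ∈ frameDomain F y) (i : Fin (Module.finrank ℝ F)) :
    frameCoeff y i (ι p)
        (mfderiv 𝓘(ℝ, E) 𝓘(ℝ, F) ι p (VectorField.mlieBracket 𝓘(ℝ, E) X Y p)) =
      mvfderiv 𝓘(ℝ, E) (fun q ↦ frameCoeff y i (ι q) (push ι Y q)) p (X p) -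
        mvfderiv 𝓘(ℝ, E) (fun q ↦ frameCoeff y i (ι q) (push ι X q)) p (Y p) := by
  have hmem : ∀ᶠ q in 𝓝 p, ι q ∈ frameDomain F y :=
    hι.continuous.continuousAt.eventually ((isOpen_frameDomain y).mem_nhds hy)
  have hs := smoothFnNear_chartCoord hy i
  have key : ∀ q, ι q ∈ frameDomain F y → ∀ v : TangentSpace 𝓘(ℝ, E) q,
      mvfderiv 𝓘(ℝ, E) (fun q ↦ chartCoord y i (ι q)) q v =
      frameCoeff y i (ι q) (mfderiv 𝓘(ℝ, E) 𝓘(ℝ, F) ι q v) := by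
    intro q hq v
    rw [(smoothFnNear_chartCoord hq i).mvfderiv_comp hι, frameCoeff_eq_mvfderiv hq]
  rw [← key p hy, (hs.comp hι).mvfderiv_mlieBracket hX hY]
  congr 1
  · exact mvfderiv_congr (hmem.mono fun q hq ↦ key q hq _) _
  · exact mvfderiv_congr (hmem.mono fun q hq ↦ key q hq _) _

lemma cov_mfderiv_eq_sum {y : N} (hy : ι p ∈ frameDomain F y) (Y : ∀ x : N, TangentSpace 𝓘(ℝ, F) x)
    (w : TangentSpace 𝓘(ℝ, F) (ι p)) :
    cov Y (ι p) w = ∑ j, frameCoeff y j (ι p) w • cov Y (ι p) (frame y j (ι p)) := by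
  conv_lhs => rw [← sum_frameCoeff_smul_frame hy w]
  simp only [map_sum, map_smul]

/-- The connection along `ι` is torsion-free. -/
lemma covAlong_push_sub (ht : cov.torsion = 0) (hι : ContMDiff 𝓘(ℝ, E) 𝓘(ℝ, F) ∞ ι)
    {X Y : ∀ q : M, TangentSpace 𝓘(ℝ, E) q} (hX : SmoothNear X p) (hY : SmoothNear Y p) :
    covAlong cov ι (push ι Y) p (X p) - covAlong cov ι (push ι X) p (Y p) =
      mfderiv 𝓘(ℝ, E) 𝓘(ℝ, F) ι p (VectorField.mlieBracket 𝓘(ℝ, E) X Y p) := by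
  have hdom := mem_frameDomain (F := F) (ι p)
  rw [covAlong_eq_sum cov hι (hX.smoothAlongNear_push hι),
    covAlong_eq_sum cov hι (hY.smoothAlongNear_push hι),
    ← sum_frameCoeff_smul_frame hdom
      (mfderiv 𝓘(ℝ, E) 𝓘(ℝ, F) ι p (VectorField.mlieBracket 𝓘(ℝ, E) X Y p)),
    Finset.sum_add_distrib, Finset.sum_add_distrib]
  -- The Christoffel terms are symmetric, since the frame fields commute and the torsion vanishes;
  -- only derivatives of the coefficients remain.
  have hsymm : ∑ i, frameCoeff (ι p) i (ι p) (push ι Y p) •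
      cov (frame (ι p) i) (ι p) (mfderiv 𝓘(ℝ, E) 𝓘(ℝ, F) ι p (X p)) =
      ∑ i, frameCoeff (ι p) i (ι p) (push ι X p) •
      cov (frame (ι p) i) (ι p) (mfderiv 𝓘(ℝ, E) 𝓘(ℝ, F) ι p (Y p)) := by
    simp_rw [cov_mfderiv_eq_sum hdom (frame (ι p) _) (mfderiv 𝓘(ℝ, E) 𝓘(ℝ, F) ι p _),
      Finset.smul_sum]
    rw [Finset.sum_comm]
    refine Finset.sum_congr rfl fun i _ ↦ Finset.sum_congr rfl fun j _ ↦ ?_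
    rw [cov_comm ht (frame_smoothNear hdom i) (frame_smoothNear hdom j)
      (mlieBracket_frame hdom i j),
      smul_comm]
    rfl
  rw [hsymm, add_sub_add_right_eq_sub, ← Finset.sum_sub_distrib]
  refine Finset.sum_congr rfl fun i _ ↦ ?_
  rw [← sub_smul, frameCoeff_mlieBracket_push hι hX hY hdom]

/-- Induction principle for smooth fields along `ι`, which are locally generated by the fields of
the form `Y ∘ ι`. -/
lemma SmoothAlongNear.induction (hι : ContMDiff 𝓘(ℝ, E) 𝓘(ℝ, F) ∞ ι)
    {P : (∀ q : M, TangentSpace 𝓘(ℝ, F) (ι q)) → Prop}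
    (comp : ∀ Y : ∀ x : N, TangentSpace 𝓘(ℝ, F) x, SmoothNear Y (ι p) → P fun q ↦ Y (ι q))
    (smul : ∀ (c : M → ℝ) V, SmoothFnNear E c p → SmoothAlongNear (E := E) ι V p → P V →
      P fun q ↦ c q • V q)
    (add : ∀ V W, SmoothAlongNear (E := E) ι V p → SmoothAlongNear (E := E) ι W p →
      P V → P W → P fun q ↦ V q + W q)
    (congr : ∀ V W, SmoothAlongNear (E := E) ι V p → (∀ᶠ q in 𝓝 p, W q = V q) → P V → P W)
    {V : ∀ q : M, TangentSpace 𝓘(ℝ, F) (ι q)} (hV : SmoothAlongNear (E := E) ι V p) : P V := by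
  classical
  have hdom := mem_frameDomain (F := F) (ι p)
  have hfr := fun i ↦ frame_smoothNear hdom i
  have hc := hV.smoothFnNear_frameCoeff hι hdom
  have hmem : ∀ᶠ q in 𝓝 p, ι q ∈ frameDomain F (ι p) :=
    hι.continuous.continuousAt.eventually ((isOpen_frameDomain _).mem_nhds hdom)
  have hterm := fun i ↦ ((hfr i).comp hι).smul hι (hc i)
  refine congr (fun q ↦ ∑ i, frameCoeff (ι p) i (ι q) (V q) • frame (ι p) i (ι q)) V
    (.sum hι _ fun i _ ↦ hterm i)
    (hmem.mono fun q hq ↦ (sum_frameCoeff_smul_frame hq _).symm) ?_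
  have main : ∀ s : Finset (Fin (Module.finrank ℝ F)),
      P fun q ↦ ∑ i ∈ s, frameCoeff (ι p) i (ι q) (V q) • frame (ι p) i (ι q) := by
    intro s
    induction s using Finset.induction_on with
    | empty =>
      simp only [Finset.sum_empty]
      refine comp (fun _ ↦ 0) ?_
      exact smoothAlongNear_zero (ι := fun x : N ↦ x) contMDiff_id'
    | insert a s ha ih =>
      simp only [Finset.sum_insert ha]
      exact add _ _ (hterm a) (.sum hι _ fun i _ ↦ hterm i)
        (smul _ _ (hc a) ((hfr a).comp hι) (comp _ (hfr a))) ih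
  exact main Finset.univ

end AlongMaps

/-! ### The curvature tensor and its pullback -/

section Curvature

variable {E : Type*} [NormedAddCommGroup E] [NormedSpace ℝ E] [FiniteDimensional ℝ E]
  {M : Type*} [TopologicalSpace M] [ChartedSpace E M] [IsManifold 𝓘(ℝ, E) ∞ M]
  {F : Type*} [NormedAddCommGroup F] [NormedSpace ℝ F] [FiniteDimensional ℝ F]
  {N : Type*} [TopologicalSpace N] [T2Space N] [ChartedSpace F N] [IsManifold 𝓘(ℝ, F) ∞ N]
  (cov : CovariantDerivative 𝓘(ℝ, F) F (fun x : N ↦ TangentSpace 𝓘(ℝ, F) x))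
  {ι : M → N} {p : M}

/-- The second covariant derivatives of the local frame at its centre. -/
def frameHessian (y : N) (i j k : Fin (Module.finrank ℝ F)) : TangentSpace 𝓘(ℝ, F) y :=
  cov (fun x ↦ cov (frame y i) x (frame y j x)) y (frame y k y)

/-- The curvature tensor `R(u, v)w` of the connection, in terms of the local frame. -/
def curvatureTensor (y : N) (u v w : TangentSpace 𝓘(ℝ, F) y) : TangentSpace 𝓘(ℝ, F) y :=
  ∑ i, ∑ j, ∑ k, (frameCoeff y i y w * frameCoeff y j y v * frameCoeff y k y u) •
    (frameHessian cov y i j k - frameHessian cov y i k j)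

variable {cov}

/-- The frame at `ι p` stays fixed while the point varies. The terms are kept apart by how they
behave in the curvature: second derivatives of the coefficients of `V`, two cross terms exchanged
when the directions are swapped, derivatives of the coefficients of `dι(Y)`, and second covariant
derivatives of the frame. -/
lemma covAlong_covAlong (hcov : cov.ContMDiffCovariantDerivative ∞)
    (hι : ContMDiff 𝓘(ℝ, E) 𝓘(ℝ, F) ∞ ι) {Y : ∀ q : M, TangentSpace 𝓘(ℝ, E) q}
    (hY : SmoothNear Y p) {V : ∀ q : M, TangentSpace 𝓘(ℝ, F) (ι q)}
    (hV : SmoothAlongNear (E := E) ι V p) (v : TangentSpace 𝓘(ℝ, E) p) :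
    covAlong cov ι (fun q ↦ covAlong cov ι V q (Y q)) p v =
      ∑ i, (mvfderiv 𝓘(ℝ, E) (fun q ↦ mvfderiv 𝓘(ℝ, E)
          (fun q ↦ frameCoeff (ι p) i (ι q) (V q)) q (Y q)) p v • frame (ι p) i (ι p) +
        mvfderiv 𝓘(ℝ, E) (fun q ↦ frameCoeff (ι p) i (ι q) (V q)) p (Y p) •
          cov (frame (ι p) i) (ι p) (mfderiv 𝓘(ℝ, E) 𝓘(ℝ, F) ι p v) +
        mvfderiv 𝓘(ℝ, E) (fun q ↦ frameCoeff (ι p) i (ι q) (V q)) p v •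
          cov (frame (ι p) i) (ι p) (mfderiv 𝓘(ℝ, E) 𝓘(ℝ, F) ι p (Y p)) +
        frameCoeff (ι p) i (ι p) (V p) •
          ∑ j, (mvfderiv 𝓘(ℝ, E) (fun q ↦ frameCoeff (ι p) j (ι q) (push ι Y q)) p v •
              cov (frame (ι p) i) (ι p) (frame (ι p) j (ι p)) +
            frameCoeff (ι p) j (ι p) (push ι Y p) •
              ∑ k, frameCoeff (ι p) k (ι p) (mfderiv 𝓘(ℝ, E) 𝓘(ℝ, F) ι p v) •
                frameHessian cov (ι p) i j k)) := by
  have hdom := mem_frameDomain (F := F) (ι p)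
  have hmem : ∀ᶠ q in 𝓝 p, ι q ∈ frameDomain F (ι p) :=
    hι.continuous.continuousAt.eventually ((isOpen_frameDomain _).mem_nhds hdom)
  have hfr := fun i ↦ frame_smoothNear hdom i
  have hc := hV.smoothFnNear_frameCoeff hι hdom
  have hy : ∀ j, SmoothFnNear E (fun q ↦ frameCoeff (ι p) j (ι q) (push ι Y q)) p := fun j ↦
    hY.smoothFnNear_frameCoeff_push hι hdom j
  have hG := fun i j ↦ SmoothNear.cov_apply hcov (hfr i) (hfr j)
  have hGs : ∀ i j, SmoothAlongNear (E := E) ι (fun q ↦ frameCoeff (ι p) j (ι q) (push ι Y q) •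
      cov (frame (ι p) i) (ι q) (frame (ι p) j (ι q))) p := fun i j ↦
    ((hG i j).comp hι).smul hι (hy j)
  have hA := fun i ↦ ((hfr i).comp hι).smul hι ((hc i).mvfderiv hY)
  have hB := fun i ↦ (SmoothAlongNear.sum hι Finset.univ fun j _ ↦ hGs i j).smul hι (hc i)
  rw [covAlong_congr cov (V := fun q ↦ ∑ i,
    (mvfderiv 𝓘(ℝ, E) (fun q ↦ frameCoeff (ι p) i (ι q) (V q)) q (Y q) • frame (ι p) i (ι q) +
      frameCoeff (ι p) i (ι q) (V q) • ∑ j, frameCoeff (ι p) j (ι q) (push ι Y q) •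
        cov (frame (ι p) i) (ι q) (frame (ι p) j (ι q)))),
    covAlong_sum cov hι _ fun i _ ↦ (hA i).add hι (hB i)]
  · refine Finset.sum_congr rfl fun i _ ↦ ?_
    rw [covAlong_add cov hι (hA i) (hB i), covAlong_smul cov hι ((hc i).mvfderiv hY)
      ((hfr i).comp hι), covAlong_comp cov hι (hfr i), covAlong_smul cov hι (hc i)
      (SmoothAlongNear.sum hι Finset.univ fun j _ ↦ hGs i j),
      covAlong_sum cov hι _ fun j _ ↦ hGs i j,
      ← cov_mfderiv_eq_sum hdom (frame (ι p) i), ← add_assoc]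
    congr 2
    refine Finset.sum_congr rfl fun j _ ↦ ?_
    rw [covAlong_smul cov hι (hy j) ((hG i j).comp hι), covAlong_comp cov hι (hG i j),
      cov_mfderiv_eq_sum hdom fun y ↦ cov (frame (ι p) i) y (frame (ι p) j y)]
    rfl
  · filter_upwards [hmem, hV.eventually] with q hq hVq
    rw [covAlong_eq_sum_frame cov hι hVq hq]
    refine Finset.sum_congr rfl fun i _ ↦ ?_
    rw [cov_mfderiv_eq_sum hq (frame (ι p) i)]
    rfl

/-- The curvature of the connection along `ι` is the pullback of the curvature tensor. -/
theorem curvature_covAlong (hcov : cov.ContMDiffCovariantDerivative ∞)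
    (hι : ContMDiff 𝓘(ℝ, E) 𝓘(ℝ, F) ∞ ι) {X Y : ∀ q : M, TangentSpace 𝓘(ℝ, E) q}
    (hX : SmoothNear X p) (hY : SmoothNear Y p) {V : ∀ q : M, TangentSpace 𝓘(ℝ, F) (ι q)}
    (hV : SmoothAlongNear (E := E) ι V p) :
    curvature (V := fun q ↦ TangentSpace 𝓘(ℝ, F) (ι q)) (covAlong cov ι) X Y V p =
      curvatureTensor cov (ι p) (push ι X p) (push ι Y p) (V p) := by
  have hdom := mem_frameDomain (F := F) (ι p)
  have hc := hV.smoothFnNear_frameCoeff hι hdom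
  unfold curvature
  rw [covAlong_covAlong hcov hι hY hV, covAlong_covAlong hcov hι hX hV,
    covAlong_eq_sum cov hι hV, ← Finset.sum_sub_distrib, ← Finset.sum_sub_distrib,
    curvatureTensor]
  refine Finset.sum_congr rfl fun i _ ↦ ?_
  -- The `[X, Y]`-term absorbs the second derivatives of the coefficients of `V` and the derivatives
  -- of the coefficients of `dι(X)` and `dι(Y)`. The cross terms cancel, so only the antisymmetrized
  -- `frameHessian` survives.
  rw [(hc i).mvfderiv_mlieBracket hX hY, cov_mfderiv_eq_sum hdom (frame (ι p) i)
    (mfderiv 𝓘(ℝ, E) 𝓘(ℝ, F) ι p (VectorField.mlieBracket 𝓘(ℝ, E) X Y p))]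
  simp_rw [frameCoeff_mlieBracket_push hι hX hY hdom]
  set c := frameCoeff (ι p) i (ι p) (V p)
  have hH : ∑ j, ∑ k, (c * frameCoeff (ι p) j (ι p) (push ι Y p) *
      frameCoeff (ι p) k (ι p) (push ι X p)) •
        (frameHessian cov (ι p) i j k - frameHessian cov (ι p) i k j) =
      c • (∑ j, frameCoeff (ι p) j (ι p) (push ι Y p) • ∑ k, frameCoeff (ι p) k (ι p)
        (push ι X p) • frameHessian cov (ι p) i j k) -
      c • (∑ j, frameCoeff (ι p) j (ι p) (push ι X p) • ∑ k, frameCoeff (ι p) k (ι p)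
        (push ι Y p) • frameHessian cov (ι p) i j k) := by
    simp_rw [smul_sub, Finset.sum_sub_distrib, Finset.smul_sum, smul_smul]
    congr 1
    · simp_rw [mul_assoc]
    · rw [Finset.sum_comm]
      refine Finset.sum_congr rfl fun j _ ↦ Finset.sum_congr rfl fun k _ ↦ ?_
      congr 1
      ring
  rw [hH]
  simp_rw [sub_smul, Finset.sum_sub_distrib, Finset.sum_add_distrib, smul_add, smul_sub]
  simp only [push]
  abel

/-- The curvature tensor computed by fields. -/
theorem curvature_eq (hcov : cov.ContMDiffCovariantDerivative ∞) {x : N}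
    {X Y Z : ∀ y : N, TangentSpace 𝓘(ℝ, F) y}
    (hX : SmoothNear X x) (hY : SmoothNear Y x) (hZ : SmoothNear Z x) :
    curvature (fun s y v ↦ cov s y v) X Y Z x = curvatureTensor cov x (X x) (Y x) (Z x) := by
  have h := curvature_covAlong (ι := fun y : N ↦ y) hcov contMDiff_id' hX hY (V := Z) hZ
  have hpush : ∀ X : ∀ y : N, TangentSpace 𝓘(ℝ, F) y, push (fun y : N ↦ y) X x = X x := fun X ↦
    congr($(mfderiv_id) (X x))
  rw [hpush, hpush] at h
  rw [← h]
  have key : ∀ {X : ∀ y : N, TangentSpace 𝓘(ℝ, F) y}, SmoothNear X x → ∀ v,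
      covAlong cov (fun y : N ↦ y) (fun q ↦ covAlong cov (fun y : N ↦ y) Z q (X q)) x v =
        cov (fun q ↦ cov Z q (X q)) x v := by
    intro X hX v
    rw [covAlong_congr cov (V := fun q ↦ cov Z q (X q))]
    · exact covAlong_id cov (SmoothNear.cov_apply hcov hZ hX) v
    · filter_upwards [hZ.eventually] with q hq using covAlong_id cov hq _
  unfold curvature
  rw [key hX, key hY, covAlong_id cov hZ]

end Curvature

/-! ### Algebraic curvature tensors -/

section Algebra

/-- An algebraic curvature tensor with vanishing sectional curvatures is zero. -/
lemma eq_zero_of_sectional {V : Type*} [AddCommGroup V] {B : V → V → V → V → ℝ}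
    (add₁ : ∀ x x' y z w, B (x + x') y z w = B x y z w + B x' y z w)
    (skew₁ : ∀ x y z w, B x y z w = -B y x z w)
    (skew₂ : ∀ x y z w, B x y z w = -B x y w z)
    (bianchi : ∀ x y z w, B x y z w + B y z x w + B z x y w = 0)
    (pair : ∀ x y z w, B x y z w = B z w x y)
    (h : ∀ x y, B x y y x = 0) (x y z w : V) : B x y z w = 0 := by
  have add₂ : ∀ x y y' z w, B x (y + y') z w = B x y z w + B x y' z w := by
    intro x y y' z w
    rw [skew₁, add₁, skew₁ x y, skew₁ x y']
    ring
  have add₃ : ∀ x y z z' w, B x y (z + z') w = B x y z w + B x y z' w := by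
    intro x y z z' w
    rw [pair, add₁, pair z, pair z']
  have add₄ : ∀ x y z w w', B x y z (w + w') = B x y z w + B x y z w' := by
    intro x y z w w'
    rw [pair, add₂, pair z, pair z w']
  -- Polarization in the outer pair of arguments.
  have h1 : ∀ x y z, B x y y z = 0 := by
    intro x y z
    have := h (x + z) y
    rw [add₁, add₄, add₄, h x y, h z y] at this
    have h2 : B z y y x = B x y y z := by
      rw [pair, skew₁, skew₂]; ring
    linarith
  -- Polarization in the inner pair. Now `B` alternates, the three terms of the Bianchi identity
  -- coincide, and `3B = 0`.
  have h2 : ∀ x y z w, B x y z w = -B x z y w := by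
    intro x y z w
    have := h1 x (y + z) w
    rw [add₂, add₃, add₃, h1, h1] at this
    linarith
  have h3 := bianchi x y z w
  have h4 : B y z x w = B x y z w := by
    rw [h2 y z x w, skew₁ y x z w]; ring
  have h5 : B z x y w = B x y z w := by
    rw [skew₁, h2 x z y w]; ring
  linarith

/-- The pair symmetry of algebraic curvature tensors. -/
lemma pair_symm {V : Type*} {B : V → V → V → V → ℝ}
    (skew₁ : ∀ x y z w, B x y z w = -B y x z w)
    (skew₂ : ∀ x y z w, B x y z w = -B x y w z)
    (bianchi : ∀ x y z w, B x y z w + B y z x w + B z x y w = 0) (x y z w : V) :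
    B x y z w = B z w x y := by
  -- The four Bianchi identities obtained by cyclic rotation of the arguments combine, modulo the
  -- two skew symmetries, to pair symmetry.
  have b1 := bianchi x y z w
  have b2 := bianchi y z w x
  have b3 := bianchi z w x y
  have b4 := bianchi w x y z
  have e1 := skew₂ x y z w
  have e2 := skew₂ z w x y
  have e3 := skew₁ y z w x
  have e4 := skew₂ y z x w
  have e5 := skew₂ z x y w
  have e6 := skew₂ w x y z
  have e7 := skew₁ z x w y
  have e8 := skew₁ w x z y
  have e9 := skew₂ w y z x
  have e10 := skew₁ w y x z
  have e11 := skew₂ y w x z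
  have e12 := skew₁ z x y w
  have e13 := skew₂ x z y w
  have e14 := skew₂ x w y z
  have e15 := skew₁ x y w z
  have e16 := skew₁ z w y x
  linarith

/-- A Kähler algebraic curvature tensor with vanishing holomorphic sectional curvature is zero. -/
lemma eq_zero_of_holomorphic {V : Type*} [AddCommGroup V] {B : V → V → V → V → ℝ} {J : V → V}
    (hJadd : ∀ x y, J (x + y) = J x + J y) (hJJ : ∀ x, J (J x) = -x)
    (add₁ : ∀ x x' y z w, B (x + x') y z w = B x y z w + B x' y z w)
    (skew₁ : ∀ x y z w, B x y z w = -B y x z w)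
    (skew₂ : ∀ x y z w, B x y z w = -B x y w z)
    (bianchi : ∀ x y z w, B x y z w + B y z x w + B z x y w = 0)
    (hJ : ∀ x y z w, B x y (J z) (J w) = B x y z w)
    (h : ∀ x, B x (J x) (J x) x = 0) (x y z w : V) : B x y z w = 0 := by
  have pair := pair_symm skew₁ skew₂ bianchi
  have add₂ : ∀ x y y' z w, B x (y + y') z w = B x y z w + B x y' z w := by
    intro x y y' z w
    rw [skew₁, add₁, skew₁ x y, skew₁ x y']
    ring
  have add₃ : ∀ x y z z' w, B x y (z + z') w = B x y z w + B x y z' w := by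
    intro x y z z' w
    rw [pair, add₁, pair z, pair z']
  have add₄ : ∀ x y z w w', B x y z (w + w') = B x y z w + B x y z w' := by
    intro x y z w w'
    rw [pair, add₂, pair z, pair z w']
  have zero₁ : ∀ y z w, B 0 y z w = 0 := by
    intro y z w
    have := add₁ 0 0 y z w
    rw [add_zero] at this
    linarith
  have neg₁ : ∀ x y z w, B (-x) y z w = -B x y z w := by
    intro x y z w
    have := add₁ x (-x) y z w
    rw [add_neg_cancel, zero₁] at this
    linarith
  have neg₂ : ∀ x y z w, B x (-y) z w = -B x y z w := by
    intro x y z w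
    rw [skew₁, neg₁, skew₁ x y]
  have neg₃ : ∀ x y z w, B x y (-z) w = -B x y z w := by
    intro x y z w
    rw [pair, neg₁, pair z]
  have neg₄ : ∀ x y z w, B x y z (-w) = -B x y z w := by
    intro x y z w
    rw [skew₂, neg₃, skew₂ x y w]
    ring
  have hJneg : ∀ x, J (-x) = -J x := by
    intro x
    have := hJadd x (-x)
    have h0 := hJadd 0 0
    rw [add_zero] at h0
    rw [add_neg_cancel, left_eq_add.1 h0] at this
    exact (neg_eq_of_add_eq_zero_right this.symm).symm
  have hJ' : ∀ x y z w, B (J x) (J y) z w = B x y z w := by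
    intro x y z w
    rw [pair, hJ, pair]
  refine eq_zero_of_sectional add₁ skew₁ skew₂ bianchi pair ?_ x y z w
  -- The terms quadratic in `x` and in `y` of the holomorphic curvatures of `x + y` and `x - y`,
  -- added; `J`-invariance and Bianchi reduce the mixed terms to these two.
  have key : ∀ x y, B x y y x + 3 * B x (J y) (J y) x = 0 := by
    intro x y
    have h1 := h (x + y)
    have h2 := h (x + -y)
    have hx := h x
    have hy := h y
    simp only [hJadd, hJneg, add₁, add₂, add₃, add₄, neg₁, neg₂, neg₃, neg₄] at h1 h2
    have e1 : B x (J y) (J x) y = B x (J y) (J y) x := by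
      rw [← hJ x (J y) (J x) y, hJJ, neg₃, skew₂]; ring
    have e2 : B x (J x) (J y) y = B x y y x + B x (J y) (J y) x := by
      have b := bianchi x (J x) (J y) y
      rw [hJ' x y x y, skew₂ x y x y, skew₁ (J y) x, e1] at b
      linarith
    have e3 : B y (J y) (J x) x = B x (J x) (J y) y := by
      rw [pair, skew₁, skew₂]; ring
    have e4 : B y (J x) (J x) y = B x (J y) (J y) x := by
      rw [← hJ' y, hJJ, neg₂, ← hJ, hJJ, neg₃, pair, skew₁, skew₂]
      ring
    have e5 : B y (J x) (J y) x = B x (J y) (J y) x := by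
      rw [← hJ y (J x) (J y) x, hJJ, neg₃, skew₂, e4]; ring
    linarith
  intro x y
  have k1 := key x y
  -- Replacing `y` by `Jy` exchanges the two sectional terms, and the resulting linear system has
  -- only the zero solution.
  have k2 := key x (J y)
  rw [hJJ, neg₂, neg₃] at k2
  linarith

variable {V : Type*} [NormedAddCommGroup V] [InnerProductSpace ℝ V]

/-- A Kähler algebraic curvature tensor of constant holomorphic sectional curvature `μ` has
constant sectional curvature `μ / 4` on totally real subspaces. -/
lemma inner_curvature_of_holomorphic {R : V → V → V → V} {J : V →ₗ[ℝ] V} {μ : ℝ}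
    (hJJ : ∀ x, J (J x) = -x) (hJi : ∀ x y, inner ℝ (J x) (J y) = inner ℝ x y)
    (add₁ : ∀ x x' y z, R (x + x') y z = R x y z + R x' y z)
    (skew₁ : ∀ x y z, R x y z = -R y x z)
    (skew₂ : ∀ x y z w, inner ℝ (R x y z) w + inner ℝ z (R x y w) = 0)
    (bianchi : ∀ x y z, R x y z + R y z x + R z x y = 0)
    (hJ : ∀ x y z, R x y (J z) = J (R x y z))
    (h : ∀ x, inner ℝ (R x (J x) (J x)) x = μ * (inner ℝ x x) ^ 2)
    {x y z w : V} (hxy : inner ℝ (J x) y = 0) (hxz : inner ℝ (J x) z = 0)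
    (hyz : inner ℝ (J y) z = 0) :
    inner ℝ (R x y z) w = μ / 4 * (inner ℝ y z * inner ℝ x w - inner ℝ x z * inner ℝ y w) := by
  have hJs : ∀ x y, inner ℝ x (J y) = -inner ℝ (J x) y := by
    intro x y
    rw [← hJi x, hJJ, inner_neg_right]
  have hJs' : ∀ x, inner ℝ (J x) x = 0 := by
    intro x
    have := hJs x x
    rw [real_inner_comm] at this
    linarith
  -- The difference from the model curvature tensor of a complex space form. It keeps the Kähler
  -- symmetries and has zero holomorphic curvature, so it vanishes; the assumptions on `x`, `y`, `z`
  -- kill the `J`-terms of the model.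
  set B : V → V → V → V → ℝ := fun x y z w ↦ inner ℝ (R x y z) w - μ / 4 *
    (inner ℝ y z * inner ℝ x w - inner ℝ x z * inner ℝ y w + inner ℝ (J y) z * inner ℝ (J x) w
      - inner ℝ (J x) z * inner ℝ (J y) w - 2 * inner ℝ (J x) y * inner ℝ (J z) w) with hB
  have hB0 : B x y z w = 0 := by
    refine eq_zero_of_holomorphic (J := J) (map_add J) hJJ ?_ ?_ ?_ ?_ ?_ ?_ x y z w
    · intro x x' y z w
      simp only [hB, add₁, inner_add_left, map_add]
      ring
    · intro x y z w
      have e : inner ℝ (J x) y = -inner ℝ (J y) x := by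
        rw [real_inner_comm, hJs]
      simp only [hB]
      rw [skew₁ x y, inner_neg_left, e]
      ring
    · intro x y z w
      have e1 := skew₂ x y z w
      have e2 : inner ℝ (J z) w = -inner ℝ (J w) z := by
        rw [real_inner_comm, hJs]
      simp only [hB]
      rw [e2]
      rw [real_inner_comm (R x y w) z] at e1
      linear_combination e1
    · intro x y z w
      have e1 : inner ℝ (R x y z) w + inner ℝ (R y z x) w + inner ℝ (R z x y) w = 0 := by
        rw [← inner_add_left, ← inner_add_left, bianchi, inner_zero_left]
      have e2 : inner ℝ (J x) y = -inner ℝ (J y) x := by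
        rw [real_inner_comm, hJs]
      have e3 : inner ℝ (J x) z = -inner ℝ (J z) x := by
        rw [real_inner_comm, hJs]
      have e4 : inner ℝ (J y) z = -inner ℝ (J z) y := by
        rw [real_inner_comm, hJs]
      simp only [hB]
      rw [e2, e3, e4, real_inner_comm y x, real_inner_comm z x, real_inner_comm z y]
      linear_combination e1
    · intro x y z w
      simp only [hB, hJ, hJi, hJJ, inner_neg_left]
      rw [hJs y z, hJs x z, hJs x w, hJs y w, hJs z w]
      ring
    · intro x
      simp only [hB, h, hJi, hJJ, inner_neg_left, hJs', hJs]
      ring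
  have : inner ℝ (R x y z) w - μ / 4 *
    (inner ℝ y z * inner ℝ x w - inner ℝ x z * inner ℝ y w + inner ℝ (J y) z * inner ℝ (J x) w
      - inner ℝ (J x) z * inner ℝ (J y) w - 2 * inner ℝ (J x) y * inner ℝ (J z) w) = 0 := hB0
  rw [hxy, hxz, hyz] at this
  linear_combination this

end Algebra

/-! ### Metric and complex structure along the immersion, and the ambient curvature -/

section Kaehler

variable {E : Type*} [NormedAddCommGroup E] [NormedSpace ℝ E] [FiniteDimensional ℝ E]
  {M : Type*} [TopologicalSpace M] [ChartedSpace E M] [IsManifold 𝓘(ℝ, E) ∞ M]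
  {F : Type*} [NormedAddCommGroup F] [NormedSpace ℝ F] [FiniteDimensional ℝ F]
  {N : Type*} [TopologicalSpace N] [ChartedSpace F N] [IsManifold 𝓘(ℝ, F) ∞ N]
  [RiemannianBundle (fun x : N ↦ TangentSpace 𝓘(ℝ, F) x)]
  [IsContMDiffRiemannianBundle 𝓘(ℝ, F) ∞ F (fun x : N ↦ TangentSpace 𝓘(ℝ, F) x)]
  {cov : CovariantDerivative 𝓘(ℝ, F) F (fun x : N ↦ TangentSpace 𝓘(ℝ, F) x)}
  {J : ∀ x : N, TangentSpace 𝓘(ℝ, F) x →L[ℝ] TangentSpace 𝓘(ℝ, F) x}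
  {ι : M → N} {p : M}

lemma SmoothAlongNear.smoothFnNear_inner {V W : ∀ q : M, TangentSpace 𝓘(ℝ, F) (ι q)}
    (hV : SmoothAlongNear (E := E) ι V p) (hW : SmoothAlongNear (E := E) ι W p) :
    SmoothFnNear E (fun q ↦ inner ℝ (V q) (W q)) p := by
  filter_upwards [hV, hW] with q hq hq'
  exact ContMDiffAt.inner_bundle hq hq'

/-- The connection along `ι` is metric. -/
lemma mvfderiv_inner_along (hm : CovariantDerivative.IsMetricCompatible (F := F)
      (V := fun x : N ↦ TangentSpace 𝓘(ℝ, F) x) cov)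
    (hι : ContMDiff 𝓘(ℝ, E) 𝓘(ℝ, F) ∞ ι) {V W : ∀ q : M, TangentSpace 𝓘(ℝ, F) (ι q)}
    (hV : SmoothAlongNear (E := E) ι V p) (hW : SmoothAlongNear (E := E) ι W p)
    (v : TangentSpace 𝓘(ℝ, E) p) :
    mvfderiv 𝓘(ℝ, E) (fun q ↦ inner ℝ (V q) (W q)) p v =
      inner ℝ (covAlong cov ι V p v) (W p) + inner ℝ (V p) (covAlong cov ι W p v) := by
  have symm : ∀ V W : ∀ q : M, TangentSpace 𝓘(ℝ, F) (ι q),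
      mvfderiv 𝓘(ℝ, E) (fun q ↦ inner ℝ (V q) (W q)) p v =
        inner ℝ (covAlong cov ι V p v) (W p) + inner ℝ (V p) (covAlong cov ι W p v) →
      mvfderiv 𝓘(ℝ, E) (fun q ↦ inner ℝ (W q) (V q)) p v =
        inner ℝ (covAlong cov ι W p v) (V p) + inner ℝ (W p) (covAlong cov ι V p v) := by
    intro V W h
    simp_rw [fun q ↦ real_inner_comm (V q) (W q)]
    rw [h, real_inner_comm (V p), real_inner_comm (W p), add_comm]
  -- Reduces the first argument to a restricted field `Y ∘ ι`. It is used twice, with `symm` in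
  -- between, until both arguments are restrictions and the compatibility on `N` applies.
  have step : ∀ W : ∀ q : M, TangentSpace 𝓘(ℝ, F) (ι q), SmoothAlongNear (E := E) ι W p →
      (∀ Y : ∀ x : N, TangentSpace 𝓘(ℝ, F) x, SmoothNear Y (ι p) →
        mvfderiv 𝓘(ℝ, E) (fun q ↦ inner ℝ (Y (ι q)) (W q)) p v =
        inner ℝ (covAlong cov ι (fun q ↦ Y (ι q)) p v) (W p)
          + inner ℝ (Y (ι p)) (covAlong cov ι W p v)) →
      ∀ V : ∀ q : M, TangentSpace 𝓘(ℝ, F) (ι q), SmoothAlongNear (E := E) ι V p →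
      mvfderiv 𝓘(ℝ, E) (fun q ↦ inner ℝ (V q) (W q)) p v =
        inner ℝ (covAlong cov ι V p v) (W p) + inner ℝ (V p) (covAlong cov ι W p v) := by
    intro W hW hcomp V hV
    refine SmoothAlongNear.induction hι (P := fun V ↦
      mvfderiv 𝓘(ℝ, E) (fun q ↦ inner ℝ (V q) (W q)) p v =
        inner ℝ (covAlong cov ι V p v) (W p) + inner ℝ (V p) (covAlong cov ι W p v))
      hcomp ?_ ?_ ?_ hV
    · intro c V hc hV ih
      simp only [inner_smul_left, conj_trivial]
      rw [hc.mvfderiv_mul (hV.smoothFnNear_inner hW), covAlong_smul cov hι hc hV, ih,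
          inner_add_left,
        inner_smul_left, inner_smul_left, conj_trivial, conj_trivial]
      ring
    · intro V V' hV hV' ih ih'
      simp only [inner_add_left]
      rw [(hV.smoothFnNear_inner hW).mvfderiv_add (hV'.smoothFnNear_inner hW), ih, ih',
          covAlong_add cov hι hV hV',
        inner_add_left]
      ring
    · intro V V' hV h ih
      rw [covAlong_congr cov h, h.self_of_nhds, ← ih]
      exact mvfderiv_congr (h.mono fun q hq ↦ by rw [hq]) v
  refine step W hW ?_ V hV
  intro Y hY
  refine symm _ _ (step _ (hY.comp hι) ?_ W hW)
  intro Z hZ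
  have hsm : SmoothFnNear F (fun x ↦ inner ℝ (Z x) (Y x)) (ι p) :=
    SmoothAlongNear.smoothFnNear_inner (ι := fun x : N ↦ x) hZ hY
  rw [hsm.mvfderiv_comp hι, covAlong_comp cov hι hY, covAlong_comp cov hι hZ]
  have := hm.mvfderiv_inner_eq (constField (ι p) (mfderiv 𝓘(ℝ, E) 𝓘(ℝ, F) ι p v))
    hZ.mdifferentiableAt hY.mdifferentiableAt
  simp only [constField_self] at this
  exact this

lemma SmoothAlongNear.complexStructure (h : IsKaehler cov J)
    {V : ∀ q : M, TangentSpace 𝓘(ℝ, F) (ι q)} (hι : ContMDiff 𝓘(ℝ, E) 𝓘(ℝ, F) ∞ ι)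
    (hV : SmoothAlongNear (E := E) ι V p) :
    SmoothAlongNear (E := E) ι (fun q ↦ J (ι q) (V q)) p := by
  filter_upwards [hV] with q hq
  exact ContMDiffAt.clm_bundle_apply ((h.smooth_J.comp hι).contMDiffAt) hq

/-- `J` is parallel along `ι`. -/
lemma covAlong_complexStructure (h : IsKaehler cov J) (hι : ContMDiff 𝓘(ℝ, E) 𝓘(ℝ, F) ∞ ι)
    {V : ∀ q : M, TangentSpace 𝓘(ℝ, F) (ι q)} (hV : SmoothAlongNear (E := E) ι V p)
    (v : TangentSpace 𝓘(ℝ, E) p) :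
    covAlong cov ι (fun q ↦ J (ι q) (V q)) p v = J (ι p) (covAlong cov ι V p v) := by
  refine SmoothAlongNear.induction hι (P := fun V ↦
    covAlong cov ι (fun q ↦ J (ι q) (V q)) p v = J (ι p) (covAlong cov ι V p v)) ?_ ?_ ?_ ?_ hV
  · intro Y hY
    have hJY : SmoothNear (fun x ↦ J x (Y x)) (ι p) :=
      SmoothAlongNear.complexStructure (ι := fun x : N ↦ x) h contMDiff_id' hY
    rw [covAlong_comp cov hι hY, covAlong_comp cov hι hJY]
    exact h.J_parallel (ι p) Y hY _
  · intro c V hc hV ih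
    simp only [map_smul]
    rw [covAlong_smul cov hι hc (hV.complexStructure h hι), ih, covAlong_smul cov hι hc hV, map_add,
      map_smul, map_smul]
  · intro V W hV hW ih ih'
    simp only [map_add]
    rw [covAlong_add cov hι (hV.complexStructure h hι) (hW.complexStructure h hι), ih, ih',
      covAlong_add cov hι hV hW, map_add]
  · intro V W hV hVW ih
    rw [covAlong_congr cov hVW, ← ih]
    exact covAlong_congr cov (hVW.mono fun q hq ↦ by rw [hq]) v

variable [T2Space N]

/-- Constant-coordinate extensions commute, so the bracket term drops out and the symmetries of the
curvature become statements about second covariant derivatives. -/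
lemma curvatureTensor_constField (hcov : cov.ContMDiffCovariantDerivative ∞) (x : N)
    (u v w : TangentSpace 𝓘(ℝ, F) x) :
    curvatureTensor cov x u v w = cov (fun y ↦ cov (constField x w) y (constField x v y)) x u -
      cov (fun y ↦ cov (constField x w) y (constField x u y)) x v := by
  have h := curvature_eq hcov (constField_smoothNear_self x u) (constField_smoothNear_self x v)
    (constField_smoothNear_self x w)
  rw [curvature, mlieBracket_constField (mem_frameDomain x)] at h
  simp only [constField_self, map_zero, sub_zero] at h
  exact h.symm

lemma curvatureTensor_add_left (x : N) (u u' v w : TangentSpace 𝓘(ℝ, F) x) :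
    curvatureTensor cov x (u + u') v w =
        curvatureTensor cov x u v w + curvatureTensor cov x u' v w := by
  simp only [curvatureTensor, ← Finset.sum_add_distrib, map_add, mul_add, add_smul]

lemma curvatureTensor_swap (hcov : cov.ContMDiffCovariantDerivative ∞) (x : N)
    (u v w : TangentSpace 𝓘(ℝ, F) x) :
    curvatureTensor cov x u v w = -curvatureTensor cov x v u w := by
  rw [curvatureTensor_constField hcov, curvatureTensor_constField hcov, neg_sub]

/-- For commuting fields, vanishing torsion makes `∇_B A = ∇_A B` on a whole neighbourhood; after
one more derivative the six terms of the cyclic sum cancel in pairs. -/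
lemma curvatureTensor_bianchi (hcov : cov.ContMDiffCovariantDerivative ∞) (ht : cov.torsion = 0)
    (x : N) (u v w : TangentSpace 𝓘(ℝ, F) x) :
    curvatureTensor cov x u v w + curvatureTensor cov x v w u + curvatureTensor cov x w u v =
        0 := by
  have key : ∀ a b c : TangentSpace 𝓘(ℝ, F) x,
      cov (fun y ↦ cov (constField x a) y (constField x b y)) x c =
      cov (fun y ↦ cov (constField x b) y (constField x a y)) x c := by
    intro a b c
    congr 1
    refine cov_congr cov (SmoothNear.cov_apply hcov (constField_smoothNear_self x b)
      (constField_smoothNear_self x a)) ?_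
    filter_upwards [(isOpen_frameDomain (F := F) x).mem_nhds (mem_frameDomain x)] with y hy
    exact cov_comm ht (constField_smoothNear x a hy) (constField_smoothNear x b hy)
      (mlieBracket_constField hy a b)
  rw [curvatureTensor_constField hcov, curvatureTensor_constField hcov,
    curvatureTensor_constField hcov, key w v u, key u w v, key v u w]
  abel

/-- Second derivatives of the function `⟨W, Z⟩` along two commuting fields agree. Expanding them by
the metric property, the cross terms `⟨∇W, ∇Z⟩` are symmetric in the two directions and drop out. -/
lemma inner_curvatureTensor_skew (hcov : cov.ContMDiffCovariantDerivative ∞)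
    (hm : CovariantDerivative.IsMetricCompatible (F := F)
      (V := fun x : N ↦ TangentSpace 𝓘(ℝ, F) x) cov) (x : N) (u v w z : TangentSpace 𝓘(ℝ, F) x) :
    inner ℝ (curvatureTensor cov x u v w) z + inner ℝ w (curvatureTensor cov x u v z) = 0 := by
  have hW := constField_smoothNear_self x w
  have hZ := constField_smoothNear_self x z
  have metric : ∀ {y : N} {A B : ∀ y : N, TangentSpace 𝓘(ℝ, F) y}, SmoothNear A y → SmoothNear B y →
      ∀ t : TangentSpace 𝓘(ℝ, F) y, mvfderiv 𝓘(ℝ, F) (fun q ↦ inner ℝ (A q) (B q)) y t =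
      inner ℝ (cov A y t) (B y) + inner ℝ (A y) (cov B y t) := by
    intro y A B hA hB t
    have := mvfderiv_inner_along hm (ι := fun y : N ↦ y) contMDiff_id' hA hB t
    rwa [covAlong_id cov hA, covAlong_id cov hB] at this
  have hf : SmoothFnNear F (fun y ↦ inner ℝ (constField x w y) (constField x z y)) x :=
    SmoothAlongNear.smoothFnNear_inner (ι := fun x : N ↦ x) hW hZ
  have second : ∀ s t : TangentSpace 𝓘(ℝ, F) x,
      mvfderiv 𝓘(ℝ, F) (fun y ↦ mvfderiv 𝓘(ℝ, F)
        (fun y ↦ inner ℝ (constField x w y) (constField x z y)) y (constField x t y)) x s =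
      inner ℝ (cov (fun y ↦ cov (constField x w) y (constField x t y)) x s) z +
      inner ℝ (cov (constField x w) x t) (cov (constField x z) x s) +
      (inner ℝ (cov (constField x w) x s) (cov (constField x z) x t) +
      inner ℝ w (cov (fun y ↦ cov (constField x z) y (constField x t y)) x s)) := by
    intro s t
    have hT := constField_smoothNear_self x t
    have hWT := SmoothNear.cov_apply hcov hW hT
    have hZT := SmoothNear.cov_apply hcov hZ hT
    rw [mvfderiv_congr (d := fun y ↦
      inner ℝ (cov (constField x w) y (constField x t y)) (constField x z y) +
      inner ℝ (constField x w y) (cov (constField x z) y (constField x t y))),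
      SmoothFnNear.mvfderiv_add (SmoothAlongNear.smoothFnNear_inner (ι := fun x : N ↦ x) hWT hZ)
        (SmoothAlongNear.smoothFnNear_inner (ι := fun x : N ↦ x) hW hZT), metric hWT hZ,
            metric hW hZT]
    · simp only [constField_self]
    · filter_upwards [hW.eventually, hZ.eventually] with y hWy hZy
      exact metric hWy hZy _
  have hbr := hf.mvfderiv_mlieBracket (constField_smoothNear_self x u)
    (constField_smoothNear_self x v)
  rw [mlieBracket_constField (mem_frameDomain x), map_zero] at hbr
  simp only [constField_self, second] at hbr
  rw [curvatureTensor_constField hcov, curvatureTensor_constField hcov, inner_sub_left,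
    inner_sub_right]
  linarith

variable (h : IsKaehler cov J)

include h

/-- A parallel `J` passes through both covariant derivatives of the extension of `w`. -/
lemma curvatureTensor_complexStructure (x : N) (u v w : TangentSpace 𝓘(ℝ, F) x) :
    curvatureTensor cov x u v (J x w) = J x (curvatureTensor cov x u v w) := by
  have hcov := h.smooth_cov
  have hW := constField_smoothNear_self x w
  have hJW : SmoothNear (fun y ↦ J y (constField x w y)) x :=
    SmoothAlongNear.complexStructure (ι := fun x : N ↦ x) h contMDiff_id' hW
  have e1 := curvature_eq hcov (constField_smoothNear_self x u) (constField_smoothNear_self x v) hJW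
  have second : ∀ s t : TangentSpace 𝓘(ℝ, F) x,
      cov (fun y ↦ cov (fun y ↦ J y (constField x w y)) y (constField x t y)) x s =
      J x (cov (fun y ↦ cov (constField x w) y (constField x t y)) x s) := by
    intro s t
    have hWT := SmoothNear.cov_apply hcov hW (constField_smoothNear_self x t)
    rw [← h.J_parallel x _ hWT, cov_congr cov (SmoothAlongNear.complexStructure
      (ι := fun x : N ↦ x) h contMDiff_id' hWT)]
    filter_upwards [hW.eventually] with y hWy
    exact h.J_parallel y _ hWy _
  rw [curvature, mlieBracket_constField (mem_frameDomain x)] at e1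
  simp only [constField_self, map_zero, sub_zero, second] at e1
  rw [← e1, curvatureTensor_constField hcov, map_sub]

/-- The curvature of a complex space form on totally real subspaces. -/
theorem inner_curvatureTensor_of_totallyReal {μ : ℝ} (hμ : HasConstantHolomorphicCurvature cov J μ)
    (x : N) {u v w z : TangentSpace 𝓘(ℝ, F) x} (huv : inner ℝ (J x u) v = 0)
    (huw : inner ℝ (J x u) w = 0) (hvw : inner ℝ (J x v) w = 0) :
    inner ℝ (curvatureTensor cov x u v w) z =
      μ / 4 * (inner ℝ v w * inner ℝ u z - inner ℝ u w * inner ℝ v z) := by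
  refine inner_curvature_of_holomorphic (R := curvatureTensor cov x) (J := (J x).toLinearMap)
    (h.J_sq x) (h.J_orthogonal x) (curvatureTensor_add_left x)
    (curvatureTensor_swap h.smooth_cov x) (inner_curvatureTensor_skew h.smooth_cov h.metric x)
    (curvatureTensor_bianchi h.smooth_cov h.torsion_free x) (curvatureTensor_complexStructure h x)
    ?_ huv huw hvw
  intro v
  have hV := constField_smoothNear_self x v
  have hJV : SmoothNear (fun y ↦ J y (constField x v y)) x :=
    SmoothAlongNear.complexStructure (ι := fun x : N ↦ x) h contMDiff_id' hV
  have := hμ x _ hV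
  rw [curvature_eq h.smooth_cov hV hJV hJV] at this
  simp only [constField_self] at this
  exact this

end Kaehler

/-! ### Tangential and normal components -/

section Projections

variable {E : Type*} [NormedAddCommGroup E] [NormedSpace ℝ E] [FiniteDimensional ℝ E]
  {M : Type*} [TopologicalSpace M] [ChartedSpace E M] [IsManifold 𝓘(ℝ, E) ∞ M]
  {F : Type*} [NormedAddCommGroup F] [NormedSpace ℝ F] [FiniteDimensional ℝ F]
  {N : Type*} [TopologicalSpace N] [ChartedSpace F N] [IsManifold 𝓘(ℝ, F) ∞ N]
  [RiemannianBundle (fun x : N ↦ TangentSpace 𝓘(ℝ, F) x)]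
  {ι : M → N} {p : M}

lemma mfderiv_mem_tangentSubspace (v : TangentSpace 𝓘(ℝ, E) p) :
    mfderiv 𝓘(ℝ, E) 𝓘(ℝ, F) ι p v ∈ tangentSubspace E (F := F) ι p :=
  ⟨v, rfl⟩

lemma mem_tangentSubspace_orthogonal_iff {w : TangentSpace 𝓘(ℝ, F) (ι p)} :
    w ∈ (tangentSubspace E ι p)ᗮ ↔ ∀ v, inner ℝ (mfderiv 𝓘(ℝ, E) 𝓘(ℝ, F) ι p v) w = 0 := by
  rw [Submodule.mem_orthogonal]
  constructor
  · exact fun h v ↦ h _ (mfderiv_mem_tangentSubspace v)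
  · rintro h _ ⟨v, rfl⟩
    exact h v

lemma normalPart_mem_orthogonal (w : TangentSpace 𝓘(ℝ, F) (ι p)) :
    normalPart E ι p w ∈ (tangentSubspace E ι p)ᗮ :=
  (tangentSubspace E ι p).sub_starProjection_mem_orthogonal w

lemma inner_mfderiv_normalPart (v : TangentSpace 𝓘(ℝ, E) p) (w : TangentSpace 𝓘(ℝ, F) (ι p)) :
    inner ℝ (mfderiv 𝓘(ℝ, E) 𝓘(ℝ, F) ι p v) (normalPart E ι p w) = 0 :=
  mem_tangentSubspace_orthogonal_iff.1 (normalPart_mem_orthogonal w) v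

lemma normalPart_add (w w' : TangentSpace 𝓘(ℝ, F) (ι p)) :
    normalPart E ι p (w + w') = normalPart E ι p w + normalPart E ι p w' := by
  simp only [normalPart, map_add]
  abel

lemma normalPart_smul (c : ℝ) (w : TangentSpace 𝓘(ℝ, F) (ι p)) :
    normalPart E ι p (c • w) = c • normalPart E ι p w := by
  simp only [normalPart, map_smul, smul_sub]

lemma normalPart_neg (w : TangentSpace 𝓘(ℝ, F) (ι p)) :
    normalPart E ι p (-w) = -normalPart E ι p w := by
  rw [← neg_one_smul ℝ, normalPart_smul, neg_one_smul]

lemma normalPart_zero : normalPart E ι p (0 : TangentSpace 𝓘(ℝ, F) (ι p)) = 0 := by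
  simp [normalPart]

lemma normalPart_sub (w w' : TangentSpace 𝓘(ℝ, F) (ι p)) :
    normalPart E ι p (w - w') = normalPart E ι p w - normalPart E ι p w' := by
  rw [sub_eq_add_neg, normalPart_add, normalPart_neg, sub_eq_add_neg]

lemma tangentPart_add (w w' : TangentSpace 𝓘(ℝ, F) (ι p)) :
    tangentPart E ι p (w + w') = tangentPart E ι p w + tangentPart E ι p w' := by
  simp only [tangentPart, map_add]

lemma tangentPart_smul (c : ℝ) (w : TangentSpace 𝓘(ℝ, F) (ι p)) :
    tangentPart E ι p (c • w) = c • tangentPart E ι p w := by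
  simp only [tangentPart, map_smul]

variable (hι : IsSubmanifold E F ι)

include hι

lemma mfderiv_tangentPart (w : TangentSpace 𝓘(ℝ, F) (ι p)) :
    mfderiv 𝓘(ℝ, E) 𝓘(ℝ, F) ι p (tangentPart E ι p w) =
      (tangentSubspace E ι p).starProjection w := by
  obtain ⟨v, hv⟩ := (tangentSubspace E ι p).starProjection_apply_mem w
  have h : tangentPart E ι p w = v := by
    unfold tangentPart
    rw [← hv]
    exact LinearMap.leftInverse_apply_of_inj (LinearMap.ker_eq_bot.2 (hι.injective p)) v
  rw [h]
  exact hv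

lemma mfderiv_tangentPart_add_normalPart (w : TangentSpace 𝓘(ℝ, F) (ι p)) :
    mfderiv 𝓘(ℝ, E) 𝓘(ℝ, F) ι p (tangentPart E ι p w) + normalPart E ι p w = w := by
  rw [mfderiv_tangentPart hι, normalPart]
  abel

lemma normalPart_eq (w : TangentSpace 𝓘(ℝ, F) (ι p)) :
    normalPart E ι p w = w - mfderiv 𝓘(ℝ, E) 𝓘(ℝ, F) ι p (tangentPart E ι p w) := by
  rw [mfderiv_tangentPart hι, normalPart]

lemma tangentPart_add_of_mem_orthogonal (v : TangentSpace 𝓘(ℝ, E) p)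
    {s : TangentSpace 𝓘(ℝ, F) (ι p)} (hs : s ∈ (tangentSubspace E ι p)ᗮ) :
    tangentPart E ι p (mfderiv 𝓘(ℝ, E) 𝓘(ℝ, F) ι p v + s) = v := by
  apply hι.injective p
  rw [mfderiv_tangentPart hι]
  refine Submodule.eq_starProjection_of_mem_of_inner_eq_zero (mfderiv_mem_tangentSubspace v) ?_
  intro w hw
  rw [add_sub_cancel_left, real_inner_comm]
  exact (Submodule.mem_orthogonal _ _).1 hs w hw

lemma tangentPart_mfderiv (v : TangentSpace 𝓘(ℝ, E) p) :
    tangentPart E ι p (mfderiv 𝓘(ℝ, E) 𝓘(ℝ, F) ι p v) = v := by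
  simpa using tangentPart_add_of_mem_orthogonal hι v (Submodule.zero_mem _)

lemma normalPart_mfderiv (v : TangentSpace 𝓘(ℝ, E) p) :
    normalPart E ι p (mfderiv 𝓘(ℝ, E) 𝓘(ℝ, F) ι p v) = 0 := by
  rw [normalPart_eq hι, tangentPart_mfderiv hι, sub_self]

lemma tangentPart_of_mem_orthogonal {s : TangentSpace 𝓘(ℝ, F) (ι p)}
    (hs : s ∈ (tangentSubspace E ι p)ᗮ) : tangentPart E ι p s = 0 := by
  simpa using tangentPart_add_of_mem_orthogonal hι 0 hs

lemma normalPart_of_mem_orthogonal {s : TangentSpace 𝓘(ℝ, F) (ι p)}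
    (hs : s ∈ (tangentSubspace E ι p)ᗮ) : normalPart E ι p s = s := by
  rw [normalPart_eq hι, tangentPart_of_mem_orthogonal hι hs, map_zero, sub_zero]

variable [IsContMDiffRiemannianBundle 𝓘(ℝ, F) ∞ F (fun x : N ↦ TangentSpace 𝓘(ℝ, F) x)]

/-- The tangential component of a smooth field is smooth. -/
lemma SmoothAlongNear.smoothNear_tangentPart {V : ∀ q : M, TangentSpace 𝓘(ℝ, F) (ι q)}
    (hV : SmoothAlongNear (E := E) ι V p) :
    SmoothNear (fun q ↦ tangentPart E ι q (V q)) p := by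
  set U : Fin (Module.finrank ℝ E) → ∀ q : M, TangentSpace 𝓘(ℝ, F) (ι q) :=
    fun a ↦ push ι (frame p a) with hU
  -- `g` is the Gram matrix of the pushed frame. The coefficients of the tangential part of `V`
  -- solve a linear system with matrix `g` and right-hand side `β`; Cramer's rule makes them visibly
  -- smooth.
  set g : M → Matrix (Fin (Module.finrank ℝ E)) (Fin (Module.finrank ℝ E)) ℝ :=
    fun q ↦ .of fun a b ↦ inner ℝ (U a q) (U b q) with hg
  set β : M → Fin (Module.finrank ℝ E) → ℝ := fun q a ↦ inner ℝ (U a q) (V q) with hβ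
  have hdom := mem_frameDomain (F := E) p
  have hfr := fun a ↦ frame_smoothNear hdom a
  have hUs : ∀ a, SmoothAlongNear (E := E) ι (U a) p := fun a ↦
    (hfr a).smoothAlongNear_push hι.smooth
  have hgs : ∀ a b, SmoothFnNear E (fun q ↦ g q a b) p :=
      fun a b ↦ (hUs a).smoothFnNear_inner (hUs b)
  have hβs : ∀ a, SmoothFnNear E (fun q ↦ β q a) p := fun a ↦ (hUs a).smoothFnNear_inner hV
  have hdets : SmoothFnNear E (fun q ↦ (g q).det) p := .det hgs
  -- The immersion keeps the frame independent, so its Gram matrix is positive definite.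
  have hdet : (g p).det ≠ 0 := by
    have hli : LinearIndependent ℝ fun a ↦ U a p := by
      have h1 : LinearIndependent ℝ fun a ↦ frame (F := E) p a p := by
        rw [Fintype.linearIndependent_iff]
        intro c hc a
        have := congr(frameCoeff p a p $hc)
        simpa [map_sum, frameCoeff_frame hdom] using this
      exact h1.map' (mfderiv 𝓘(ℝ, E) 𝓘(ℝ, F) ι p).toLinearMap
        (LinearMap.ker_eq_bot.2 (hι.injective p))
    exact (Matrix.posDef_gram_of_linearIndependent hli).det_pos.ne'
  have hdet' : ∀ᶠ q in 𝓝 p, (g q).det ≠ 0 := hdets.contMDiffAt.continuousAt.eventually_ne hdet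
  have hcr : ∀ a, SmoothFnNear E (fun q ↦ (g q).cramer (β q) a) p := by
    intro a
    simp only [Matrix.cramer_apply]
    refine .det fun i j ↦ ?_
    by_cases hj : j = a
    · subst hj
      simpa using hβs i
    · simpa [Matrix.updateCol_apply, hj] using hgs i j
  refine SmoothAlongNear.congr (ι := fun q : M ↦ q) (V := fun q ↦ ∑ a,
    (((g q).det)⁻¹ * (g q).cramer (β q) a) • frame p a q)
    (.sum contMDiff_id' _ fun a _ ↦ .smul contMDiff_id' ((hdets.inv hdet).mul (hcr a)) (hfr a)) ?_
  filter_upwards [hdet', (isOpen_frameDomain (F := E) p).mem_nhds hdom] with q hq hqd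
  set r : TangentSpace 𝓘(ℝ, E) q := ∑ a, (((g q).det)⁻¹ * (g q).cramer (β q) a) • frame p a q
  have hr : mfderiv 𝓘(ℝ, E) 𝓘(ℝ, F) ι q r =
      ∑ a, (((g q).det)⁻¹ * (g q).cramer (β q) a) • U a q := by
    simp only [r, map_sum, map_smul]
    rfl
  have hort : ∀ b, inner ℝ (U b q) (mfderiv 𝓘(ℝ, E) 𝓘(ℝ, F) ι q r) = inner ℝ (U b q) (V q) := by
    intro b
    have h1 := congr_fun (Matrix.mulVec_cramer (g q) (β q)) b
    simp only [Matrix.mulVec, dotProduct, Pi.smul_apply, smul_eq_mul] at h1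
    rw [hr, inner_sum]
    simp only [inner_smul_right]
    have h2 : ∑ a, (g q).det⁻¹ * (g q).cramer (β q) a * inner ℝ (U b q) (U a q) =
        (g q).det⁻¹ * ∑ a, g q b a * (g q).cramer (β q) a := by
      rw [Finset.mul_sum]
      refine Finset.sum_congr rfl fun a _ ↦ ?_
      change _ = (g q).det⁻¹ * (inner ℝ (U b q) (U a q) * _)
      ring
    rw [h2, h1, ← mul_assoc, inv_mul_cancel₀ hq, one_mul]
  -- The remainder is orthogonal to the pushed frame, hence normal; uniqueness of the decomposition
  -- identifies `r`.
  have hn : V q - mfderiv 𝓘(ℝ, E) 𝓘(ℝ, F) ι q r ∈ (tangentSubspace E ι q)ᗮ := by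
    rw [mem_tangentSubspace_orthogonal_iff]
    intro v
    rw [← sum_frameCoeff_smul_frame hqd v, map_sum, sum_inner]
    refine Finset.sum_eq_zero fun b _ ↦ ?_
    rw [map_smul, inner_smul_left, inner_sub_right]
    have := hort b
    simp only [hU, push] at this
    rw [this, sub_self, mul_zero]
  have := tangentPart_add_of_mem_orthogonal hι r hn
  rwa [add_sub_cancel] at this

lemma SmoothAlongNear.smoothAlongNear_normalPart {V : ∀ q : M, TangentSpace 𝓘(ℝ, F) (ι q)}
    (hV : SmoothAlongNear (E := E) ι V p) :
    SmoothAlongNear (E := E) ι (fun q ↦ normalPart E ι q (V q)) p := by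
  simp only [normalPart_eq hι]
  exact hV.sub hι.smooth ((hV.smoothNear_tangentPart hι).smoothAlongNear_push hι.smooth)

end Projections

/-! ### The second fundamental form and the Gauss equation -/

section SecondForm

variable {E : Type*} [NormedAddCommGroup E] [NormedSpace ℝ E] [FiniteDimensional ℝ E]
  {M : Type*} [TopologicalSpace M] [T2Space M] [ChartedSpace E M] [IsManifold 𝓘(ℝ, E) ∞ M]
  {F : Type*} [NormedAddCommGroup F] [NormedSpace ℝ F] [FiniteDimensional ℝ F]
  {N : Type*} [TopologicalSpace N] [T2Space N] [ChartedSpace F N] [IsManifold 𝓘(ℝ, F) ∞ N]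
  [RiemannianBundle (fun x : N ↦ TangentSpace 𝓘(ℝ, F) x)]
  [IsContMDiffRiemannianBundle 𝓘(ℝ, F) ∞ F (fun x : N ↦ TangentSpace 𝓘(ℝ, F) x)]
  (cov : CovariantDerivative 𝓘(ℝ, F) F (fun x : N ↦ TangentSpace 𝓘(ℝ, F) x))
  {J : ∀ x : N, TangentSpace 𝓘(ℝ, F) x →L[ℝ] TangentSpace 𝓘(ℝ, F) x}
  (ι : M → N) {p : M}

/-- The second fundamental form as a form on the tangent space at `p`. -/
def secondForm (p : M) (v w : TangentSpace 𝓘(ℝ, E) p) : TangentSpace 𝓘(ℝ, F) (ι p) :=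
  normalPart E ι p (covAlong cov ι (push ι (constField p w)) p v)

variable {cov ι}

lemma secondForm_mem_orthogonal (v w : TangentSpace 𝓘(ℝ, E) p) :
    secondForm cov ι p v w ∈ (tangentSubspace E ι p)ᗮ :=
  normalPart_mem_orthogonal _

lemma inner_mfderiv_secondForm (u v w : TangentSpace 𝓘(ℝ, E) p) :
    inner ℝ (mfderiv 𝓘(ℝ, E) 𝓘(ℝ, F) ι p u) (secondForm cov ι p v w) = 0 :=
  inner_mfderiv_normalPart _ _

lemma inner_secondForm_mfderiv (u v w : TangentSpace 𝓘(ℝ, E) p) :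
    inner ℝ (secondForm cov ι p v w) (mfderiv 𝓘(ℝ, E) 𝓘(ℝ, F) ι p u) = 0 := by
  rw [real_inner_comm, inner_mfderiv_secondForm]

lemma constField_smoothAlongNear (hι : IsSubmanifold E F ι) (v : TangentSpace 𝓘(ℝ, E) p) :
    SmoothAlongNear (E := E) (F := F) ι (push ι (constField p v)) p :=
  (constField_smoothNear_self p v).smoothAlongNear_push hι.smooth

lemma push_constField_self (v : TangentSpace 𝓘(ℝ, E) p) :
    push ι (constField p v) p = mfderiv 𝓘(ℝ, E) 𝓘(ℝ, F) ι p v := by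
  rw [push, constField_self]

lemma secondFundamentalForm_comm (ht : cov.torsion = 0) (hι : IsSubmanifold E F ι)
    {X Y : ∀ q : M, TangentSpace 𝓘(ℝ, E) q} (hX : SmoothNear X p) (hY : SmoothNear Y p) :
    secondFundamentalForm cov ι X Y p = secondFundamentalForm cov ι Y X p := by
  rw [← sub_eq_zero, secondFundamentalForm, secondFundamentalForm, ← normalPart_sub,
    covAlong_push_sub ht hι.smooth hX hY, normalPart_mfderiv hι]

/-- Tensoriality in `Y` comes from symmetry: `σ(V, Y) = σ(Y, V)`, and the right side sees `Y` only
through its value at `p`. -/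
lemma normalPart_covAlong_push (ht : cov.torsion = 0) (hι : IsSubmanifold E F ι)
    {Y : ∀ q : M, TangentSpace 𝓘(ℝ, E) q} (hY : SmoothNear Y p) (v : TangentSpace 𝓘(ℝ, E) p) :
    normalPart E ι p (covAlong cov ι (push ι Y) p v) = secondForm cov ι p v (Y p) := by
  have hv := constField_smoothNear_self p v
  have hw := constField_smoothNear_self p (Y p)
  have h1 := secondFundamentalForm_comm ht hι hv hY
  have h2 := secondFundamentalForm_comm ht hι hv hw
  simp only [secondFundamentalForm, constField_self] at h1 h2
  rw [h1, secondForm, h2]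

lemma secondFundamentalForm_eq (ht : cov.torsion = 0) (hι : IsSubmanifold E F ι)
    (X : ∀ q : M, TangentSpace 𝓘(ℝ, E) q) {Y : ∀ q : M, TangentSpace 𝓘(ℝ, E) q}
    (hY : SmoothNear Y p) :
    secondFundamentalForm cov ι X Y p = secondForm cov ι p (X p) (Y p) :=
  normalPart_covAlong_push ht hι hY _

lemma secondForm_comm (ht : cov.torsion = 0) (hι : IsSubmanifold E F ι)
    (v w : TangentSpace 𝓘(ℝ, E) p) : secondForm cov ι p v w = secondForm cov ι p w v := by
  have := secondFundamentalForm_comm ht hι (constField_smoothNear_self p v)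
    (constField_smoothNear_self p w)
  simpa only [secondFundamentalForm, secondForm, constField_self] using this

lemma secondForm_add_left (hι : IsSubmanifold E F ι) (u v w : TangentSpace 𝓘(ℝ, E) p) :
    secondForm cov ι p (u + v) w = secondForm cov ι p u w + secondForm cov ι p v w := by
  rw [secondForm, covAlong_vec_add cov hι.smooth (constField_smoothAlongNear hι w), normalPart_add]
  rfl

lemma secondForm_smul_left (hι : IsSubmanifold E F ι) (c : ℝ) (v w : TangentSpace 𝓘(ℝ, E) p) :
    secondForm cov ι p (c • v) w = c • secondForm cov ι p v w := by
  rw [secondForm, covAlong_vec_smul cov hι.smooth (constField_smoothAlongNear hι w),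
    normalPart_smul]
  rfl

/-- The Gauss formula. -/
lemma covAlong_push (ht : cov.torsion = 0) (hι : IsSubmanifold E F ι)
    {Y : ∀ q : M, TangentSpace 𝓘(ℝ, E) q} (hY : SmoothNear Y p) (v : TangentSpace 𝓘(ℝ, E) p) :
    covAlong cov ι (push ι Y) p v =
      mfderiv 𝓘(ℝ, E) 𝓘(ℝ, F) ι p (inducedConnection cov ι Y p v) +
        secondForm cov ι p v (Y p) := by
  rw [← normalPart_covAlong_push ht hι hY, inducedConnection,
    mfderiv_tangentPart_add_normalPart hι]

lemma SmoothNear.inducedConnection (hcov : cov.ContMDiffCovariantDerivative ∞)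
    (hι : IsSubmanifold E F ι) {X Y : ∀ q : M, TangentSpace 𝓘(ℝ, E) q} (hX : SmoothNear X p)
    (hY : SmoothNear Y p) :
    SmoothNear (fun q ↦ KaehlerSubmanifold.inducedConnection cov ι Y q (X q)) p :=
  ((hY.smoothAlongNear_push hι.smooth).covAlong hcov hι.smooth hX).smoothNear_tangentPart hι

lemma SmoothAlongNear.secondForm (hcov : cov.ContMDiffCovariantDerivative ∞)
    (ht : cov.torsion = 0) (hι : IsSubmanifold E F ι)
    {X Y : ∀ q : M, TangentSpace 𝓘(ℝ, E) q} (hX : SmoothNear X p) (hY : SmoothNear Y p) :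
    SmoothAlongNear (E := E) ι (fun q ↦ secondForm cov ι q (X q) (Y q)) p := by
  refine SmoothAlongNear.congr (((hY.smoothAlongNear_push hι.smooth).covAlong hcov
    hι.smooth hX).smoothAlongNear_normalPart hι) ?_
  filter_upwards [hY.eventually] with q hq
  exact (normalPart_covAlong_push ht hι hq _).symm

/-- The Gauss equation. -/
lemma inner_tangentCurvature (hcov : cov.ContMDiffCovariantDerivative ∞)
    (hm : CovariantDerivative.IsMetricCompatible (F := F)
      (V := fun x : N ↦ TangentSpace 𝓘(ℝ, F) x) cov) (ht : cov.torsion = 0)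
    (hι : IsSubmanifold E F ι) {X Y Z : ∀ q : M, TangentSpace 𝓘(ℝ, E) q} (hX : SmoothNear X p)
    (hY : SmoothNear Y p) (hZ : SmoothNear Z p) (w : TangentSpace 𝓘(ℝ, E) p) :
    inner ℝ (mfderiv 𝓘(ℝ, E) 𝓘(ℝ, F) ι p (tangentCurvature cov ι X Y Z p))
        (mfderiv 𝓘(ℝ, E) 𝓘(ℝ, F) ι p w) =
      inner ℝ (curvatureTensor cov (ι p) (push ι X p) (push ι Y p) (push ι Z p))
          (mfderiv 𝓘(ℝ, E) 𝓘(ℝ, F) ι p w) +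
        inner ℝ (secondForm cov ι p (Y p) (Z p)) (secondForm cov ι p (X p) w) -
        inner ℝ (secondForm cov ι p (X p) (Z p)) (secondForm cov ι p (Y p) w) := by
  have hZs := hZ.smoothAlongNear_push hι.smooth
  have hW := constField_smoothNear_self p w
  have hWs := constField_smoothAlongNear hι w
  have step : ∀ {A : ∀ q : M, TangentSpace 𝓘(ℝ, E) q}, SmoothNear A p →
      -- The Gauss formula splits the inner derivative. The contribution of its normal part is found
      -- by differentiating `⟨σ(A, Z), W⟩ = 0`, which produces the quadratic term in `σ`.
      ∀ v : TangentSpace 𝓘(ℝ, E) p,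
      inner ℝ (covAlong cov ι (fun q ↦ covAlong cov ι (push ι Z) q (A q)) p v)
        (mfderiv 𝓘(ℝ, E) 𝓘(ℝ, F) ι p w) =
      inner ℝ (mfderiv 𝓘(ℝ, E) 𝓘(ℝ, F) ι p (inducedConnection cov ι
          (fun q ↦ inducedConnection cov ι Z q (A q)) p v)) (mfderiv 𝓘(ℝ, E) 𝓘(ℝ, F) ι p w) -
        inner ℝ (secondForm cov ι p (A p) (Z p)) (secondForm cov ι p v w) := by
    intro A hA v
    have hI := SmoothNear.inducedConnection hcov hι hA hZ
    have hS := SmoothAlongNear.secondForm hcov ht hι hA hZ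
    have e : ∀ᶠ q in 𝓝 p, covAlong cov ι (push ι Z) q (A q) =
        push ι (fun q ↦ inducedConnection cov ι Z q (A q)) q + secondForm cov ι q (A q) (Z q) := by
      filter_upwards [hZ.eventually] with q hq
      exact covAlong_push ht hι hq _
    have hms := mvfderiv_inner_along hm hι.smooth hS hWs v
    have hz : (fun q ↦ inner ℝ (secondForm cov ι q (A q) (Z q)) (push ι (constField p w) q)) =
        fun _ ↦ (0 : ℝ) := by
      funext q
      exact inner_secondForm_mfderiv _ _ _
    rw [hz, mvfderiv_const, covAlong_push ht hι hW, push_constField_self, constField_self,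
      inner_add_right, real_inner_comm (mfderiv 𝓘(ℝ, E) 𝓘(ℝ, F) ι p _) (secondForm cov ι p _ _),
      inner_mfderiv_secondForm] at hms
    rw [covAlong_congr cov e, covAlong_add cov hι.smooth (hI.smoothAlongNear_push hι.smooth) hS,
      inner_add_left, covAlong_push ht hι hI, inner_add_left,
      inner_secondForm_mfderiv]
    simp only [zero_apply] at hms
    linarith
  have hc := curvature_covAlong hcov hι.smooth hX hY hZs
  rw [← hc, curvature, inner_sub_left, inner_sub_left, step hY, step hX, tangentCurvature,
    curvature, map_sub, map_sub, inner_sub_left, inner_sub_left, covAlong_push ht hι hZ,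
    inner_add_left, inner_secondForm_mfderiv]
  ring

end SecondForm

/-! ### Totally real submanifolds with parallel `f` -/

section TotallyReal

variable {E : Type*} [NormedAddCommGroup E] [NormedSpace ℝ E] [FiniteDimensional ℝ E]
  {M : Type*} [TopologicalSpace M] [T2Space M] [ChartedSpace E M] [IsManifold 𝓘(ℝ, E) ∞ M]
  {F : Type*} [NormedAddCommGroup F] [NormedSpace ℝ F] [FiniteDimensional ℝ F]
  {N : Type*} [TopologicalSpace N] [T2Space N] [ChartedSpace F N] [IsManifold 𝓘(ℝ, F) ∞ N]
  [RiemannianBundle (fun x : N ↦ TangentSpace 𝓘(ℝ, F) x)]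
  [IsContMDiffRiemannianBundle 𝓘(ℝ, F) ∞ F (fun x : N ↦ TangentSpace 𝓘(ℝ, F) x)]
  {cov : CovariantDerivative 𝓘(ℝ, F) F (fun x : N ↦ TangentSpace 𝓘(ℝ, F) x)}
  {J : ∀ x : N, TangentSpace 𝓘(ℝ, F) x →L[ℝ] TangentSpace 𝓘(ℝ, F) x}
  {ι : M → N} {p : M}

lemma IsKaehler.inner_left (h : IsKaehler cov J) (x : N) (v w : TangentSpace 𝓘(ℝ, F) x) :
    inner ℝ (J x v) w = -inner ℝ v (J x w) := by
  rw [← h.J_orthogonal, h.J_sq, inner_neg_left]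

lemma IsTotallyReal.inner_mfderiv (hreal : IsTotallyReal E J ι) (v w : TangentSpace 𝓘(ℝ, E) p) :
    inner ℝ (J (ι p) (mfderiv 𝓘(ℝ, E) 𝓘(ℝ, F) ι p v)) (mfderiv 𝓘(ℝ, E) 𝓘(ℝ, F) ι p w) = 0 := by
  rw [real_inner_comm]
  exact mem_tangentSubspace_orthogonal_iff.1 (hreal p _ (mfderiv_mem_tangentSubspace v)) w

lemma IsTotallyReal.smoothNormalNear (hreal : IsTotallyReal E J ι) (h : IsKaehler cov J)
    (hι : IsSubmanifold E F ι) {X : ∀ q : M, TangentSpace 𝓘(ℝ, E) q} (hX : SmoothNear X p) :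
    SmoothNormalNear E ι (fun q ↦ J (ι q) (push ι X q)) p :=
  ⟨(hX.smoothAlongNear_push hι.smooth).complexStructure h hι.smooth,
    .of_forall fun q ↦ hreal q _ (mfderiv_mem_tangentSubspace _)⟩

section

variable (h : IsKaehler cov J) (hι : IsSubmanifold E F ι)

include h hι

lemma covAlong_complexStructure_push {X : ∀ q : M, TangentSpace 𝓘(ℝ, E) q} (hX : SmoothNear X p)
    (v : TangentSpace 𝓘(ℝ, E) p) :
    covAlong cov ι (fun q ↦ J (ι q) (push ι X q)) p v =
      J (ι p) (mfderiv 𝓘(ℝ, E) 𝓘(ℝ, F) ι p (inducedConnection cov ι X p v)) +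
        J (ι p) (secondForm cov ι p v (X p)) := by
  rw [covAlong_complexStructure h hι.smooth (hX.smoothAlongNear_push hι.smooth),
    covAlong_push h.torsion_free hι hX, map_add]

/-- The `f`-structure vanishes on the first normal space if it is parallel. -/
lemma normalPart_complexStructure_secondForm (hreal : IsTotallyReal E J ι)
    (hf : HasParallelF E cov J ι) (v w : TangentSpace 𝓘(ℝ, E) p) :
    normalPart E ι p (J (ι p) (secondForm cov ι p v w)) = 0 := by
  have hW := constField_smoothNear_self p w
  -- Applied to the normal field `JW`, for which `f(JW)` is the normal part of `-W`, hence zero.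
  have key := hf p _ (hreal.smoothNormalNear h hι hW) v
  have hz : (fun q ↦ normalF E J ι q (J (ι q) (push ι (constField p w) q))) = fun _ ↦ 0 := by
    funext q
    rw [normalF, h.J_sq, normalPart_neg, push, normalPart_mfderiv hι, neg_zero]
  rw [hz, normalConnection, covAlong_zero cov hι.smooth, normalPart_zero, normalConnection,
    covAlong_complexStructure_push h hι hW, constField_self, normalPart_add,
    normalPart_of_mem_orthogonal hι (hreal p _ (mfderiv_mem_tangentSubspace _)), normalF, map_add,
    h.J_sq, normalPart_add, normalPart_neg, normalPart_mfderiv hι, neg_zero, zero_add] at key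
  set s := secondForm cov ι p v w
  have hs : s ∈ (tangentSubspace E ι p)ᗮ := secondForm_mem_orthogonal v w
  have hperp : ∀ {a : TangentSpace 𝓘(ℝ, F) (ι p)}, a ∈ (tangentSubspace E ι p)ᗮ →
      ∀ b, inner ℝ a (normalPart E ι p b) = inner ℝ a b := by
    intro a ha b
    rw [normalPart_eq hι, inner_sub_right, real_inner_comm (mfderiv 𝓘(ℝ, E) 𝓘(ℝ, F) ι p _) a,
      mem_tangentSubspace_orthogonal_iff.1 ha, sub_zero]
  -- At this point `key` says `f²s = 0`, and skewness gives `|fs|² = -⟨s, f²s⟩ = 0`.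
  rw [← inner_self_eq_zero (𝕜 := ℝ), hperp (normalPart_mem_orthogonal _), real_inner_comm,
    h.inner_left, ← hperp hs, ← key, inner_zero_right, neg_zero]

/-- The cubic form `⟨σ(u, v), J w⟩` is symmetric in `v` and `w`. -/
lemma inner_secondForm_comm (hreal : IsTotallyReal E J ι) (u v w : TangentSpace 𝓘(ℝ, E) p) :
    inner ℝ (secondForm cov ι p u v) (J (ι p) (mfderiv 𝓘(ℝ, E) 𝓘(ℝ, F) ι p w)) =
      inner ℝ (secondForm cov ι p u w) (J (ι p) (mfderiv 𝓘(ℝ, E) 𝓘(ℝ, F) ι p v)) := by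
  have hV := constField_smoothNear_self p v
  have hW := constField_smoothNear_self p w
  -- Differentiate `⟨JV, W⟩ = 0` along `u`; the tangential parts of the derivatives contribute
  -- nothing because `M` is totally real.
  have key := mvfderiv_inner_along h.metric hι.smooth
    ((constField_smoothAlongNear hι v).complexStructure h hι.smooth)
    (constField_smoothAlongNear hι w) u
  have hz : (fun q ↦ inner ℝ (J (ι q) (push ι (constField p v) q)) (push ι (constField p w) q)) =
      fun _ ↦ (0 : ℝ) :=
    funext fun q ↦ hreal.inner_mfderiv _ _
  rw [hz, mvfderiv_const, covAlong_complexStructure_push h hι hV,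
      covAlong_push h.torsion_free hι hW,
    push_constField_self, push_constField_self, constField_self, constField_self, inner_add_left,
    inner_add_right, hreal.inner_mfderiv, hreal.inner_mfderiv, h.inner_left,
    real_inner_comm (secondForm cov ι p u w)] at key
  simp only [zero_apply] at key
  linarith

variable (hreal : IsTotallyReal E J ι) (hf : HasParallelF E cov J ι)

include hreal hf

lemma mfderiv_tangentPart_complexStructure (v w : TangentSpace 𝓘(ℝ, E) p) :
    mfderiv 𝓘(ℝ, E) 𝓘(ℝ, F) ι p (tangentPart E ι p (J (ι p) (secondForm cov ι p v w))) =
      J (ι p) (secondForm cov ι p v w) := by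
  conv_rhs => rw [← mfderiv_tangentPart_add_normalPart hι (J (ι p) (secondForm cov ι p v w)),
    normalPart_complexStructure_secondForm h hι hreal hf, add_zero]

lemma shapeOperator_complexStructure_push {X : ∀ q : M, TangentSpace 𝓘(ℝ, E) q}
    (hX : SmoothNear X p) (v : TangentSpace 𝓘(ℝ, E) p) :
    shapeOperator cov ι (fun q ↦ J (ι q) (push ι X q)) p v =
      -tangentPart E ι p (J (ι p) (secondForm cov ι p v (X p))) := by
  rw [shapeOperator, covAlong_complexStructure_push h hι hX, tangentPart_add,
    tangentPart_of_mem_orthogonal hι (hreal p _ (mfderiv_mem_tangentSubspace _)), zero_add]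

/-- As `Jσ` is tangent, `⟨A_{Ja}A_{Jb}v, z⟩ = ⟨σ(b, v), σ(a, z)⟩`. Commuting shape operators
therefore exchange `a` and `b`; only the normal fields `JX` are needed. -/
lemma inner_secondForm_secondForm_comm (hcomm : HasCommutativeSecondForms E cov ι)
    (u v w z : TangentSpace 𝓘(ℝ, E) p) :
    inner ℝ (secondForm cov ι p u v) (secondForm cov ι p w z) =
      inner ℝ (secondForm cov ι p w v) (secondForm cov ι p u z) := by
  have ht := h.torsion_free
  have aux : ∀ a b : TangentSpace 𝓘(ℝ, E) p,
      inner ℝ (mfderiv 𝓘(ℝ, E) 𝓘(ℝ, F) ι p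
        (shapeOperator cov ι (fun q ↦ J (ι q) (push ι (constField p a) q)) p
          (shapeOperator cov ι (fun q ↦ J (ι q) (push ι (constField p b) q)) p v)))
        (mfderiv 𝓘(ℝ, E) 𝓘(ℝ, F) ι p z) =
      inner ℝ (secondForm cov ι p b v) (secondForm cov ι p a z) := by
    intro a b
    rw [shapeOperator_complexStructure_push h hι hreal hf (constField_smoothNear_self p a),
      shapeOperator_complexStructure_push h hι hreal hf (constField_smoothNear_self p b), map_neg,
      mfderiv_tangentPart_complexStructure h hι hreal hf, constField_self, constField_self,
      inner_neg_left, h.inner_left, neg_neg, secondForm_comm ht hι _ a,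
      inner_secondForm_comm h hι hreal, map_neg,
      mfderiv_tangentPart_complexStructure h hι hreal hf, map_neg, h.J_sq, neg_neg,
      real_inner_comm, secondForm_comm ht hι v b]
  rw [← aux, ← aux, hcomm p _ _ (hreal.smoothNormalNear h hι (constField_smoothNear_self p w))
    (hreal.smoothNormalNear h hι (constField_smoothNear_self p u))]

/-- The induced curvature is that of a space form. -/
lemma tangentCurvature_eq {μ : ℝ} (hμ : HasConstantHolomorphicCurvature cov J μ)
    (hcomm : HasCommutativeSecondForms E cov ι) {X Y Z : ∀ q : M, TangentSpace 𝓘(ℝ, E) q}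
    (hX : SmoothNear X p) (hY : SmoothNear Y p) (hZ : SmoothNear Z p) :
    tangentCurvature cov ι X Y Z p = (μ / 4) •
      (inner ℝ (push (F := F) ι Y p) (push (F := F) ι Z p) • X p -
      inner ℝ (push (F := F) ι X p) (push (F := F) ι Z p) • Y p) := by
  apply hι.injective p
  have key : ∀ w, inner ℝ (mfderiv 𝓘(ℝ, E) 𝓘(ℝ, F) ι p (tangentCurvature cov ι X Y Z p -
      (μ / 4) • (inner ℝ (push (F := F) ι Y p) (push ι Z p) • X p -
      inner ℝ (push (F := F) ι X p) (push ι Z p) • Y p))) (mfderiv 𝓘(ℝ, E) 𝓘(ℝ, F) ι p w) = 0 := by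
    intro w
    have hpush : ∀ A B : ∀ q : M, TangentSpace 𝓘(ℝ, E) q,
        inner ℝ (J (ι p) (push ι A p)) (push ι B p) = 0 := fun A B ↦ hreal.inner_mfderiv _ _
    -- The two `σ`-terms of the Gauss equation cancel by commutativity, and the ambient term is the
    -- one for totally real vectors.
    rw [map_sub, inner_sub_left, inner_tangentCurvature h.smooth_cov h.metric h.torsion_free hι hX
      hY hZ w, inner_secondForm_secondForm_comm h hι hreal hf hcomm (Y p),
      inner_curvatureTensor_of_totallyReal h hμ (ι p) (hpush X Y) (hpush X Z) (hpush Y Z),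
          map_smul, map_sub, map_smul, map_smul,
      inner_smul_left, inner_sub_left, inner_smul_left, inner_smul_left]
    simp only [conj_trivial, push]
    ring
  rw [← sub_eq_zero, ← map_sub, ← inner_self_eq_zero (𝕜 := ℝ)]
  exact key _

lemma isFlat_of_holomorphicCurvature_eq_zero (hμ : HasConstantHolomorphicCurvature cov J 0)
    (hcomm : HasCommutativeSecondForms E cov ι) : IsFlat E cov ι := by
  intro p X Y Z hX hY hZ
  rw [tangentCurvature_eq h hι hreal hf hμ hcomm hX hY hZ, zero_div, zero_smul]

end

end TotallyReal

/-! ### Semiparallel submanifolds with nonzero `μ` -/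

section Semiparallel

variable {E : Type*} [NormedAddCommGroup E] [NormedSpace ℝ E] [FiniteDimensional ℝ E]
  {M : Type*} [TopologicalSpace M] [T2Space M] [ChartedSpace E M] [IsManifold 𝓘(ℝ, E) ∞ M]
  {F : Type*} [NormedAddCommGroup F] [NormedSpace ℝ F] [FiniteDimensional ℝ F]
  {N : Type*} [TopologicalSpace N] [T2Space N] [ChartedSpace F N] [IsManifold 𝓘(ℝ, F) ∞ N]
  [RiemannianBundle (fun x : N ↦ TangentSpace 𝓘(ℝ, F) x)]
  [IsContMDiffRiemannianBundle 𝓘(ℝ, F) ∞ F (fun x : N ↦ TangentSpace 𝓘(ℝ, F) x)]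
  {cov : CovariantDerivative 𝓘(ℝ, F) F (fun x : N ↦ TangentSpace 𝓘(ℝ, F) x)}
  {J : ∀ x : N, TangentSpace 𝓘(ℝ, F) x →L[ℝ] TangentSpace 𝓘(ℝ, F) x}
  {ι : M → N} {p : M}

lemma normalCurvature_congr (X Y : ∀ q : M, TangentSpace 𝓘(ℝ, E) q)
    {ξ η : ∀ q : M, TangentSpace 𝓘(ℝ, F) (ι q)} (hξ : ∀ᶠ q in 𝓝 p, ξ q = η q) :
    normalCurvature cov ι X Y ξ p = normalCurvature cov ι X Y η p := by
  have e : ∀ A : ∀ q : M, TangentSpace 𝓘(ℝ, E) q,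
      ∀ᶠ q in 𝓝 p, normalConnection cov ι ξ q (A q) = normalConnection cov ι η q (A q) := by
    intro A
    filter_upwards [hξ.eventually_nhds] with q hq
    rw [normalConnection, normalConnection, covAlong_congr cov hq]
  simp only [normalCurvature, curvature]
  rw [normalConnection, normalConnection, normalConnection, covAlong_congr cov (e Y),
    covAlong_congr cov (e X), covAlong_congr cov hξ]
  rfl

variable (h : IsKaehler cov J) (hι : IsSubmanifold E F ι) (hreal : IsTotallyReal E J ι)
  (hf : HasParallelF E cov J ι)

include h hι hreal hf

/-- The only other term of `∇(JT)` is `Jσ`, which is tangent. So `J` intertwines `∇` with `D`, and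
iterating gives the corresponding statement for the curvatures. -/
lemma normalConnection_complexStructure_push {T : ∀ q : M, TangentSpace 𝓘(ℝ, E) q}
    (hT : SmoothNear T p) (v : TangentSpace 𝓘(ℝ, E) p) :
    normalConnection cov ι (fun q ↦ J (ι q) (push ι T q)) p v =
      J (ι p) (mfderiv 𝓘(ℝ, E) 𝓘(ℝ, F) ι p (inducedConnection cov ι T p v)) := by
  rw [normalConnection, covAlong_complexStructure_push h hι hT, normalPart_add,
    normalPart_complexStructure_secondForm h hι hreal hf, add_zero,
    normalPart_of_mem_orthogonal hι (hreal p _ (mfderiv_mem_tangentSubspace _))]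

/-- `J` intertwines the curvatures of the tangent and of the normal bundle. -/
lemma normalCurvature_complexStructure_push {X Y T : ∀ q : M, TangentSpace 𝓘(ℝ, E) q}
    (hX : SmoothNear X p) (hY : SmoothNear Y p) (hT : SmoothNear T p) :
    normalCurvature cov ι X Y (fun q ↦ J (ι q) (push ι T q)) p =
      J (ι p) (mfderiv 𝓘(ℝ, E) 𝓘(ℝ, F) ι p (tangentCurvature cov ι X Y T p)) := by
  have e : ∀ {A : ∀ q : M, TangentSpace 𝓘(ℝ, E) q}, SmoothNear A p → ∀ v,
      normalConnection cov ι
        (fun q ↦ normalConnection cov ι (fun q ↦ J (ι q) (push ι T q)) q (A q)) p v =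
      J (ι p) (mfderiv 𝓘(ℝ, E) 𝓘(ℝ, F) ι p
        (inducedConnection cov ι (fun q ↦ inducedConnection cov ι T q (A q)) p v)) := by
    intro A hA v
    rw [← normalConnection_complexStructure_push h hι hreal hf
      (SmoothNear.inducedConnection h.smooth_cov hι hA hT), normalConnection, normalConnection]
    congr 1
    refine covAlong_congr cov ?_ v
    filter_upwards [hT.eventually] with q hq
    exact normalConnection_complexStructure_push h hι hreal hf hq _
  rw [normalCurvature, curvature, e hY, e hX,
    normalConnection_complexStructure_push h hι hreal hf hT, tangentCurvature, curvature]
  simp only [map_sub]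

/-- Semiparallelity for `X = x`, `Y = Z = U = y`, divided by `μ/4`. Here `R^⊥(x, y)σ(y, y) = JR(x,
y)T` with `T = -Jσ(y, y)`, and `R(x, y)y = (μ/4)|y|²x` accounts for both terms on the right. -/
lemma semiparallel_identity {μ : ℝ} (hμ : HasConstantHolomorphicCurvature cov J μ)
    (hcomm : HasCommutativeSecondForms E cov ι) (hsemi : IsSemiparallel E cov ι) (hμ0 : μ ≠ 0)
    {x y : TangentSpace 𝓘(ℝ, E) p} (hxy : inner ℝ (mfderiv 𝓘(ℝ, E) 𝓘(ℝ, F) ι p x)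
      (mfderiv 𝓘(ℝ, E) 𝓘(ℝ, F) ι p y) = 0) :
    inner ℝ (secondForm cov ι p y y) (J (ι p) (mfderiv 𝓘(ℝ, E) 𝓘(ℝ, F) ι p y)) •
        J (ι p) (mfderiv 𝓘(ℝ, E) 𝓘(ℝ, F) ι p x) -
      inner ℝ (secondForm cov ι p y y) (J (ι p) (mfderiv 𝓘(ℝ, E) 𝓘(ℝ, F) ι p x)) •
        J (ι p) (mfderiv 𝓘(ℝ, E) 𝓘(ℝ, F) ι p y) =
      (2 * inner ℝ (mfderiv 𝓘(ℝ, E) 𝓘(ℝ, F) ι p y) (mfderiv 𝓘(ℝ, E) 𝓘(ℝ, F) ι p y)) •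
        secondForm cov ι p x y := by
  have ht := h.torsion_free
  have hX := constField_smoothNear_self p x
  have hY := constField_smoothNear_self p y
  have hXs := constField_smoothAlongNear hι x
  have hYs := constField_smoothAlongNear hι y
  set X := constField p x
  set Y := constField p y
  have hXp : X p = x := constField_self p x
  have hYp : Y p = y := constField_self p y
  set S : ∀ q : M, TangentSpace 𝓘(ℝ, F) (ι q) := fun q ↦ secondForm cov ι q (Y q) (Y q)
  have hS : SmoothAlongNear (E := E) ι S p := SmoothAlongNear.secondForm h.smooth_cov ht hι hY hY
  have hJS := hS.complexStructure h hι.smooth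
  -- Chosen so that `JT = σ(Y, Y)`. The tangential projection loses nothing, since `Jσ` is tangent.
  set T : ∀ q : M, TangentSpace 𝓘(ℝ, E) q := fun q ↦ tangentPart E ι q ((-1 : ℝ) • J (ι q) (S q))
  have hT : SmoothNear T p :=
    (hJS.smul hι.smooth (.const (-1))).smoothNear_tangentPart hι
  have hpT : ∀ q, push ι T q = -J (ι q) (S q) := by
    intro q
    simp only [push, T, S]
    rw [tangentPart_smul, map_smul, neg_one_smul,
      mfderiv_tangentPart_complexStructure h hι hreal hf]
  have hN : normalCurvature cov ι X Y (secondFundamentalForm cov ι Y Y) p =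
      J (ι p) (mfderiv 𝓘(ℝ, E) 𝓘(ℝ, F) ι p (tangentCurvature cov ι X Y T p)) := by
    rw [← normalCurvature_complexStructure_push h hι hreal hf hX hY hT]
    refine normalCurvature_congr X Y ?_
    filter_upwards [hY.eventually] with q hq
    rw [secondFundamentalForm_eq ht hι Y hq, hpT, map_neg, h.J_sq, neg_neg]
  -- The space-form expression for `R(X, Y)Y`, as a field. In `σ(Y, R(X, Y)Y)` the curvature field
  -- is differentiated, so its value at `p` is not enough: agreement with a smooth field near `p` is
  -- used.
  set W : ∀ q : M, TangentSpace 𝓘(ℝ, E) q := fun q ↦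
    (μ / 4) • (inner ℝ (push (F := F) ι Y q) (push ι Y q) • X q -
      inner ℝ (push (F := F) ι X q) (push ι Y q) • Y q) with hW
  have hWs : SmoothNear W p := by
    refine SmoothAlongNear.smul (ι := fun q : M ↦ q) contMDiff_id' (.const (μ / 4))
      (SmoothAlongNear.sub (ι := fun q : M ↦ q) contMDiff_id' ?_ ?_)
    · exact .smul (ι := fun q : M ↦ q) contMDiff_id' (hYs.smoothFnNear_inner hYs) hX
    · exact .smul (ι := fun q : M ↦ q) contMDiff_id' (hXs.smoothFnNear_inner hYs) hY
  have hRW : ∀ᶠ q in 𝓝 p, tangentCurvature cov ι X Y Y q = W q := by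
    filter_upwards [hX.eventually, hY.eventually] with q hXq hYq
    exact tangentCurvature_eq h hι hreal hf hμ hcomm hXq hYq hYq
  have hWp : W p = (μ / 4 * inner ℝ (mfderiv 𝓘(ℝ, E) 𝓘(ℝ, F) ι p y)
      (mfderiv 𝓘(ℝ, E) 𝓘(ℝ, F) ι p y)) • x := by
    simp only [hW, push, hXp, hYp, hxy, zero_smul, sub_zero, mul_smul]
  have h1 : secondFundamentalForm cov ι (tangentCurvature cov ι X Y Y) Y p =
      secondForm cov ι p (W p) y := by
    rw [secondFundamentalForm_eq ht hι _ hY, hRW.self_of_nhds, hYp]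
  have h2 : secondFundamentalForm cov ι Y (tangentCurvature cov ι X Y Y) p =
      secondForm cov ι p (W p) y := by
    rw [secondForm_comm ht hι, ← hYp, ← secondFundamentalForm_eq ht hι Y hWs,
      secondFundamentalForm, secondFundamentalForm]
    congr 1
    refine covAlong_congr cov (hRW.mono fun q hq ↦ ?_) _
    rw [push, push, hq]
  have key := hsemi p X Y Y Y hX hY hY hY
  have hin : ∀ z, inner ℝ (mfderiv 𝓘(ℝ, E) 𝓘(ℝ, F) ι p z) (-J (ι p) (S p)) =
      inner ℝ (secondForm cov ι p y y) (J (ι p) (mfderiv 𝓘(ℝ, E) 𝓘(ℝ, F) ι p z)) := by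
    intro z
    rw [inner_neg_right, real_inner_comm, h.inner_left, neg_neg]
    simp only [S, hYp]
  rw [hN, h1, h2, tangentCurvature_eq h hι hreal hf hμ hcomm hX hY hT, hpT, push, push, hXp, hYp,
    hin, hin, hWp, secondForm_smul_left hι] at key
  simp only [map_smul, map_sub] at key
  have h4 : μ / 4 ≠ 0 := by positivity
  apply smul_right_injective _ h4
  beta_reduce
  rw [← sub_eq_zero, ← key]
  module

/-- The symmetric cubic form `C` vanishes on the diagonal by `semiparallel_identity`, hence
identically, and it determines `σ` because `Jσ` is tangent. -/
lemma secondForm_eq_zero (hE : 1 < Module.finrank ℝ E) {μ : ℝ}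
    (hμ : HasConstantHolomorphicCurvature cov J μ)
    (hcomm : HasCommutativeSecondForms E cov ι) (hsemi : IsSemiparallel E cov ι) (hμ0 : μ ≠ 0)
    (v w : TangentSpace 𝓘(ℝ, E) p) : secondForm cov ι p v w = 0 := by
  have ht := h.torsion_free
  set d := mfderiv 𝓘(ℝ, E) 𝓘(ℝ, F) ι p with hd
  set C : TangentSpace 𝓘(ℝ, E) p → TangentSpace 𝓘(ℝ, E) p → TangentSpace 𝓘(ℝ, E) p → ℝ :=
    fun u v w ↦ inner ℝ (secondForm cov ι p u v) (J (ι p) (d w)) with hC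
  have hC1 : ∀ u v w, C u v w = C v u w := fun u v w ↦ by
    simp only [hC, secondForm_comm ht hι u v]
  have hC2 : ∀ u v w, C u v w = C u w v := fun u v w ↦ inner_secondForm_comm h hι hreal u v w
  have hCadd : ∀ u u' v w, C (u + u') v w = C u v w + C u' v w := fun u u' v w ↦ by
    simp only [hC, secondForm_add_left hι, inner_add_left]
  have hCneg : ∀ u v w, C (-u) v w = -C u v w := fun u v w ↦ by
    have := secondForm_smul_left (cov := cov) hι (-1) u v
    rw [neg_one_smul, neg_one_smul] at this
    simp only [hC, this, inner_neg_left]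
  have hpos : ∀ {u}, u ≠ 0 → inner ℝ (d u) (d u) ≠ 0 := by
    intro u hu h0
    rw [inner_self_eq_zero] at h0
    exact hu (hι.injective p (h0.trans (map_zero d).symm))
  have hJd : ∀ a b, inner ℝ (J (ι p) (d a)) (J (ι p) (d b)) = inner ℝ (d a) (d b) := fun a b ↦
    h.J_orthogonal _ _ _
  have hxyy : ∀ x y, inner ℝ (d x) (d y) = 0 → C x y y = 0 := by
    intro x y hxy
    by_cases hy : y = 0
    · simp only [hC, hy, map_zero, inner_zero_right]
    -- Pairing with `Jy` gives `-C(y, y, x)|y|² = 2|y|²C(x, y, y)`; by symmetry of `C` this is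
    -- `3|y|²C(x, y, y) = 0`.
    have e := congr(inner ℝ $(semiparallel_identity h hι hreal hf hμ hcomm hsemi hμ0 hxy)
      (J (ι p) (d y)))
    simp only [inner_sub_left, inner_smul_left, conj_trivial, ← hd, hJd, hxy] at e
    change C y y y * 0 - C y y x * _ = 2 * _ * C x y y at e
    rw [show C y y x = C x y y by rw [hC2, hC1]] at e
    have : 3 * inner ℝ (d y) (d y) * C x y y = 0 := by linarith
    exact (mul_eq_zero.1 this).resolve_left (mul_ne_zero three_ne_zero (hpos hy))
  have hyyy : ∀ y, C y y y = 0 := by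
    intro y
    obtain ⟨x, hxy, hx⟩ : ∃ x, inner ℝ (d x) (d y) = 0 ∧ x ≠ 0 := by
      let f : E →ₗ[ℝ] ℝ := ((innerₗ (TangentSpace 𝓘(ℝ, F) (ι p))) (d y)).comp d.toLinearMap
      -- A linear functional on a space of dimension greater than one has a nonzero kernel vector;
      -- this is where `n > 1` enters.
      have hf : LinearMap.ker f ≠ ⊥ := LinearMap.ker_ne_bot_of_finrank_lt (by simpa using hE)
      obtain ⟨x, hx, hx0⟩ := (Submodule.ne_bot_iff _).1 hf
      refine ⟨x, ?_, hx0⟩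
      rw [real_inner_comm]
      exact hx
    -- Pairing with `Jx` gives `C(y, y, y)|x|² = 2|y|²C(y, x, x)`, and the right side vanishes by
    -- `hxyy` with the roles of `x` and `y` exchanged.
    have e := congr(inner ℝ $(semiparallel_identity h hι hreal hf hμ hcomm hsemi hμ0 hxy)
      (J (ι p) (d x)))
    simp only [inner_sub_left, inner_smul_left, conj_trivial, ← hd, hJd] at e
    rw [real_inner_comm (d x) (d y), hxy] at e
    change C y y y * _ - C y y x * 0 = 2 * _ * C x y x at e
    rw [show C x y x = C y x x by rw [hC1], hxyy y x (by rwa [real_inner_comm])] at e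
    have : C y y y * inner ℝ (d x) (d x) = 0 := by linarith
    exact (mul_eq_zero.1 this).resolve_right (hpos hx)
  have hCadd2 : ∀ u v v' w, C u (v + v') w = C u v w + C u v' w := fun u v v' w ↦ by
    rw [hC1, hCadd, hC1 v, hC1 v']
  have hCadd3 : ∀ u v w w', C u v (w + w') = C u v w + C u v w' := fun u v w w' ↦ by
    rw [hC2, hCadd2, hC2 _ w, hC2 _ w']
  have hCneg2 : ∀ u v w, C u (-v) w = -C u v w := fun u v w ↦ by rw [hC1, hCneg, hC1]
  have hCneg3 : ∀ u v w, C u v (-w) = -C u v w := fun u v w ↦ by rw [hC2, hCneg2, hC2]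
  have hyyz : ∀ y z, C y y z = 0 := by
    intro y z
    -- The difference of the cubic values at `y + z` and `y - z` isolates `6C(y, y, z)`.
    have e1 := hyyy (y + z)
    have e2 := hyyy (y + -z)
    simp only [hCadd, hCadd2, hCadd3, hCneg, hCneg2, hCneg3, hyyy] at e1 e2
    have a1 : C y z y = C y y z := hC2 _ _ _
    have a2 : C z y y = C y y z := by rw [hC1, a1]
    linarith
  have hall : ∀ z, C v w z = 0 := by
    intro z
    have e1 := hyyz (v + w) z
    simp only [hCadd, hCadd2, hyyz, hC1 w v] at e1
    linarith
  -- For `z` with `dι(z) = Jσ(v, w)` one gets `C(v, w, z) = ⟨σ(v, w), J²σ(v, w)⟩ = -|σ(v, w)|²`.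
  have := hall (tangentPart E ι p (J (ι p) (secondForm cov ι p v w)))
  simp only [hC, hd, mfderiv_tangentPart_complexStructure h hι hreal hf, h.J_sq, inner_neg_right,
    neg_eq_zero, inner_self_eq_zero] at this
  exact this

lemma isTotallyGeodesic_of_holomorphicCurvature_ne_zero (hE : 1 < Module.finrank ℝ E) {μ : ℝ}
    (hμ : HasConstantHolomorphicCurvature cov J μ)
    (hcomm : HasCommutativeSecondForms E cov ι) (hsemi : IsSemiparallel E cov ι) (hμ0 : μ ≠ 0) :
    IsTotallyGeodesic E cov ι := by
  intro p X Y _ hY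
  rw [secondFundamentalForm_eq h.torsion_free hι X hY,
    secondForm_eq_zero h hι hreal hf hE hμ hcomm hsemi hμ0]

end Semiparallel

end KaehlerSubmanifold

end

theorem proposition2 {n m : ℕ} (hn : 1 < n)
    {M : Type*} [TopologicalSpace M] [T2Space M]
    [ChartedSpace (EuclideanSpace ℝ (Fin n)) M] [IsManifold (𝓡 n) ∞ M]
    {N : Type*} [TopologicalSpace N] [T2Space N]
    [ChartedSpace (EuclideanSpace ℝ (Fin (2 * m))) N] [IsManifold (𝓡 (2 * m)) ∞ N]
    [RiemannianBundle (fun x : N ↦ TangentSpace (𝓡 (2 * m)) x)]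
    [IsContMDiffRiemannianBundle (𝓡 (2 * m)) ∞ (EuclideanSpace ℝ (Fin (2 * m)))
      (fun x : N ↦ TangentSpace (𝓡 (2 * m)) x)]
    (cov : CovariantDerivative (𝓡 (2 * m)) (EuclideanSpace ℝ (Fin (2 * m)))
      (fun x : N ↦ TangentSpace (𝓡 (2 * m)) x))
    (J : ∀ x : N, TangentSpace (𝓡 (2 * m)) x →L[ℝ] TangentSpace (𝓡 (2 * m)) x)
    (μ : ℝ)
    (hN : KaehlerSubmanifold.IsKaehler cov J)
    (hμ : KaehlerSubmanifold.HasConstantHolomorphicCurvature cov J μ)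
    (ι : M → N)
    (hι : KaehlerSubmanifold.IsSubmanifold (EuclideanSpace ℝ (Fin n))
      (EuclideanSpace ℝ (Fin (2 * m))) ι)
    (hreal : KaehlerSubmanifold.IsTotallyReal (EuclideanSpace ℝ (Fin n)) J ι)
    (hsemi : KaehlerSubmanifold.IsSemiparallel (EuclideanSpace ℝ (Fin n)) cov ι)
    (hcomm : KaehlerSubmanifold.HasCommutativeSecondForms (EuclideanSpace ℝ (Fin n)) cov ι)
    (hf : KaehlerSubmanifold.HasParallelF (EuclideanSpace ℝ (Fin n)) cov J ι) :
    KaehlerSubmanifold.IsTotallyGeodesic (EuclideanSpace ℝ (Fin n)) cov ι ∨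
      KaehlerSubmanifold.IsFlat (EuclideanSpace ℝ (Fin n)) cov ι := by
  by_cases hμ0 : μ = 0
  · subst hμ0
    exact .inr (KaehlerSubmanifold.isFlat_of_holomorphicCurvature_eq_zero hN hι hreal hf hμ hcomm)
  · exact .inl (KaehlerSubmanifold.isTotallyGeodesic_of_holomorphicCurvature_ne_zero hN hι hreal hf
      (by simpa using hn) hμ hcomm hsemi hμ0)
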